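/- Let $0<\alpha<1$. There is a constant $c>0$, depending only on $\alpha$, with the following property. Let $\Omega\subset\mathbb R^d$, $d\in\{1,2\}$, be a bounded domain, let $A v=-\sum_{i,j}\partial_i(a_{ij}\partial_j v)+qv$ be a self-adjoint, uniformly elliptic, positive definite second-order differential operator on $\Omega$ with homogeneous Dirichlet boundary condition and bounded measurable real coefficients, and let $A(\cdot,\cdot)$ be its bilinear form. Let $X_h\subset H_0^1(\Omega)$ be the space of continuous piecewise linear finite elements, vanishing on $\partial\Omega$, on a conforming finite triangulation of $\overline\Omega$; let $(\cdot,\cdot)$ and $\|\cdot\|$ be the inner product and norm of $L^2(\Omega)$, $P_h:L^2(\Omega)\to X_h$ the $L^2$-projection, and $A_h:X_h\to X_h$ the operator with $(A_h\varphi,\psi)=A(\varphi,\psi)$ for all $\varphi,\psi\in X_h$. Let $T>0$, $N\ge 1$, $\tau=T/N$, $t_n=n\tau$, and $u^0\in L^2(\Omega)$. For a source term $f$ put $f_h=P_hf$, and let $u_h:[0,T]\to X_h$ be the (absolutely continuous) solution of the semidiscrete sub-diffusion problem $$\bigl({}^{C}D_t^\alpha u_h(t),\varphi\bigr)+A(u_h(t),\varphi)=(f(t),\varphi)\quad\forall\varphi\in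 X_h,\ \text{a.e. } t\in(0,T],\qquad u_h(0)=P_hu^0,$$ where ${}^{C}D_t^\alpha u(t)=\frac1{\Gamma(1-\alpha)}\int_0^t(t-\zeta)^{-\alpha}u'(\zeta)\,d\zeta$ is the Caputo derivative. Let $\sigma_0=1$, $\sigma_j=\bigl(1-\frac{\alpha+1}{j}\bigr)\sigma_{j-1}$ for $j\ge1$, and $D_\tau g^n=\tau^{-1}\bigl(\tfrac32g^n-2g^{n-1}+\tfrac12g^{n-2}\bigr)$. The scheme CN-I seeks $\tilde U_h^n,\tilde u_h^n\in X_h$ such that, for $1\le n\le N$, $$\tau^{-\alpha}\sum_{j=0}^n\sigma_j\tilde U_h^{n-j}+\bigl(1-\tfrac\alpha2\bigr)A_h\tilde U_h^n+\tfrac\alpha2A_h\tilde U_h^{n-1}=\bigl(1-\tfrac\alpha2\bigr)S^n+\tfrac\alpha2S^{n-1}+\Bigl(\bigl(1-\tfrac\alpha2\bigr)D_\tau G^n+\tfrac\alpha2D_\tau G^{n-1}\Bigr)u_h(0),$$ $$\tilde u_h^n=D_\tau\tilde U_h^n,$$ where $S^n=F_h(t_n)$, $F_h(t)=\int_0^tf_h(\xi)\,d\xi$,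 and $G^n=t_n^{2-\alpha}/\Gamma(3-\alpha)$; the quantities $\tilde U_h^n$, $G^n$, $F_h(t_n)$ are set to zero for $n\le0$. The scheme CN-II is the same with $S^n=D_\tau\tilde F_h(t_n)$ instead, where $\tilde F_h(t)=\int_0^tF_h(\xi)\,d\xi$, also set to zero for $t\le 0$. In the homogeneous case $f\equiv0$ the schemes CN-I and CN-II have the same solutions, and the solution of either scheme satisfies $$\|u_h(t_n)-\tilde u_h^n\|\le c\,\tau^2\,t_n^{-2}\,\|u^0\|,\qquad n=1,\dots,N.$$ -/

import Mathlib

open MeasureTheory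

namespace SubDiffusion

/-! ### Domain, elliptic operator, finite element space -/

/-- A bounded domain: a bounded, open, connected (in particular nonempty) subset of `ℝᵈ`. -/
structure BoundedDomain (d : ℕ) where
  carrier : Set (EuclideanSpace ℝ (Fin d))
  isOpen : IsOpen carrier
  isConnected : IsConnected carrier
  isBounded : Bornology.IsBounded carrier

/-- Lebesgue measure restricted to the domain. -/
noncomputable abbrev BoundedDomain.vol {d : ℕ} (Ω : BoundedDomain d) :
    Measure (EuclideanSpace ℝ (Fin d)) :=
  volume.restrict Ω.carrier

/-- The real Hilbert space `L²(Ω)`. -/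
abbrev BoundedDomain.L2 {d : ℕ} (Ω : BoundedDomain d) : Type :=
  Lp ℝ 2 Ω.vol

/-- The partial derivative `∂ᵢ v (x)`. -/
noncomputable def partialDeriv {d : ℕ} (i : Fin d) (v : EuclideanSpace ℝ (Fin d) → ℝ)
    (x : EuclideanSpace ℝ (Fin d)) : ℝ :=
  fderiv ℝ v x (EuclideanSpace.single i 1)

/-- The bilinear form `A(v, w) = ∫_Ω (∑ᵢⱼ aᵢⱼ ∂ⱼv ∂ᵢw + q v w) dx` of the differential operator
`A v = -∑ᵢⱼ ∂ᵢ(aᵢⱼ ∂ⱼ v) + q v`.  It is only used for Lipschitz functions `v`, `w`, whose classical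
derivatives exist almost everywhere and are their weak derivatives. -/
noncomputable def ellipticForm {d : ℕ} (Ω : BoundedDomain d)
    (a : EuclideanSpace ℝ (Fin d) → Matrix (Fin d) (Fin d) ℝ)
    (q : EuclideanSpace ℝ (Fin d) → ℝ) (v w : EuclideanSpace ℝ (Fin d) → ℝ) : ℝ :=
  ∫ x, ((∑ i, ∑ j, a x i j * partialDeriv j v x * partialDeriv i w x) + q x * v x * w x) ∂Ω.vol

/-- A self-adjoint positive definite second-order elliptic operator
`A v = -∑ᵢⱼ ∂ᵢ(aᵢⱼ ∂ⱼ v) + q v` on `Ω` with homogeneous Dirichlet boundary condition: the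
coefficients are bounded and measurable on `Ω`, the matrix `a` is symmetric and uniformly positive
definite, and the operator is positive definite, `(A v, v) ≥ c₀ ‖v‖²` with `c₀ > 0`.
The last inequality is required for the Lipschitz functions that vanish outside `Ω`; they form a
dense subspace of `H₀¹(Ω)`, so that this is the same as requiring it on `H₀¹(Ω)`. -/
structure EllipticOperator {d : ℕ} (Ω : BoundedDomain d) where
  a : EuclideanSpace ℝ (Fin d) → Matrix (Fin d) (Fin d) ℝ
  q : EuclideanSpace ℝ (Fin d) → ℝ
  measurable_a : ∀ i j, AEStronglyMeasurable (fun x => a x i j) Ω.vol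
  measurable_q : AEStronglyMeasurable q Ω.vol
  bounded_a : ∃ M : ℝ, ∀ x ∈ Ω.carrier, ∀ i j, |a x i j| ≤ M
  bounded_q : ∃ M : ℝ, ∀ x ∈ Ω.carrier, |q x| ≤ M
  symmetric : ∀ x ∈ Ω.carrier, ∀ i j, a x i j = a x j i
  elliptic : ∃ κ : ℝ, 0 < κ ∧ ∀ x ∈ Ω.carrier, ∀ ξ : Fin d → ℝ,
    κ * ∑ i, ξ i ^ 2 ≤ ∑ i, ∑ j, a x i j * ξ j * ξ i
  posDef : ∃ c₀ : ℝ, 0 < c₀ ∧ ∀ v : EuclideanSpace ℝ (Fin d) → ℝ,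
    (∃ C : NNReal, LipschitzWith C v) → (∀ x, x ∉ Ω.carrier → v x = 0) →
      c₀ * ∫ x, v x ^ 2 ∂Ω.vol ≤ ellipticForm Ω a q v v

/-- The bilinear form associated with an elliptic operator. -/
noncomputable def EllipticOperator.form {d : ℕ} {Ω : BoundedDomain d} (A : EllipticOperator Ω)
    (v w : EuclideanSpace ℝ (Fin d) → ℝ) : ℝ :=
  ellipticForm Ω A.a A.q v w

/-- A (conforming) triangulation of `Ω`: a finite simplicial complex, so that two simplices meet
in a common face or not at all, whose simplices cover exactly the closure of `Ω`. -/
structure Triangulation {d : ℕ} (Ω : BoundedDomain d) where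
  complex : Geometry.SimplicialComplex ℝ (EuclideanSpace ℝ (Fin d))
  finite : complex.faces.Finite
  space_eq : complex.space = closure Ω.carrier

/-- The space `X_h ⊂ H₀¹(Ω)` of continuous piecewise linear finite elements: continuous functions,
affine on every simplex, zero on `∂Ω`, and extended by zero to all of `ℝᵈ`. -/
def Triangulation.space {d : ℕ} {Ω : BoundedDomain d} (K : Triangulation Ω) :
    Submodule ℝ (EuclideanSpace ℝ (Fin d) → ℝ) where
  carrier := {v | Continuous v ∧ (∀ x, x ∉ Ω.carrier → v x = 0) ∧
    ∀ s ∈ K.complex.faces, ∃ g : EuclideanSpace ℝ (Fin d) →ᵃ[ℝ] ℝ,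
      ∀ x ∈ convexHull ℝ (s : Set (EuclideanSpace ℝ (Fin d))), v x = g x}
  add_mem' := by
    rintro v w ⟨hv, hv0, hva⟩ ⟨hw, hw0, hwa⟩
    refine ⟨hv.add hw, fun x hx => by simp [hv0 x hx, hw0 x hx], fun s hs => ?_⟩
    obtain ⟨g, hg⟩ := hva s hs
    obtain ⟨k, hk⟩ := hwa s hs
    exact ⟨g + k, fun x hx => by simp [hg x hx, hk x hx]⟩
  zero_mem' := ⟨continuous_zero, fun _ _ => rfl, fun _ _ => ⟨0, fun _ _ => rfl⟩⟩
  smul_mem' := by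
    rintro c v ⟨hv, hv0, hva⟩
    refine ⟨hv.const_smul c, fun x hx => by simp [hv0 x hx], fun s hs => ?_⟩
    obtain ⟨g, hg⟩ := hva s hs
    exact ⟨c • g, fun x hx => by simp [hg x hx]⟩

theorem Triangulation.memLp {d : ℕ} {Ω : BoundedDomain d} (K : Triangulation Ω) (v : K.space) :
    MemLp (v : EuclideanSpace ℝ (Fin d) → ℝ) 2 Ω.vol := by
  refine (v.2.1.memLp_of_hasCompactSupport (μ := volume) ?_).restrict _
  refine HasCompactSupport.intro (Ω.isBounded.isCompact_closure) fun x hx => ?_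
  exact v.2.2.1 x fun h => hx (subset_closure h)

/-- The inclusion `X_h ⊂ L²(Ω)`. -/
noncomputable def Triangulation.toL2 {d : ℕ} {Ω : BoundedDomain d} (K : Triangulation Ω) :
    K.space →ₗ[ℝ] Ω.L2 where
  toFun v := (K.memLp v).toLp v
  map_add' v w := MemLp.toLp_add (K.memLp v) (K.memLp w)
  map_smul' c v := MemLp.toLp_const_smul c (K.memLp v)

/-- `v = P_h g`, the `L²(Ω)`-projection of `g` onto `X_h`:
`(v, ψ) = (g, ψ)` for all `ψ ∈ X_h`. -/
def IsL2Projection {d : ℕ} {Ω : BoundedDomain d} (K : Triangulation Ω) (g : Ω.L2)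
    (v : K.space) : Prop :=
  ∀ ψ : K.space, inner ℝ (K.toL2 v) (K.toL2 ψ) = inner ℝ g (K.toL2 ψ)

/-! ### The semidiscrete problem -/

/-- The left Caputo derivative of order `α ∈ (0, 1)`,
`(1 / Γ(1 - α)) ∫₀ᵗ (t - ζ)^(-α) u'(ζ) dζ`. -/
noncomputable def caputoDeriv {F : Type*} [NormedAddCommGroup F] [NormedSpace ℝ F]
    (α : ℝ) (u : ℝ → F) (t : ℝ) : F :=
  (Real.Gamma (1 - α))⁻¹ • ∫ ζ in (0 : ℝ)..t, (t - ζ) ^ (-α) • deriv u ζ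

/-- `u : [0, T] → X_h` solves the semidiscrete finite element problem with source term `f` and
initial value `u0`.  As a function with values in `L²(Ω)`, `u` is absolutely continuous on `[0, T]`
(its derivative is integrable and `u` is the integral of its derivative), it satisfies
`(ᶜD^α u(t), φ) + A(u(t), φ) = (f(t), φ)` for all `φ ∈ X_h` and almost every `t ∈ (0, T]`, and
`u(0) = P_h u0`. -/
structure IsSemidiscreteSolution {d : ℕ} {Ω : BoundedDomain d} (A : EllipticOperator Ω)
    (K : Triangulation Ω) (α T : ℝ) (f : ℝ → Ω.L2) (u0 : Ω.L2) (u : ℝ → K.space) : Prop where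
  integrable_deriv : IntervalIntegrable (deriv fun t => K.toL2 (u t)) volume 0 T
  eq_integral_deriv : ∀ t ∈ Set.Icc 0 T,
    K.toL2 (u t) = K.toL2 (u 0) + ∫ ζ in (0 : ℝ)..t, deriv (fun r => K.toL2 (u r)) ζ
  equation : ∀ᵐ t ∂(volume.restrict (Set.Ioc 0 T)), ∀ φ : K.space,
    inner ℝ (caputoDeriv α (fun r => K.toL2 (u r)) t) (K.toL2 φ) + A.form (u t) φ
      = inner ℝ (f t) (K.toL2 φ)
  initial : IsL2Projection K u0 (u 0)

/-! ### The Crank-Nicolson schemes -/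

/-- The Grünwald-Letnikov weights: `σ₀ = 1` and `σⱼ = (1 - (α + 1) / j) σⱼ₋₁` for `j ≥ 1`. -/
noncomputable def glWeight (α : ℝ) : ℕ → ℝ
  | 0 => 1
  | j + 1 => (1 - (α + 1) / ((j : ℝ) + 1)) * glWeight α j

/-- The second-order BDF operator
`D_τ gⁿ = τ⁻¹ ((3/2) gⁿ - 2 gⁿ⁻¹ + (1/2) gⁿ⁻²)` on grid functions. -/
noncomputable def bdf2 {F : Type*} [AddCommGroup F] [Module ℝ F] (τ : ℝ) (g : ℤ → F) (n : ℤ) : F :=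
  τ⁻¹ • ((3 / 2 : ℝ) • g n - (2 : ℝ) • g (n - 1) + (1 / 2 : ℝ) • g (n - 2))

/-- The grid function `t_k^(2-α) / Γ(3-α)`, `t_k = kτ`, prescribed by zero for `t_k ≤ 0`. -/
noncomputable def powerGrid (α τ : ℝ) (k : ℤ) : ℝ :=
  if 0 < k then ((k : ℝ) * τ) ^ (2 - α) / Real.Gamma (3 - α) else 0

/-- The primitive `∫₀ᵗ f(ξ) dξ`, prescribed by zero for `t ≤ 0`. -/
noncomputable def primitive {F : Type*} [NormedAddCommGroup F] [NormedSpace ℝ F]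
    (f : ℝ → F) (t : ℝ) : F :=
  ∫ ξ in (0 : ℝ)..(max t 0), f ξ

/-- The Crank-Nicolson scheme with a discretized integrated source term `S` and discrete initial
value `v0`, with step size `τ = T / N`, tested with all `φ ∈ X_h`: for `1 ≤ n ≤ N`,
`τ^(-α) ∑_{j=0}^n σⱼ Uⁿ⁻ʲ + (1 - α/2) A_h Uⁿ + (α/2) A_h Uⁿ⁻¹ = (1 - α/2) P_h Sⁿ + (α/2) P_h Sⁿ⁻¹
  + (1 - α/2) D_τ (t_n^(2-α) / Γ(3-α)) v0 + (α/2) D_τ (t_{n-1}^(2-α) / Γ(3-α)) v0`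
and `wⁿ = D_τ Uⁿ`, where `Uⁿ = 0` for `n ≤ 0` and `(A_h v, φ) = A(v, φ)` for `v, φ ∈ X_h`. -/
structure IsCNSolution {d : ℕ} {Ω : BoundedDomain d} (A : EllipticOperator Ω)
    (K : Triangulation Ω) (α T : ℝ) (N : ℕ) (S : ℤ → Ω.L2) (v0 : K.space)
    (U w : ℤ → K.space) : Prop where
  zero : ∀ k : ℤ, k ≤ 0 → U k = 0
  step : ∀ n : ℕ, 1 ≤ n → n ≤ N → ∀ φ : K.space,
    inner ℝ (K.toL2 ((T / N) ^ (-α) • ∑ j ∈ Finset.range (n + 1), glWeight α j • U (n - j)))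
        (K.toL2 φ)
      + (1 - α / 2) * A.form (U n) φ + (α / 2) * A.form (U (n - 1)) φ
    = (1 - α / 2) * inner ℝ (S n) (K.toL2 φ) + (α / 2) * inner ℝ (S (n - 1)) (K.toL2 φ)
      + (1 - α / 2) * inner ℝ (K.toL2 (bdf2 (T / N) (powerGrid α (T / N)) n • v0)) (K.toL2 φ)
      + (α / 2) * inner ℝ (K.toL2 (bdf2 (T / N) (powerGrid α (T / N)) (n - 1) • v0)) (K.toL2 φ)
  velocity : ∀ n : ℕ, 1 ≤ n → n ≤ N → w n = bdf2 (T / N) U n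

/-- Scheme CN-I: the integrated source is `Fⁿ = F(t_n)` with `F(t) = ∫₀ᵗ f`. -/
def IsCNI {d : ℕ} {Ω : BoundedDomain d} (A : EllipticOperator Ω) (K : Triangulation Ω)
    (α T : ℝ) (N : ℕ) (f : ℝ → Ω.L2) (v0 : K.space) (U w : ℤ → K.space) : Prop :=
  IsCNSolution A K α T N (fun k => primitive f (k * (T / N))) v0 U w

/-- Scheme CN-II: the integrated source is `D_τ F̃ⁿ`, where `F̃(t) = ∫₀ᵗ F` and `F(t) = ∫₀ᵗ f`. -/
def IsCNII {d : ℕ} {Ω : BoundedDomain d} (A : EllipticOperator Ω) (K : Triangulation Ω)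
    (α T : ℝ) (N : ℕ) (f : ℝ → Ω.L2) (v0 : K.space) (U w : ℤ → K.space) : Prop :=
  IsCNSolution A K α T N
    (bdf2 (T / N) fun k => primitive (primitive f) (k * (T / N))) v0 U w

end SubDiffusion

/-!
The scheme is compared with the semidiscrete solution along one eigenfunction of `A_h` at a time,
with a bound that does not depend on the eigenvalue; Parseval's identity in `X_h` then gives the
estimate in `L²(Ω)`.

*Reduction to scalar equations.*  A finite element function is affine on each piece of a finite
closed cover, hence Lipschitz, so that Rademacher's theorem makes the elliptic form bilinear on
`X_h`; it is symmetric and positive definite, and `exists_eigenfunctions` diagonalizes it in an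
`L²`-orthonormal basis.  Let `l` be an eigenvalue.  The component of the semidiscrete solution is
absolutely continuous and its Caputo derivative is `-l` times itself.  Applying the fractional
integral of order `α` turns this into a Volterra equation, whose only continuous solution is the
multiple of `E_α(-l t ^ α)` with the given initial value (`inner_eq_mul_tsum_mlTerm`).  Both this
function and the scheme depend on the step size `τ` only through `μ = l τ ^ α`, so that it is enough
to treat `τ = 1` and all `μ > 0`.

*Generating functions.*  With unit step size the values of the scheme are the Taylor coefficients of
`schemeFun α μ = β ² G δ / ((1 - ζ) ^ α + μ δ)` (`inner_scheme_eq`), where `β`, `δ` and `G` generate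
the difference operator `D_τ`, the Crank-Nicolson average and the powers `n ^ (2 - α) / Γ(3 - α)`.
By Cauchy's formula with `ζ = e⁻ᶻ` they are integrals of `schemeFun α μ (e⁻ᶻ) eⁿᶻ` over a vertical
segment of length `2π`, while `E_α(-μ n ^ α)` is the integral of `mlLaplace α μ z eⁿᶻ`,
`mlLaplace α μ z = z ^ (α - 1) / (z ^ α + μ)`, over the whole vertical line.

*The error symbol.*  Poisson summation gives `G(e⁻ᶻ) = z ^ (α - 3) + ` a function holomorphic near
the segment (`powerSeriesFun_exp_neg`), and `((1 - e⁻ᶻ) / z) ^ α` and `δ(e⁻ᶻ)` agree up to `O(z²)`,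
which is the second order consistency of the scheme.  Since `α < 1`, both terms of either
denominator lie in a sector around the positive axis, on which the denominators are bounded below by
a multiple of `|z| ^ α + μ`.  Hence the difference `mlLaplace α μ z - schemeFun α μ (e⁻ᶻ)` is
`O(|z|)`, and each derivative costs one power of `|z|`, uniformly in `μ` (`isSymbol_error`).  The
class `IsSymbol` keeps track of such bounds.

*The estimate.*  After three integrations by parts, which divide by `n ³`, the difference of the
integrands is `O(|z|⁻²)` on the line `Re z = 1 / n`: inside the segment by the bound on the error
symbol, outside because `mlLaplace α μ` is a symbol of order `-1`.  The integral of `|z|⁻²` over that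
line is `π n`, and the error is `O(n⁻²)` (`exists_scalar_error`), that is `O(τ ² t_n⁻²)`.  Only
vertical lines in the right half-plane occur, so no contour has to be bent.
-/

namespace SubDiffusion

open Filter Topology FourierTransform

/-! ### Symbols -/

/-- A family `f i` of functions, holomorphic on `D`, is a symbol of order `m` up to `k` derivatives
if `‖f i⁽ʲ⁾ z‖ ≤ C ‖z‖ ^ (m - j)` on `D` for `j ≤ k`, with constants that do not depend on the
parameter `i`.  The recursion on `k` makes the rules of calculus provable by induction. -/
def IsSymbol {ι : Type*} (D : Set ℂ) : ℕ → ℝ → (ι → ℂ → ℂ) → Prop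
  | 0, m, f => ∃ C : ℝ, ∀ i, ∀ z ∈ D, ‖f i z‖ ≤ C * ‖z‖ ^ m
  | k + 1, m, f => (∃ C : ℝ, ∀ i, ∀ z ∈ D, ‖f i z‖ ≤ C * ‖z‖ ^ m) ∧
      (∀ i, DifferentiableOn ℂ (f i) D) ∧ IsSymbol D k (m - 1) (fun i => deriv (f i))

namespace IsSymbol

variable {ι : Type*} {D : Set ℂ}

theorem of_succ {k : ℕ} : ∀ {m : ℝ} {f : ι → ℂ → ℂ}, IsSymbol D (k + 1) m f → IsSymbol D k m f := by
  induction k with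
  | zero => intro m f h; exact h.1
  | succ k ih => intro m f h; exact ⟨h.1, h.2.1, ih h.2.2⟩

theorem congr (hD : IsOpen D) {k : ℕ} : ∀ {m : ℝ} {f g : ι → ℂ → ℂ}, IsSymbol D k m f →
    (∀ i, Set.EqOn (f i) (g i) D) → IsSymbol D k m g := by
  induction k with
  | zero => rintro m f g ⟨C, hC⟩ h; exact ⟨C, fun i z hz => h i hz ▸ hC i z hz⟩
  | succ k ih =>
    rintro m f g ⟨⟨C, hC⟩, h1, h2⟩ h
    exact ⟨⟨C, fun i z hz => h i hz ▸ hC i z hz⟩,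
      fun i => (h1 i).congr fun z hz => (h i hz).symm, ih h2 fun i => (h i).deriv hD⟩

theorem comp {κ : Type*} (φ : κ → ι) {k : ℕ} :
    ∀ {m : ℝ} {f : ι → ℂ → ℂ}, IsSymbol D k m f → IsSymbol D k m (fun j => f (φ j)) := by
  induction k with
  | zero => rintro m f ⟨C, hC⟩; exact ⟨C, fun j z hz => hC _ z hz⟩
  | succ k ih =>
    rintro m f ⟨⟨C, hC⟩, h1, h2⟩
    exact ⟨⟨C, fun j z hz => hC _ z hz⟩, fun j => h1 _, ih h2⟩

theorem add (hD : IsOpen D) {k : ℕ} : ∀ {m : ℝ} {f g : ι → ℂ → ℂ}, IsSymbol D k m f →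
    IsSymbol D k m g → IsSymbol D k m (fun i z => f i z + g i z) := by
  have key : ∀ {m : ℝ} {f g : ι → ℂ → ℂ}, (∃ C : ℝ, ∀ i, ∀ z ∈ D, ‖f i z‖ ≤ C * ‖z‖ ^ m) →
      (∃ C : ℝ, ∀ i, ∀ z ∈ D, ‖g i z‖ ≤ C * ‖z‖ ^ m) →
      ∃ C : ℝ, ∀ i, ∀ z ∈ D, ‖f i z + g i z‖ ≤ C * ‖z‖ ^ m := by
    rintro m f g ⟨C, hC⟩ ⟨C', hC'⟩
    refine ⟨C + C', fun i z hz => (norm_add_le _ _).trans ?_⟩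
    rw [add_mul]
    exact add_le_add (hC i z hz) (hC' i z hz)
  induction k with
  | zero => exact key
  | succ k ih =>
    rintro m f g hf hg
    refine ⟨key hf.1 hg.1, fun i => (hf.2.1 i).add (hg.2.1 i), (ih hf.2.2 hg.2.2).congr hD ?_⟩
    intro i z hz
    exact (deriv_add ((hf.2.1 i).differentiableAt (hD.mem_nhds hz))
      ((hg.2.1 i).differentiableAt (hD.mem_nhds hz))).symm

theorem mul (hD : IsOpen D) (h0 : (0 : ℂ) ∉ D) {k : ℕ} : ∀ {m n : ℝ} {f g : ι → ℂ → ℂ},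
    IsSymbol D k m f → IsSymbol D k n g → IsSymbol D k (m + n) (fun i z => f i z * g i z) := by
  have key : ∀ {m n : ℝ} {f g : ι → ℂ → ℂ}, (∃ C : ℝ, ∀ i, ∀ z ∈ D, ‖f i z‖ ≤ C * ‖z‖ ^ m) →
      (∃ C : ℝ, ∀ i, ∀ z ∈ D, ‖g i z‖ ≤ C * ‖z‖ ^ n) →
      ∃ C : ℝ, ∀ i, ∀ z ∈ D, ‖f i z * g i z‖ ≤ C * ‖z‖ ^ (m + n) := by
    rintro m n f g ⟨C, hC⟩ ⟨C', hC'⟩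
    refine ⟨C * C', fun i z hz => ?_⟩
    have hz0 : 0 < ‖z‖ := norm_pos_iff.2 fun h => h0 (h ▸ hz)
    rw [norm_mul, Real.rpow_add hz0, mul_mul_mul_comm]
    exact mul_le_mul (hC i z hz) (hC' i z hz) (norm_nonneg _)
      ((norm_nonneg _).trans (hC i z hz))
  induction k with
  | zero => exact key
  | succ k ih =>
    rintro m n f g hf hg
    refine ⟨key hf.1 hg.1, fun i => (hf.2.1 i).mul (hg.2.1 i), ?_⟩
    have h1 := ih hf.2.2 hg.of_succ
    have h2 := ih hf.of_succ hg.2.2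
    rw [show m - 1 + n = m + n - 1 by ring] at h1
    rw [show m + (n - 1) = m + n - 1 by ring] at h2
    refine (add hD h1 h2).congr hD fun i z hz => ?_
    exact (deriv_mul ((hf.2.1 i).differentiableAt (hD.mem_nhds hz))
      ((hg.2.1 i).differentiableAt (hD.mem_nhds hz))).symm

/-- On a bounded set the order of a symbol may be lowered. -/
theorem of_le {R : ℝ} (hR : ∀ z ∈ D, ‖z‖ ≤ R) (h0 : (0 : ℂ) ∉ D) {k : ℕ} :
    ∀ {m n : ℝ} {f : ι → ℂ → ℂ}, n ≤ m → IsSymbol D k m f → IsSymbol D k n f := by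
  have key : ∀ {m n : ℝ} {f : ι → ℂ → ℂ}, n ≤ m →
      (∃ C : ℝ, ∀ i, ∀ z ∈ D, ‖f i z‖ ≤ C * ‖z‖ ^ m) →
      ∃ C : ℝ, ∀ i, ∀ z ∈ D, ‖f i z‖ ≤ C * ‖z‖ ^ n := by
    rintro m n f hmn ⟨C, hC⟩
    refine ⟨|C| * R ^ (m - n), fun i z hz => (hC i z hz).trans ?_⟩
    have hz0 : 0 < ‖z‖ := norm_pos_iff.2 fun h => h0 (h ▸ hz)
    calc C * ‖z‖ ^ m ≤ |C| * ‖z‖ ^ m := by gcongr; exact le_abs_self C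
      _ = |C| * ‖z‖ ^ (m - n) * ‖z‖ ^ n := by rw [mul_assoc, ← Real.rpow_add hz0]; simp
      _ ≤ |C| * R ^ (m - n) * ‖z‖ ^ n := by
        gcongr
        exact hR z hz
  induction k with
  | zero => exact key
  | succ k ih =>
    intro m n f hmn h
    exact ⟨key hmn h.1, h.2.1, ih (by linarith) h.2.2⟩

theorem const (hD : IsOpen D) (c : ℂ) (k : ℕ) : IsSymbol D k 0 (fun (_ : ι) _ => c) := by
  have zero : ∀ (k : ℕ) (m : ℝ), IsSymbol D k m (fun (_ : ι) _ => (0 : ℂ)) := by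
    intro k
    induction k with
    | zero => exact fun m => ⟨0, by simp⟩
    | succ k ih =>
      refine fun m => ⟨⟨0, by simp⟩, fun i => differentiableOn_const _, (ih _).congr hD ?_⟩
      intro i z hz
      simp
  cases k with
  | zero => exact ⟨‖c‖, by simp⟩
  | succ k =>
    refine ⟨⟨‖c‖, by simp⟩, fun i => differentiableOn_const _, (zero k _).congr hD ?_⟩
    intro i z hz
    simp

theorem const_mul (hD : IsOpen D) (h0 : (0 : ℂ) ∉ D) (c : ℂ) {k : ℕ} {m : ℝ} {f : ι → ℂ → ℂ}
    (h : IsSymbol D k m f) : IsSymbol D k m (fun i z => c * f i z) := by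
  simpa using (const hD c k).mul hD h0 h

theorem sub (hD : IsOpen D) (h0 : (0 : ℂ) ∉ D) {k : ℕ} {m : ℝ} {f g : ι → ℂ → ℂ}
    (hf : IsSymbol D k m f) (hg : IsSymbol D k m g) : IsSymbol D k m (fun i z => f i z - g i z) := by
  simpa [sub_eq_add_neg] using hf.add hD (hg.const_mul hD h0 (-1))

/-- The power `z ^ a` is a symbol of order `a` on the right half-plane. -/
theorem cpow (hD : IsOpen D) (hre : ∀ z ∈ D, 0 < z.re) {k : ℕ} :
    ∀ a : ℝ, IsSymbol D k a (fun (_ : ι) z => z ^ (a : ℂ)) := by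
  have h0 : (0 : ℂ) ∉ D := fun h => by simpa using hre 0 h
  have key : ∀ a : ℝ, ∃ C : ℝ, ∀ (_ : ι), ∀ z ∈ D, ‖z ^ (a : ℂ)‖ ≤ C * ‖z‖ ^ a := fun a =>
    ⟨1, fun _ z _ => by simp [Complex.norm_cpow_real]⟩
  induction k with
  | zero => exact key
  | succ k ih =>
    intro a
    have hd : ∀ z ∈ D, HasDerivAt (fun z : ℂ => z ^ (a : ℂ)) ((a : ℂ) * z ^ ((a - 1 : ℝ) : ℂ)) z := by
      intro z hz
      have := (hasDerivAt_id z).cpow_const (c := (a : ℂ)) (Or.inl (hre z hz))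
      simpa using this
    refine ⟨key a, fun i z hz => (hd z hz).differentiableAt.differentiableWithinAt,
      ((ih (a - 1)).const_mul hD h0 a).congr hD fun i z hz => (hd z hz).deriv.symm⟩

/-- A function holomorphic near a compact set containing `D` is a symbol of order `0`. -/
theorem of_differentiableOn {f : ℂ → ℂ} {K V : Set ℂ} (hK : IsCompact K) (hV : IsOpen V)
    (hKV : K ⊆ V) (hDK : D ⊆ K) (h0 : (0 : ℂ) ∉ D) (hf : DifferentiableOn ℂ f V) (k : ℕ) :
    IsSymbol D k 0 (fun (_ : ι) => f) := by
  obtain ⟨R, hR⟩ := hK.isBounded.exists_norm_le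
  have key : ∀ f : ℂ → ℂ, DifferentiableOn ℂ f V →
      ∃ C : ℝ, ∀ (_ : ι), ∀ z ∈ D, ‖f z‖ ≤ C * ‖z‖ ^ (0 : ℝ) := by
    intro f hf
    obtain ⟨C, hC⟩ := hK.exists_bound_of_continuousOn (hf.continuousOn.mono hKV)
    exact ⟨C, fun _ z hz => by simpa using hC z (hDK hz)⟩
  induction k generalizing f with
  | zero => exact key f hf
  | succ k ih =>
    refine ⟨key f hf, fun _ => hf.mono (hDK.trans hKV), ?_⟩
    exact of_le (fun z hz => hR z (hDK hz)) h0 (by norm_num) (ih (hf.deriv hV))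

/-- Reciprocals of the functions `p + μ d`, where the constants do not depend on `μ`, under a lower
bound `‖p z + μ d z‖ ≥ c (‖z‖ ^ α + μ)`. -/
theorem inv_add_mul (hD : IsOpen D) (h0 : (0 : ℂ) ∉ D) {p d : ℂ → ℂ} {α c : ℝ} (hc : 0 < c)
    (μ : ι → ℝ) (hμ : ∀ i, 0 ≤ μ i) {k : ℕ} (hp : IsSymbol D (k + 1) α (fun (_ : ι) => p))
    (hd : IsSymbol D (k + 1) 0 (fun (_ : ι) => d))
    (hlow : ∀ i, ∀ z ∈ D, c * (‖z‖ ^ α + μ i) ≤ ‖p z + μ i * d z‖) :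
    IsSymbol D k (-α) (fun i z => (p z + μ i * d z)⁻¹) ∧
      IsSymbol D k 0 (fun i z => μ i * (p z + μ i * d z)⁻¹) := by
  have hpos : ∀ z ∈ D, 0 < ‖z‖ := fun z hz => norm_pos_iff.2 fun h => h0 (h ▸ hz)
  have b1 : ∃ C : ℝ, ∀ i, ∀ z ∈ D, ‖(p z + μ i * d z)⁻¹‖ ≤ C * ‖z‖ ^ (-α) := by
    refine ⟨c⁻¹, fun i z hz => ?_⟩
    rw [norm_inv, Real.rpow_neg (norm_nonneg z), ← mul_inv]
    have := Real.rpow_pos_of_pos (hpos z hz) α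
    exact inv_anti₀ (by positivity) (le_trans (by nlinarith [hμ i]) (hlow i z hz))
  have b2 : ∃ C : ℝ, ∀ i, ∀ z ∈ D, ‖(μ i : ℂ) * (p z + μ i * d z)⁻¹‖ ≤ C * ‖z‖ ^ (0 : ℝ) := by
    refine ⟨c⁻¹, fun i z hz => ?_⟩
    have h1 := Real.rpow_pos_of_pos (hpos z hz) α
    have h2 : 0 < ‖p z + μ i * d z‖ :=
      lt_of_lt_of_le (mul_pos hc (by linarith [hμ i])) (hlow i z hz)
    rw [Real.rpow_zero, mul_one, norm_mul, norm_inv, Complex.norm_real, Real.norm_eq_abs,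
      abs_of_nonneg (hμ i), ← div_eq_mul_inv, div_le_iff₀ h2, inv_mul_eq_div, le_div_iff₀ hc]
    nlinarith [hlow i z hz]
  induction k with
  | zero => exact ⟨b1, b2⟩
  | succ k ih =>
    obtain ⟨g1, g2⟩ := ih hp.of_succ hd.of_succ
    have hder : ∀ i, ∀ z ∈ D, HasDerivAt (fun z => (p z + μ i * d z)⁻¹)
        (-(deriv p z * (p z + μ i * d z)⁻¹ + deriv d z * (μ i * (p z + μ i * d z)⁻¹))
          * (p z + μ i * d z)⁻¹) z := by
      intro i z hz
      have h1 : HasDerivAt p (deriv p z) z :=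
        ((hp.2.1 i).differentiableAt (hD.mem_nhds hz)).hasDerivAt
      have h2 : HasDerivAt d (deriv d z) z :=
        ((hd.2.1 i).differentiableAt (hD.mem_nhds hz)).hasDerivAt
      have hne : p z + μ i * d z ≠ 0 := by
        rw [← norm_pos_iff]
        have := Real.rpow_pos_of_pos (hpos z hz) α
        exact lt_of_lt_of_le (mul_pos hc (by linarith [hμ i])) (hlow i z hz)
      refine ((h1.fun_add (h2.const_mul (μ i : ℂ))).fun_inv hne).congr_deriv ?_
      field_simp
    have hlog : IsSymbol D k (-1) (fun i z => -(deriv p z * (p z + μ i * d z)⁻¹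
        + deriv d z * (μ i * (p z + μ i * d z)⁻¹))) := by
      have e1 := hp.2.2.of_succ.mul hD h0 g1
      have e2 := hd.2.2.of_succ.mul hD h0 g2
      rw [show α - 1 + -α = -1 by ring] at e1
      rw [show (0 : ℝ) - 1 + 0 = -1 by ring] at e2
      simpa using (e1.add hD e2).const_mul hD h0 (-1)
    refine ⟨⟨b1, fun i z hz => (hder i z hz).differentiableAt.differentiableWithinAt, ?_⟩,
      ⟨b2, fun i z hz => ((hder i z hz).const_mul _).differentiableAt.differentiableWithinAt, ?_⟩⟩
    · have e := hlog.mul hD h0 g1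
      rw [show -1 + -α = -α - 1 by ring] at e
      exact e.congr hD fun i z hz => (hder i z hz).deriv.symm
    · have e := hlog.mul hD h0 g2
      rw [show (-1 : ℝ) + 0 = 0 - 1 by ring] at e
      refine e.congr hD fun i z hz => ?_
      rw [((hder i z hz).const_mul _).deriv]
      ring

end IsSymbol

/-! ### The symbols of the scheme -/

/-- The generating function `(1 - ζ)(3 - ζ) / 2` of the weights `3/2, -2, 1/2` of `bdf2 1`. -/
noncomputable def bdfSymbol (ζ : ℂ) : ℂ := (1 - ζ) * (3 - ζ) / 2

/-- The generating function of the Crank-Nicolson average `(1 - α/2) gⁿ + (α/2) gⁿ⁻¹`. -/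
noncomputable def avgSymbol (α : ℝ) (ζ : ℂ) : ℂ := (1 - α / 2) + (α / 2) * ζ

/-- The generating function of `powerGrid α 1`. -/
noncomputable def powerSeriesFun (α : ℝ) (ζ : ℂ) : ℂ :=
  ∑' n : ℕ, (((n : ℝ) ^ (2 - α) / Real.Gamma (3 - α) : ℝ) : ℂ) * ζ ^ n

/-- The generating function of the values `w n` computed by the scheme with unit step size for the
scalar equation with eigenvalue `μ` and initial value `1`. -/
noncomputable def schemeFun (α μ : ℝ) (ζ : ℂ) : ℂ :=
  bdfSymbol ζ ^ 2 * powerSeriesFun α ζ * avgSymbol α ζ / ((1 - ζ) ^ (α : ℂ) + μ * avgSymbol α ζ)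

/-- The Laplace transform of the solution of the scalar equation with eigenvalue `μ` and initial
value `1`. -/
noncomputable def mlLaplace (α μ : ℝ) (z : ℂ) : ℂ :=
  z ^ ((α - 1 : ℝ) : ℂ) / (z ^ (α : ℂ) + μ)

/-- A neighbourhood in the right half-plane of the segment from `-iπ` to `iπ`. -/
def halfStrip : Set ℂ := Set.Ioo 0 2 ×ℂ Set.Ioo (-4) 4

/-- The closure of `halfStrip`. -/
def closedHalfStrip : Set ℂ := Set.Icc 0 2 ×ℂ Set.Icc (-4) 4

theorem isOpen_halfStrip : IsOpen halfStrip := isOpen_Ioo.reProdIm isOpen_Ioo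

theorem isCompact_closedHalfStrip : IsCompact closedHalfStrip := isCompact_Icc.reProdIm isCompact_Icc

theorem halfStrip_subset : halfStrip ⊆ closedHalfStrip := fun _ hz =>
  ⟨Set.Ioo_subset_Icc_self hz.1, Set.Ioo_subset_Icc_self hz.2⟩

theorem re_pos_of_mem_halfStrip {z : ℂ} (hz : z ∈ halfStrip) : 0 < z.re := hz.1.1

theorem zero_notMem_halfStrip : (0 : ℂ) ∉ halfStrip := fun h => by
  simpa using re_pos_of_mem_halfStrip h

theorem exists_norm_le_halfStrip : ∃ R : ℝ, ∀ z ∈ halfStrip, ‖z‖ ≤ R := by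
  obtain ⟨R, hR⟩ := isCompact_closedHalfStrip.isBounded.exists_norm_le
  exact ⟨R, fun z hz => hR z (halfStrip_subset hz)⟩

/-- A holomorphic function with a double zero at the origin is a symbol of order `2`. -/
theorem isSymbol_two_of_double_zero {ι : Type*} {f : ℂ → ℂ} {V : Set ℂ} (hV : IsOpen V)
    (hKV : closedHalfStrip ⊆ V) (hf : DifferentiableOn ℂ f V) (h0 : f 0 = 0) (h1 : deriv f 0 = 0)
    (k : ℕ) : IsSymbol halfStrip k 2 (fun (_ : ι) => f) := by
  have hV0 : V ∈ nhds (0 : ℂ) := hV.mem_nhds (hKV ⟨by simp, by simp⟩)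
  have hg := (Complex.differentiableOn_dslope hV0).2 ((Complex.differentiableOn_dslope hV0).2 hf)
  have hz := IsSymbol.cpow (ι := ι) (k := k) isOpen_halfStrip (fun _ => re_pos_of_mem_halfStrip) 2
  have := hz.mul isOpen_halfStrip zero_notMem_halfStrip
    (IsSymbol.of_differentiableOn isCompact_closedHalfStrip hV hKV halfStrip_subset
      zero_notMem_halfStrip hg k)
  rw [add_zero] at this
  refine this.congr isOpen_halfStrip fun _ z hz => ?_
  have hz0 : z ≠ 0 := fun h => zero_notMem_halfStrip (h ▸ hz)
  simp [dslope_of_ne _ hz0, slope_def_field, h0, h1, dslope_same]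
  field_simp

/-- The entire function `(1 - e⁻ᶻ) / z`. -/
noncomputable def expQuot : ℂ → ℂ := dslope (fun z => -Complex.exp (-z)) 0

theorem differentiable_expQuot : Differentiable ℂ expQuot := by
  rw [← differentiableOn_univ]
  refine (Complex.differentiableOn_dslope Filter.univ_mem).2 ?_
  fun_prop

theorem mul_expQuot (z : ℂ) : z * expQuot z = 1 - Complex.exp (-z) := by
  have := sub_smul_dslope (fun z => -Complex.exp (-z)) 0 z
  simp only [sub_zero, smul_eq_mul] at this
  rw [expQuot, this]
  simp
  ring

theorem expQuot_zero : expQuot 0 = 1 := by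
  have h : HasDerivAt (fun z : ℂ => -Complex.exp (-z)) 1 0 := by
    simpa using ((hasDerivAt_id (0 : ℂ)).neg.cexp).fun_neg
  rw [expQuot, dslope_same, h.deriv]

theorem deriv_expQuot_zero : deriv expQuot 0 = -1 / 2 := by
  have hq := differentiable_expQuot
  have h1 : ∀ z, expQuot z + z * deriv expQuot z = Complex.exp (-z) := by
    intro z
    have a : HasDerivAt (fun z => z * expQuot z) (expQuot z + z * deriv expQuot z) z := by
      simpa using (hasDerivAt_id z).fun_mul (hq z).hasDerivAt
    have b : HasDerivAt (fun z : ℂ => 1 - Complex.exp (-z)) (Complex.exp (-z)) z := by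
      simpa using ((hasDerivAt_id z).neg.cexp).const_sub 1
    rw [funext mul_expQuot] at a
    exact a.unique b
  have hq' : Differentiable ℂ (deriv expQuot) := by
    rw [← differentiableOn_univ]
    exact (differentiableOn_univ.2 hq).deriv isOpen_univ
  have a : HasDerivAt (fun z => expQuot z + z * deriv expQuot z)
      (deriv expQuot 0 + (deriv expQuot 0 + 0 * deriv (deriv expQuot) 0)) 0 := by
    simpa using (hq 0).hasDerivAt.fun_add ((hasDerivAt_id (0 : ℂ)).fun_mul (hq' 0).hasDerivAt)
  have b : HasDerivAt (fun z : ℂ => Complex.exp (-z)) (-1) 0 := by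
    simpa using (hasDerivAt_id (0 : ℂ)).neg.cexp
  rw [funext h1] at a
  have := a.unique b
  linear_combination this / 2

theorem expQuot_mem_slitPlane {z : ℂ} (hz : z ∈ closedHalfStrip) :
    expQuot z ∈ Complex.slitPlane := by
  by_contra h
  rw [Complex.mem_slitPlane_iff, not_or, not_lt, not_not] at h
  obtain ⟨⟨hx, -⟩, hy1, hy2⟩ := hz
  have hz := mul_expQuot z
  have hre := congrArg Complex.re hz
  simp only [Complex.mul_re, h.2, mul_zero, sub_zero, Complex.sub_re, Complex.one_re,
    Complex.exp_re, Complex.neg_re, Complex.neg_im, Real.cos_neg] at hre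
  have h1 : z.re * (expQuot z).re ≤ 0 := mul_nonpos_of_nonneg_of_nonpos hx h.1
  have h2 : Real.exp (-z.re) ≤ 1 := Real.exp_le_one_iff.2 (by simpa using hx)
  have h3 := Real.cos_le_one z.im
  have h4 := Real.exp_pos (-z.re)
  have h5 : Real.exp (-z.re) = 1 := by nlinarith
  have h6 : Real.cos z.im = 1 := by rw [h5] at hre; linarith
  have h7 : z.re = 0 := by simpa using h5
  have h8 : z.im = 0 := by
    have := Real.pi_gt_three
    exact (Real.cos_eq_one_iff_of_lt_of_lt (by linarith) (by linarith)).1 h6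
  have : z = 0 := Complex.ext h7 h8
  rw [this, expQuot_zero] at h
  norm_num at h

/-- The open set on which the principal powers of `expQuot` are holomorphic. -/
def expQuotDomain : Set ℂ := expQuot ⁻¹' Complex.slitPlane

theorem isOpen_expQuotDomain : IsOpen expQuotDomain :=
  Complex.isOpen_slitPlane.preimage differentiable_expQuot.continuous

theorem closedHalfStrip_subset_expQuotDomain : closedHalfStrip ⊆ expQuotDomain :=
  fun _ hz => expQuot_mem_slitPlane hz

theorem one_sub_exp_neg_re_pos {z : ℂ} (hz : 0 < z.re) : 0 < (1 - Complex.exp (-z)).re := by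
  have h1 : ‖Complex.exp (-z)‖ < 1 := by
    rw [Complex.norm_exp]
    exact Real.exp_lt_one_iff.2 (by simpa using hz)
  have h2 := Complex.re_le_norm (Complex.exp (-z))
  simp only [Complex.sub_re, Complex.one_re]
  linarith

theorem one_sub_exp_neg_cpow (α : ℝ) {z : ℂ} (hz : 0 < z.re) :
    (1 - Complex.exp (-z)) ^ (α : ℂ) = z ^ (α : ℂ) * expQuot z ^ (α : ℂ) := by
  have hz0 : z ≠ 0 := fun h => by simp [h] at hz
  have h1 := one_sub_exp_neg_re_pos hz
  have hw0 : 1 - Complex.exp (-z) ≠ 0 := fun h => by simp [h] at h1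
  have hq0 : expQuot z ≠ 0 := fun h => hw0 (by rw [← mul_expQuot, h, mul_zero])
  have a1 := Complex.abs_arg_lt_pi_div_two_iff.2 (Or.inl h1)
  have a2 := Complex.abs_arg_lt_pi_div_two_iff.2 (Or.inl hz)
  rw [abs_lt] at a1 a2
  have hlog : Complex.log (expQuot z) = Complex.log (1 - Complex.exp (-z)) - Complex.log z := by
    rw [← Complex.log_exp (x := Complex.log (1 - Complex.exp (-z)) - Complex.log z)]
    · rw [Complex.exp_sub, Complex.exp_log hw0, Complex.exp_log hz0, ← mul_expQuot,
        mul_div_cancel_left₀ _ hz0]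
    · simp only [Complex.sub_im, Complex.log_im]; linarith
    · simp only [Complex.sub_im, Complex.log_im]; linarith
  rw [Complex.cpow_def_of_ne_zero hw0, Complex.cpow_def_of_ne_zero hz0,
    Complex.cpow_def_of_ne_zero hq0, hlog, ← Complex.exp_add]
  ring_nf

/-- On the right half-plane the power `w ^ α` stays in a sector around the positive real axis. -/
theorem cos_mul_norm_le_re_cpow {α : ℝ} (hα0 : 0 < α) (hα1 : α < 1) {w : ℂ} (hw : 0 < w.re) :
    Real.cos (α * (Real.pi / 2)) * ‖w‖ ^ α ≤ (w ^ (α : ℂ)).re := by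
  have hw0 : w ≠ 0 := fun h => by simp [h] at hw
  have a1 := Complex.abs_arg_lt_pi_div_two_iff.2 (Or.inl hw)
  have h : (w ^ (α : ℂ)).re = ‖w‖ ^ α * Real.cos (α * w.arg) := by
    rw [Complex.cpow_def_of_ne_zero hw0, Complex.exp_re]
    simp only [Complex.mul_re, Complex.mul_im, Complex.log_re, Complex.log_im, Complex.ofReal_re,
      Complex.ofReal_im, mul_zero, sub_zero, zero_add]
    rw [Real.rpow_def_of_pos (norm_pos_iff.2 hw0), mul_comm α]
  rw [h, mul_comm, ← Real.cos_abs (α * w.arg), abs_mul, abs_of_pos hα0]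
  gcongr
  refine Real.cos_le_cos_of_nonneg_of_le_pi (by positivity) ?_ ?_
  · nlinarith [Real.pi_pos]
  · gcongr

theorem cos_alpha_pos {α : ℝ} (hα0 : 0 < α) (hα1 : α < 1) : 0 < Real.cos (α * (Real.pi / 2)) := by
  apply Real.cos_pos_of_mem_Ioo
  constructor <;> nlinarith [Real.pi_pos]

theorem le_norm_cpow_add {α : ℝ} (hα0 : 0 < α) (hα1 : α < 1) {μ : ℝ} (hμ : 0 ≤ μ) {z : ℂ}
    (hz : 0 < z.re) :
    Real.cos (α * (Real.pi / 2)) * (‖z‖ ^ α + μ) ≤ ‖z ^ (α : ℂ) + μ‖ := by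
  refine le_trans ?_ (Complex.re_le_norm _)
  have h1 := cos_mul_norm_le_re_cpow hα0 hα1 hz
  have h2 := Real.cos_le_one (α * (Real.pi / 2))
  simp only [Complex.add_re, Complex.ofReal_re]
  nlinarith

theorem re_avgSymbol {α : ℝ} (hα0 : 0 < α) {ζ : ℂ} (hζ : ‖ζ‖ ≤ 1) :
    1 - α ≤ (avgSymbol α ζ).re := by
  have h := (abs_le.1 ((Complex.abs_re_le_norm ζ).trans hζ)).1
  have : (avgSymbol α ζ).re = 1 - α / 2 + α / 2 * ζ.re := by
    rw [avgSymbol, show (1 - (α : ℂ) / 2) + α / 2 * ζ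
      = ((1 - α / 2 : ℝ) : ℂ) + ((α / 2 : ℝ) : ℂ) * ζ by push_cast; ring]
    simp only [Complex.add_re, Complex.ofReal_re, Complex.re_ofReal_mul]
  rw [this]
  nlinarith

/-- The denominator of the generating function of the scheme is bounded below, uniformly in `μ`:
both of its terms have a positive real part, comparable to their absolute value. -/
theorem le_norm_denominator {α : ℝ} (hα0 : 0 < α) (hα1 : α < 1) {μ : ℝ} (hμ : 0 ≤ μ) {ζ : ℂ}
    (hζ : ‖ζ‖ < 1) :
    Real.cos (α * (Real.pi / 2)) * ‖1 - ζ‖ ^ α + (1 - α) * μ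
      ≤ ‖(1 - ζ) ^ (α : ℂ) + μ * avgSymbol α ζ‖ := by
  refine le_trans ?_ (Complex.re_le_norm _)
  have h0 : 0 < (1 - ζ).re := by
    have := Complex.re_le_norm ζ
    simp only [Complex.sub_re, Complex.one_re]
    linarith
  have h1 := cos_mul_norm_le_re_cpow hα0 hα1 h0
  have h2 := re_avgSymbol hα0 hζ.le
  simp only [Complex.add_re, Complex.re_ofReal_mul]
  nlinarith

theorem denominator_ne_zero {α : ℝ} (hα0 : 0 < α) (hα1 : α < 1) {μ : ℝ} (hμ : 0 < μ) {ζ : ℂ}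
    (hζ : ‖ζ‖ < 1) : (1 - ζ) ^ (α : ℂ) + μ * avgSymbol α ζ ≠ 0 := by
  rw [← norm_pos_iff]
  refine lt_of_lt_of_le ?_ (le_norm_denominator hα0 hα1 hμ.le hζ)
  have := cos_alpha_pos hα0 hα1
  have : 0 < (1 - α) * μ := mul_pos (by linarith) hμ
  positivity

theorem norm_exp_neg_lt_one {z : ℂ} (hz : 0 < z.re) : ‖Complex.exp (-z)‖ < 1 := by
  rw [Complex.norm_exp]
  exact Real.exp_lt_one_iff.2 (by simpa using hz)

theorem exists_le_norm_denominator {α : ℝ} (hα0 : 0 < α) (hα1 : α < 1) :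
    ∃ c : ℝ, 0 < c ∧ ∀ μ : ℝ, 0 ≤ μ → ∀ z ∈ halfStrip, c * (‖z‖ ^ α + μ)
      ≤ ‖(1 - Complex.exp (-z)) ^ (α : ℂ) + μ * avgSymbol α (Complex.exp (-z))‖ := by
  have hne : ∀ z ∈ closedHalfStrip, expQuot z ≠ 0 := fun z hz =>
    Complex.slitPlane_ne_zero (expQuot_mem_slitPlane hz)
  obtain ⟨z₀, hz₀, hmin⟩ := isCompact_closedHalfStrip.exists_isMinOn
    ⟨0, by simp [closedHalfStrip, Complex.mem_reProdIm]⟩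
    differentiable_expQuot.continuous.norm.continuousOn
  set c₁ := ‖expQuot z₀‖ with hc₁
  have hc₁0 : 0 < c₁ := norm_pos_iff.2 (hne z₀ hz₀)
  have hcos := cos_alpha_pos hα0 hα1
  refine ⟨min (Real.cos (α * (Real.pi / 2)) * c₁ ^ α) (1 - α), ?_, ?_⟩
  · exact lt_min (by positivity) (by linarith)
  intro μ hμ z hz
  refine le_trans ?_ (le_norm_denominator hα0 hα1 hμ
    (norm_exp_neg_lt_one (re_pos_of_mem_halfStrip hz)))
  rw [← mul_expQuot, norm_mul, Real.mul_rpow (norm_nonneg _) (norm_nonneg _), mul_add]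
  have h1 : c₁ ^ α ≤ ‖expQuot z‖ ^ α :=
    Real.rpow_le_rpow hc₁0.le (hmin (halfStrip_subset hz)) hα0.le
  have h2 := min_le_left (Real.cos (α * (Real.pi / 2)) * c₁ ^ α) (1 - α)
  have h3 := min_le_right (Real.cos (α * (Real.pi / 2)) * c₁ ^ α) (1 - α)
  refine add_le_add ?_ (by gcongr)
  calc _ ≤ Real.cos (α * (Real.pi / 2)) * c₁ ^ α * ‖z‖ ^ α := by gcongr
    _ ≤ Real.cos (α * (Real.pi / 2)) * ‖expQuot z‖ ^ α * ‖z‖ ^ α := by gcongr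
    _ = _ := by ring

/-- The parameters `μ > 0`. -/
abbrev PosReal : Type := Set.Ioi (0 : ℝ)

theorem isSymbol_inv_cpow_add {α : ℝ} (hα0 : 0 < α) (hα1 : α < 1) {D : Set ℂ} (hD : IsOpen D)
    (hre : ∀ z ∈ D, 0 < z.re) (k : ℕ) :
    IsSymbol D k (-α) (fun (μ : PosReal) z => (z ^ (α : ℂ) + (μ : ℝ))⁻¹) := by
  have h0 : (0 : ℂ) ∉ D := fun h => by simpa using hre 0 h
  have := (IsSymbol.inv_add_mul (ι := PosReal) (k := k) hD h0 (p := fun z => z ^ (α : ℂ))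
    (d := fun _ => 1) (cos_alpha_pos hα0 hα1) (fun μ => (μ : ℝ)) (fun μ => μ.2.le)
    (IsSymbol.cpow hD hre α) (IsSymbol.const hD 1 _)
    (fun μ z hz => by simpa using le_norm_cpow_add hα0 hα1 μ.2.le (hre z hz))).1
  simpa using this

theorem isSymbol_mlLaplace {α : ℝ} (hα0 : 0 < α) (hα1 : α < 1) {D : Set ℂ} (hD : IsOpen D)
    (hre : ∀ z ∈ D, 0 < z.re) (k : ℕ) :
    IsSymbol D k (-1) (fun (μ : PosReal) => mlLaplace α μ) := by
  have h0 : (0 : ℂ) ∉ D := fun h => by simpa using hre 0 h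
  have := (IsSymbol.cpow (ι := PosReal) hD hre (k := k) (α - 1)).mul hD h0
    (isSymbol_inv_cpow_add hα0 hα1 hD hre k)
  rw [show α - 1 + -α = -1 by ring] at this
  exact this.congr hD fun μ z _ => by simp only [mlLaplace, div_eq_mul_inv]

/-- The error symbol has order `1`, uniformly in `μ`.  The hypothesis on `R` says that
`powerSeriesFun α (e⁻ᶻ) - z ^ (α - 3)` is holomorphic near the closed half strip.  Over the common
denominator `(z ^ α + μ) ((1 - e⁻ᶻ) ^ α + μ δ)`, `δ = avgSymbol α (e⁻ᶻ)`, the difference of the two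
fractions splits into two parts: one contains the consistency error
`(1 - e⁻ᶻ) ^ α - z ^ α δ = O(z ^ (α + 2))`, the other the error `O(z ^ (α + 1))` of the numerator. -/
theorem isSymbol_error {α : ℝ} (hα0 : 0 < α) (hα1 : α < 1) {R : ℂ → ℂ} {V : Set ℂ} (hV : IsOpen V)
    (hKV : closedHalfStrip ⊆ V) (hR : DifferentiableOn ℂ R V)
    (hRG : ∀ z ∈ halfStrip, powerSeriesFun α (Complex.exp (-z)) = z ^ ((α - 3 : ℝ) : ℂ) + R z)
    (k : ℕ) : IsSymbol halfStrip k 1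
      (fun (μ : PosReal) z => mlLaplace α μ z - schemeFun α μ (Complex.exp (-z))) := by
  have hD := isOpen_halfStrip
  have h0 := zero_notMem_halfStrip
  have hre : ∀ z ∈ halfStrip, 0 < z.re := fun _ => re_pos_of_mem_halfStrip
  obtain ⟨B, hB⟩ := exists_norm_le_halfStrip
  have hpow : ∀ (k : ℕ) (a : ℝ), IsSymbol halfStrip k a (fun (_ : PosReal) z => z ^ (a : ℂ)) :=
    fun k a => IsSymbol.cpow hD hre a
  have hentire : ∀ (k : ℕ) {f : ℂ → ℂ}, Differentiable ℂ f →
      IsSymbol halfStrip k 0 (fun (_ : PosReal) => f) := fun k f hf =>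
    IsSymbol.of_differentiableOn isCompact_closedHalfStrip isOpen_univ (Set.subset_univ _)
      halfStrip_subset h0 hf.differentiableOn k
  have hqd := differentiable_expQuot
  have hdd : Differentiable ℂ (fun z => avgSymbol α (Complex.exp (-z))) := by
    unfold avgSymbol; fun_prop
  have hd : ∀ k, IsSymbol halfStrip k 0 (fun (_ : PosReal) z => avgSymbol α (Complex.exp (-z))) :=
    fun k => hentire k hdd
  have hqα : DifferentiableOn ℂ (fun z => expQuot z ^ (α : ℂ)) expQuotDomain := fun z hz =>
    ((hqd z).cpow_const hz).differentiableWithinAt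
  have hp : ∀ k, IsSymbol halfStrip k α (fun (_ : PosReal) z =>
      (1 - Complex.exp (-z)) ^ (α : ℂ)) := by
    intro k
    have := (hpow k α).mul hD h0 (IsSymbol.of_differentiableOn isCompact_closedHalfStrip
      isOpen_expQuotDomain closedHalfStrip_subset_expQuotDomain halfStrip_subset h0 hqα k)
    rw [add_zero] at this
    exact this.congr hD fun _ z hz => (one_sub_exp_neg_cpow α (hre z hz)).symm
  obtain ⟨c, hc, hlow⟩ := exists_le_norm_denominator hα0 hα1
  have hBinv := (IsSymbol.inv_add_mul (ι := PosReal) (k := k) hD h0 hc (fun μ => (μ : ℝ))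
    (fun μ => μ.2.le) (hp _) (hd _) (fun μ z hz => hlow μ μ.2.le z hz)).1
  have hAinv := isSymbol_inv_cpow_add hα0 hα1 hD hre k
  -- the weights of the scheme are consistent of second order
  have hf1 : IsSymbol halfStrip k 2 (fun (_ : PosReal) z =>
      expQuot z ^ (α : ℂ) - avgSymbol α (Complex.exp (-z))) := by
    refine isSymbol_two_of_double_zero isOpen_expQuotDomain closedHalfStrip_subset_expQuotDomain
      (hqα.sub hdd.differentiableOn) ?_ ?_ k
    · simp [expQuot_zero, avgSymbol]
    · have h1 : HasDerivAt (fun z => expQuot z ^ (α : ℂ)) (α * (-1 / 2)) 0 := by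
        have := (hqd 0).hasDerivAt.cpow_const (c := (α : ℂ))
          (Or.inl (by rw [expQuot_zero]; norm_num))
        rw [expQuot_zero, deriv_expQuot_zero] at this
        simpa using this
      have h2 : HasDerivAt (fun z => avgSymbol α (Complex.exp (-z))) (α / 2 * (-1)) 0 := by
        have e : HasDerivAt (fun z : ℂ => Complex.exp (-z)) (-1) 0 := by
          simpa using (hasDerivAt_id (0 : ℂ)).neg.cexp
        exact (e.const_mul _).const_add _
      rw [(h1.sub h2).deriv]
      ring
  -- `bdfSymbol (e⁻ᶻ) = z γ z`
  -- and `γ ^ 2 - 1` has a double zero, so that the error of the numerator has order `α + 1`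
  set γ : ℂ → ℂ := fun z => expQuot z * (3 - Complex.exp (-z)) / 2 with hγ
  have hγd : Differentiable ℂ γ := by simp only [hγ]; fun_prop
  have hβ : ∀ z, bdfSymbol (Complex.exp (-z)) = z * γ z := by
    intro z
    rw [bdfSymbol, ← mul_expQuot]; simp only [hγ]; ring
  have hγ0 : γ 0 = 1 := by simp only [hγ, expQuot_zero]; norm_num
  have hγ1 : deriv γ 0 = 0 := by
    have e : HasDerivAt (fun z : ℂ => Complex.exp (-z)) (-1) 0 := by
      simpa using (hasDerivAt_id (0 : ℂ)).neg.cexp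
    have := ((hqd 0).hasDerivAt.fun_mul (e.const_sub 3)).div_const 2
    rw [expQuot_zero, deriv_expQuot_zero] at this
    rw [this.deriv]
    norm_num
  have hf2 : IsSymbol halfStrip k 2 (fun (_ : PosReal) z => γ z ^ 2 - 1) := by
    refine isSymbol_two_of_double_zero isOpen_univ (Set.subset_univ _)
      ((hγd.pow 2).sub_const 1).differentiableOn (by simp [hγ0]) ?_ k
    rw [deriv_sub_const, deriv_pow (hγd 0), hγ1, mul_zero]
  have hR0 := IsSymbol.of_differentiableOn (ι := PosReal) isCompact_closedHalfStrip hV hKV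
    halfStrip_subset h0 hR k
  have hb : IsSymbol halfStrip k (α + 1) (fun (_ : PosReal) z => z ^ ((α - 1 : ℝ) : ℂ)
      - bdfSymbol (Complex.exp (-z)) ^ 2 * powerSeriesFun α (Complex.exp (-z))) := by
    have e1 := ((hpow k (α - 1)).mul hD h0 hf2).const_mul hD h0 (-1)
    rw [show α - 1 + 2 = α + 1 by ring] at e1
    have e2 := (((hpow k 2).mul hD h0 (hentire k (hγd.pow 2))).mul hD h0 hR0).of_le
      (n := α + 1) hB h0 (by linarith)
    refine (e1.sub hD h0 e2).congr hD fun _ z hz => ?_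
    have hz0 : z ≠ 0 := fun h => h0 (h ▸ hz)
    simp only [hβ, hRG z hz, Pi.pow_apply]
    have : z ^ ((α - 1 : ℝ) : ℂ) = z ^ 2 * z ^ ((α - 3 : ℝ) : ℂ) := by
      rw [← Complex.cpow_ofNat, ← Complex.cpow_add _ _ hz0]
      congr 1
      push_cast
      ring
    rw [this]
    simp
    ring
  have t1 := ((hpow k (α - 1)).mul hD h0 ((hpow k α).mul hD h0 hf1)).mul hD h0
    (hAinv.mul hD h0 hBinv)
  have t2 := ((hd k).mul hD h0 hb).mul hD h0 hBinv
  rw [show α - 1 + (α + 2) + (-α + -α) = 1 by ring] at t1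
  rw [show 0 + (α + 1) + -α = 1 by ring] at t2
  refine (t1.add hD t2).congr hD fun μ z hz => ?_
  have hzr := hre z hz
  have n1 : z ^ (α : ℂ) + (μ : ℝ) ≠ 0 := by
    rw [← norm_pos_iff]
    refine lt_of_lt_of_le (mul_pos (cos_alpha_pos hα0 hα1) ?_) (le_norm_cpow_add hα0 hα1 μ.2.le hzr)
    have : (0 : ℝ) < μ := μ.2
    positivity
  have n2 := denominator_ne_zero hα0 hα1 μ.2 (norm_exp_neg_lt_one hzr)
  simp only [mlLaplace, schemeFun]
  rw [one_sub_exp_neg_cpow α hzr] at n2 ⊢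
  generalize z ^ ((α - 1 : ℝ) : ℂ) = x₁ at n1 n2 ⊢
  generalize z ^ (α : ℂ) = x₂ at n1 n2 ⊢
  generalize expQuot z ^ (α : ℂ) = x₃ at n1 n2 ⊢
  generalize avgSymbol α (Complex.exp (-z)) = x₄ at n1 n2 ⊢
  generalize bdfSymbol (Complex.exp (-z)) = x₅ at n1 n2 ⊢
  generalize powerSeriesFun α (Complex.exp (-z)) = x₆ at n1 n2 ⊢
  generalize ((μ : ℝ) : ℂ) = x₇ at n1 n2 ⊢
  linear_combination x₁ * (x₂ + x₇)⁻¹ * mul_inv_cancel₀ n2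
    - x₁ * x₄ * (x₂ * x₃ + x₇ * x₄)⁻¹ * mul_inv_cancel₀ n1

/-! ### Laplace transforms of powers -/

/-- The function `t₊ ^ a e^(-z t)` on the real line. -/
noncomputable def powExp (a : ℝ) (z : ℂ) (t : ℝ) : ℂ :=
  ((max t 0 ^ a : ℝ) : ℂ) * Complex.exp (-(z * t))

theorem powExp_of_nonpos {a : ℝ} (ha : 0 < a) (z : ℂ) {t : ℝ} (ht : t ≤ 0) : powExp a z t = 0 := by
  simp [powExp, max_eq_right ht, Real.zero_rpow ha.ne']

theorem powExp_of_pos (a : ℝ) (z : ℂ) {t : ℝ} (ht : 0 < t) :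
    powExp a z t = ((t ^ a : ℝ) : ℂ) * Complex.exp (-(z * t)) := by
  simp [powExp, max_eq_left ht.le]

theorem continuous_powExp {a : ℝ} (ha : 0 < a) (z : ℂ) : Continuous (powExp a z) := by
  have : Continuous fun t : ℝ => max t 0 ^ a :=
    (continuous_id.max continuous_const).rpow_const fun _ => Or.inr ha.le
  unfold powExp
  fun_prop

theorem norm_powExp (a : ℝ) (z : ℂ) (t : ℝ) :
    ‖powExp a z t‖ = max t 0 ^ a * Real.exp (-(z.re * t)) := by
  rw [powExp, norm_mul, Complex.norm_exp, Complex.norm_real, Real.norm_of_nonneg]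
  · simp
  · exact Real.rpow_nonneg (le_max_right _ _) _

theorem integrable_max_rpow_mul_exp {a : ℝ} (ha : 0 < a) {x : ℝ} (hx : 0 < x) :
    Integrable fun t : ℝ => max t 0 ^ a * Real.exp (-(x * t)) := by
  have h := integrableOn_rpow_mul_exp_neg_mul_rpow (s := a) (p := 1) (b := x) (by linarith) one_pos hx
  rw [← integrableOn_iff_integrable_of_support_subset (s := Set.Ioi 0)]
  · refine h.congr_fun (fun t ht => ?_) measurableSet_Ioi
    simp [max_eq_left (le_of_lt (Set.mem_Ioi.1 ht))]
  · intro t ht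
    by_contra h0
    have h1 : t ≤ 0 := not_lt.1 h0
    exact ht (by simp [max_eq_right h1, Real.zero_rpow ha.ne'])

theorem integrable_powExp {a : ℝ} (ha : 0 < a) {z : ℂ} (hz : 0 < z.re) :
    Integrable (powExp a z) := by
  refine (integrable_norm_iff (continuous_powExp ha z).aestronglyMeasurable).1 ?_
  simpa only [norm_powExp] using integrable_max_rpow_mul_exp ha hz

/-- `∫ t₊ ^ a e^(-z t) dt = Γ(a + 1) z^(-(a + 1))`; the case of real `z` extends to the right
half-plane by analytic continuation. -/
theorem integral_powExp {a : ℝ} (ha : 0 < a) {z : ℂ} (hz : 0 < z.re) :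
    ∫ t, powExp a z t = Real.Gamma (a + 1) * z ^ ((-(a + 1) : ℝ) : ℂ) := by
  -- the integral is the moment generating function of the measure `t₊ ^ a dt`, which is holomorphic
  set ν : Measure ℝ := volume.withDensity fun t => ENNReal.ofReal (max t 0 ^ a) with hν
  have hmeas : Measurable fun t : ℝ => ENNReal.ofReal (max t 0 ^ a) := by fun_prop
  have hnn : ∀ t : ℝ, 0 ≤ max t 0 ^ a := fun t => Real.rpow_nonneg (le_max_right _ _) _
  have hmgf : ∀ w : ℂ, ProbabilityTheory.complexMGF id ν (-w) = ∫ t, powExp a w t := by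
    intro w
    rw [ProbabilityTheory.complexMGF, hν, integral_withDensity_eq_integral_toReal_smul hmeas
      (ae_of_all _ fun _ => ENNReal.ofReal_lt_top)]
    refine integral_congr_ae (ae_of_all _ fun t => ?_)
    simp [powExp, ENNReal.toReal_ofReal (hnn t)]
  have hset : Set.Iio (0 : ℝ) ⊆ ProbabilityTheory.integrableExpSet id ν := by
    intro x hx
    change Integrable _ _
    rw [hν, integrable_withDensity_iff_integrable_smul' hmeas
      (ae_of_all _ fun _ => ENNReal.ofReal_lt_top)]
    refine (integrable_max_rpow_mul_exp ha (x := -x) (by simpa using hx)).congr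
      (ae_of_all _ fun t => ?_)
    simp [ENNReal.toReal_ofReal (hnn t)]
  have hint : ∀ w : ℂ, 0 < w.re → (-w).re ∈ interior (ProbabilityTheory.integrableExpSet id ν) :=
    fun w hw => interior_maximal hset isOpen_Iio (by simpa using hw)
  have hU : IsOpen {w : ℂ | 0 < w.re} := isOpen_lt continuous_const Complex.continuous_re
  have hF : AnalyticOnNhd ℂ (fun w => ∫ t, powExp a w t) {w : ℂ | 0 < w.re} := by
    refine DifferentiableOn.analyticOnNhd (fun w hw => ?_) hU
    rw [← funext hmgf]
    exact (DifferentiableAt.comp w (ProbabilityTheory.hasDerivAt_complexMGF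
      (hint w hw)).differentiableAt differentiableAt_id.neg).differentiableWithinAt
  have hG : AnalyticOnNhd ℂ (fun w : ℂ => (Real.Gamma (a + 1) : ℂ) * w ^ ((-(a + 1) : ℝ) : ℂ))
      {w : ℂ | 0 < w.re} := by
    refine DifferentiableOn.analyticOnNhd (fun w hw => ?_) hU
    exact ((differentiableAt_id.cpow_const (Or.inl hw)).const_mul _).differentiableWithinAt
  have hreal : ∀ x : ℝ, 0 < x →
      ∫ t, powExp a x t = Real.Gamma (a + 1) * (x : ℂ) ^ ((-(a + 1) : ℝ) : ℂ) := by
    intro x hx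
    have h := Real.integral_rpow_mul_exp_neg_mul_Ioi (a := a + 1) (by linarith) hx
    rw [add_sub_cancel_right] at h
    rw [← Complex.ofReal_cpow hx.le, Real.rpow_neg hx.le, ← Real.inv_rpow hx.le, ← one_div,
      mul_comm, ← Complex.ofReal_mul, ← h, ← integral_complex_ofReal,
      ← setIntegral_eq_integral_of_forall_compl_eq_zero (s := Set.Ioi 0)
        fun t ht => powExp_of_nonpos ha _ (not_lt.1 ht)]
    refine setIntegral_congr_fun measurableSet_Ioi fun t ht => ?_
    simp [powExp_of_pos a _ ht]
  refine hF.eqOn_of_preconnected_of_frequently_eq hG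
    (convex_halfSpace_re_gt 0).isPreconnected (z₀ := 1) (by simp) ?_ hz
  have h1 : Tendsto (fun n : ℕ => (((1 : ℝ) + 1 / ((n : ℝ) + 1) : ℝ) : ℂ)) atTop (𝓝[≠] 1) := by
    refine tendsto_nhdsWithin_iff.2 ⟨?_, Eventually.of_forall fun n => ?_⟩
    · have := tendsto_one_div_add_atTop_nhds_zero_nat (𝕜 := ℝ)
      have := (Complex.continuous_ofReal.tendsto _).comp (this.const_add 1)
      simpa [Function.comp_def] using this
    · have : (0 : ℝ) < 1 / ((n : ℝ) + 1) := by positivity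
      intro h
      have := Complex.ofReal_injective (h.trans Complex.ofReal_one.symm)
      linarith
  exact h1.frequently (Eventually.of_forall fun n => hreal _ (by positivity)).frequently

theorem fourier_powExp {a : ℝ} (ha : 0 < a) {z : ℂ} (hz : 0 < z.re) (ξ : ℝ) :
    𝓕 (powExp a z) ξ
      = Real.Gamma (a + 1) * (z + 2 * Real.pi * ξ * Complex.I) ^ ((-(a + 1) : ℝ) : ℂ) := by
  rw [← integral_powExp ha (by simpa using hz), Real.fourier_real_eq_integral_exp_smul]
  refine integral_congr_ae (ae_of_all _ fun t => ?_)
  simp only [powExp, smul_eq_mul]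
  rw [mul_left_comm, ← Complex.exp_add]
  congr 2
  push_cast
  ring

theorem powExp_isBigO {a : ℝ} (ha : 0 < a) {z : ℂ} (hz : 0 < z.re) :
    powExp a z =O[cocompact ℝ] fun t => |t| ^ (-2 : ℝ) := by
  rw [cocompact_eq_atBot_atTop, Asymptotics.isBigO_sup]
  constructor
  · refine (Asymptotics.isBigO_zero _ _).congr' ?_ EventuallyEq.rfl
    filter_upwards [eventually_le_atBot 0] with t ht using (powExp_of_nonpos ha z ht).symm
  · have h1 := (isLittleO_exp_neg_mul_rpow_atTop hz (-2 - a)).isBigO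
    have h2 := (Asymptotics.isBigO_refl (fun t : ℝ => t ^ a) atTop).mul h1
    refine (Asymptotics.isBigO_norm_left.1 ?_)
    refine h2.congr' ?_ ?_
    · filter_upwards [eventually_gt_atTop 0] with t ht
      rw [norm_powExp, max_eq_left ht.le, neg_mul]
    · filter_upwards [eventually_gt_atTop 0] with t ht
      rw [← Real.rpow_add ht, abs_of_pos ht]
      congr 1
      ring

/-- The part of the sum `∑ₖ (z + 2πik)^(α - 3)`, `k ∈ ℤ`, with `k ≠ 0`. -/
noncomputable def shiftedPowers (α : ℝ) (z : ℂ) : ℂ :=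
  ∑' k : ℤ, if k = 0 then 0 else (z + 2 * Real.pi * k * Complex.I) ^ ((α - 3 : ℝ) : ℂ)

/-- An open strip that contains `closedHalfStrip` and whose translates by `2πik`, `k ≠ 0`, do not meet
the real axis. -/
def wideStrip : Set ℂ := {z | |z.im| < 5}

theorem isOpen_wideStrip : IsOpen wideStrip :=
  isOpen_lt (continuous_abs.comp Complex.continuous_im) continuous_const

theorem closedHalfStrip_subset_wideStrip : closedHalfStrip ⊆ wideStrip := by
  rintro z ⟨-, h1, h2⟩
  change |z.im| < 5
  rw [abs_lt]
  constructor <;> linarith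

theorem abs_le_abs_im_shift {z : ℂ} (hz : z ∈ wideStrip) {k : ℤ} (hk : k ≠ 0) :
    |(k : ℝ)| ≤ |(z + 2 * Real.pi * k * Complex.I).im| := by
  have him : (z + 2 * Real.pi * k * Complex.I).im = z.im + 2 * Real.pi * k := by
    simp
  have h1 : (1 : ℝ) ≤ |(k : ℝ)| := by exact_mod_cast Int.one_le_abs hk
  have h2 : |2 * Real.pi * k| - |z.im| ≤ |z.im + 2 * Real.pi * k| := by
    have := abs_sub_abs_le_abs_sub (2 * Real.pi * k) (-z.im)
    rw [abs_neg, sub_neg_eq_add, add_comm (2 * Real.pi * k)] at this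
    exact this
  have h3 : |2 * Real.pi * k| = 2 * Real.pi * |(k : ℝ)| := by
    rw [abs_mul, abs_of_pos (by positivity)]
  have h4 : |z.im| < 5 := hz
  have := Real.pi_gt_three
  rw [him]
  nlinarith

theorem norm_shift_cpow_le {α : ℝ} (hα1 : α < 1) {z : ℂ} (hz : z ∈ wideStrip) {k : ℤ}
    (hk : k ≠ 0) : ‖(z + 2 * Real.pi * k * Complex.I) ^ ((α - 3 : ℝ) : ℂ)‖
      ≤ |(k : ℝ)| ^ (-(3 - α)) := by
  rw [Complex.norm_cpow_real, neg_sub]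
  have h1 : (0 : ℝ) < |(k : ℝ)| := by positivity
  exact Real.rpow_le_rpow_of_nonpos h1
    ((abs_le_abs_im_shift hz hk).trans (Complex.abs_im_le_norm _)) (by linarith)

theorem differentiableOn_shiftedPowers {α : ℝ} (hα1 : α < 1) :
    DifferentiableOn ℂ (shiftedPowers α) wideStrip := by
  refine Complex.differentiableOn_tsum_of_summable_norm
    (Real.summable_abs_int_rpow (b := 3 - α) (by linarith)) ?_ isOpen_wideStrip ?_
  · intro k
    by_cases hk : k = 0
    · simp [hk]
    · simp only [hk, if_false]
      intro z hz
      refine DifferentiableAt.differentiableWithinAt ?_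
      refine DifferentiableAt.cpow_const (by fun_prop) (Or.inr fun h => ?_)
      have h1 := abs_le_abs_im_shift hz hk
      have h2 : (0 : ℝ) < |(k : ℝ)| := by positivity
      rw [h, abs_zero] at h1
      linarith
  · intro k z hz
    by_cases hk : k = 0
    · simp only [hk, if_true, norm_zero]; positivity
    · simpa only [hk, if_false] using norm_shift_cpow_le hα1 hz hk

/-- Poisson summation for the generating function of the powers: the zero frequency contributes the
Laplace transform of the power, and the others a function holomorphic near the origin. -/
theorem powerSeriesFun_exp_neg {α : ℝ} (hα1 : α < 1) {z : ℂ} (hz : z ∈ halfStrip) :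
    powerSeriesFun α (Complex.exp (-z)) = z ^ ((α - 3 : ℝ) : ℂ) + shiftedPowers α z := by
  have hre := re_pos_of_mem_halfStrip hz
  have ha : 0 < 2 - α := by linarith
  have hw := closedHalfStrip_subset_wideStrip (halfStrip_subset hz)
  have hΓ : (Real.Gamma (3 - α) : ℂ) ≠ 0 :=
    Complex.ofReal_ne_zero.2 (Real.Gamma_pos_of_pos (by linarith)).ne'
  have hF : ∀ k : ℤ, 𝓕 (powExp (2 - α) z) k
      = Real.Gamma (3 - α) * (z + 2 * Real.pi * k * Complex.I) ^ ((α - 3 : ℝ) : ℂ) := by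
    intro k
    rw [fourier_powExp ha hre, show 2 - α + 1 = 3 - α by ring, neg_sub]
    simp
  have hsum : Summable fun k : ℤ => (z + 2 * Real.pi * k * Complex.I) ^ ((α - 3 : ℝ) : ℂ) := by
    refine Summable.of_norm_bounded_eventually
      (Real.summable_abs_int_rpow (b := 3 - α) (by linarith)) ?_
    filter_upwards [(Set.finite_singleton (0 : ℤ)).compl_mem_cofinite] with k hk
    exact norm_shift_cpow_le hα1 hw hk
  have hpoisson := Real.tsum_eq_tsum_fourier_of_rpow_decay_of_summable (continuous_powExp ha z)
    one_lt_two (powExp_isBigO ha hre) (by simpa only [hF] using hsum.mul_left _) 0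
  simp only [zero_add, hF, QuotientAddGroup.mk_zero, fourier_eval_zero, mul_one] at hpoisson
  rw [tsum_mul_left, hsum.tsum_eq_add_tsum_ite 0] at hpoisson
  have hnat : ∑' n : ℤ, powExp (2 - α) z n = ∑' n : ℕ, powExp (2 - α) z n := by
    rw [← Nat.cast_injective (R := ℤ) |>.tsum_eq]
    · simp
    · intro n hn
      by_contra h
      refine hn (powExp_of_nonpos ha z ?_)
      rcases lt_or_ge n 0 with h0 | h0
      · exact_mod_cast h0.le
      · exact absurd ⟨n.toNat, by simpa using h0⟩ h
  rw [hnat] at hpoisson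
  have hterm : powerSeriesFun α (Complex.exp (-z))
      = (Real.Gamma (3 - α) : ℂ)⁻¹ * ∑' n : ℕ, powExp (2 - α) z n := by
    rw [powerSeriesFun, ← tsum_mul_left]
    refine tsum_congr fun n => ?_
    rw [powExp, max_eq_left n.cast_nonneg, ← Complex.exp_nat_mul]
    push_cast
    ring_nf
  rw [hterm, hpoisson, ← mul_assoc, inv_mul_cancel₀ hΓ, one_mul]
  simp [shiftedPowers]

/-- Decay of order greater than `1` makes a function integrable on vertical lines. -/
theorem integrable_norm_vertical {x : ℝ} (hx : 0 < x) {s : ℝ} (hs : 1 < s) :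
    Integrable fun y : ℝ => ‖(x + y * Complex.I : ℂ)‖ ^ (-s) := by
  have h : Integrable fun y : ℝ => (1 + ‖y‖) ^ (-s) :=
    integrable_one_add_norm (by simpa using hs)
  set c := min x 1 / 2 with hc
  have hc0 : 0 < c := by have := lt_min hx one_pos; positivity
  have hlow : ∀ y : ℝ, c * (1 + ‖y‖) ≤ ‖(x + y * Complex.I : ℂ)‖ := by
    intro y
    have h1 : |x| ≤ ‖(x + y * Complex.I : ℂ)‖ := by
      simpa using Complex.abs_re_le_norm (x + y * Complex.I : ℂ)
    have h2 : |y| ≤ ‖(x + y * Complex.I : ℂ)‖ := by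
      simpa using Complex.abs_im_le_norm (x + y * Complex.I : ℂ)
    rw [abs_of_pos hx] at h1
    rw [Real.norm_eq_abs]
    have h3 := min_le_left x 1
    have h4 := min_le_right x 1
    have h5 := abs_nonneg y
    rw [hc]
    nlinarith
  refine Integrable.mono' (h.const_mul (c ^ (-s))) ?_ (ae_of_all _ fun y => ?_)
  · exact (by fun_prop : Measurable fun y : ℝ => ‖(x + y * Complex.I : ℂ)‖ ^ (-s)).aestronglyMeasurable
  · rw [Real.norm_of_nonneg (by positivity), ← Real.mul_rpow hc0.le (by positivity)]
    exact Real.rpow_le_rpow_of_nonpos (by positivity) (hlow y) (by linarith)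

/-- Inversion of the Laplace transform of a power. -/
theorem integral_cpow_mul_exp {a : ℝ} (ha : 0 < a) {x : ℝ} (hx : 0 < x) {t : ℝ} (ht : 0 < t) :
    ∫ y : ℝ, (x + y * Complex.I) ^ ((-(a + 1) : ℝ) : ℂ) * Complex.exp ((x + y * Complex.I) * t)
      = 2 * Real.pi * (t ^ a / Real.Gamma (a + 1) : ℝ) := by
  have hxre : 0 < (x : ℂ).re := by simpa using hx
  have hΓ : (Real.Gamma (a + 1) : ℂ) ≠ 0 :=
    Complex.ofReal_ne_zero.2 (Real.Gamma_pos_of_pos (by linarith)).ne'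
  have hπ : (2 * Real.pi : ℝ) ≠ 0 := by positivity
  set g : ℝ → ℂ := fun y => (x + y * Complex.I) ^ ((-(a + 1) : ℝ) : ℂ)
    * Complex.exp ((x + y * Complex.I) * t) with hg
  have hF : ∀ ξ : ℝ, 𝓕 (powExp a x) ξ = Real.Gamma (a + 1)
      * (x + (2 * Real.pi * ξ : ℝ) * Complex.I) ^ ((-(a + 1) : ℝ) : ℂ) := by
    intro ξ
    rw [fourier_powExp ha hxre]
    push_cast
    rfl
  have hFint : Integrable (𝓕 (powExp a x)) := by
    have h1 : Integrable fun y : ℝ => (x + y * Complex.I) ^ ((-(a + 1) : ℝ) : ℂ) := by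
      refine (integrable_norm_vertical hx (s := a + 1) (by linarith)).mono' ?_
        (ae_of_all _ fun y => (Complex.norm_cpow_real _ _).le)
      exact (by fun_prop : Measurable fun y : ℝ =>
        ((x : ℂ) + y * Complex.I) ^ ((-(a + 1) : ℝ) : ℂ)).aestronglyMeasurable
    rw [funext hF]
    exact (h1.comp_mul_left' hπ).const_mul _
  have hinv := (integrable_powExp ha hxre).fourierInv_fourier_eq hFint
    (continuous_powExp ha (x : ℂ)).continuousAt (v := t)
  rw [Real.fourierInv_eq', powExp_of_pos a _ ht] at hinv
  have hsub : ∫ ξ : ℝ, g (2 * Real.pi * ξ) = (2 * Real.pi : ℂ)⁻¹ * ∫ y, g y := by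
    rw [Measure.integral_comp_mul_left, abs_of_pos (by positivity)]
    simp
  have hcomp : ∫ ξ : ℝ, g (2 * Real.pi * ξ) = Complex.exp (x * t) * (Real.Gamma (a + 1) : ℂ)⁻¹
      * ∫ ξ : ℝ, Complex.exp ((2 * Real.pi * inner ℝ ξ t : ℝ) * Complex.I) • 𝓕 (powExp a x) ξ := by
    rw [← integral_const_mul]
    refine integral_congr_ae (ae_of_all _ fun ξ => ?_)
    simp only [hg, hF, smul_eq_mul, add_mul, Complex.exp_add, RCLike.inner_apply, conj_trivial]
    field_simp
    congr 2
    push_cast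
    ring
  rw [hinv, hsub] at hcomp
  have hexp : Complex.exp (x * t) * Complex.exp (-(x * t)) = 1 := by
    rw [← Complex.exp_add]; simp
  have hπ' : (2 * Real.pi : ℂ) ≠ 0 := by exact_mod_cast hπ
  change ∫ y, g y = _
  rw [inv_mul_eq_iff_eq_mul₀ hπ'] at hcomp
  rw [hcomp, mul_assoc (Complex.exp _)]
  push_cast
  field_simp
  linear_combination ((t ^ a : ℝ) : ℂ) * hexp

/-! ### The Mittag-Leffler function as a contour integral -/

/-- The terms of the Mittag-Leffler series of `E(-μ t ^ α)`. -/
noncomputable def mlTerm (α μ t : ℝ) (k : ℕ) : ℝ :=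
  (-μ) ^ k * (t ^ (α * k) / Real.Gamma (α * k + 1))

/-- `mlLaplace α μ z - z⁻¹`, which decays fast enough to be integrable on vertical lines. -/
noncomputable def mlLaplaceReg (α μ : ℝ) (z : ℂ) : ℂ :=
  -μ * (z ^ ((-1 : ℝ) : ℂ) * (z ^ (α : ℂ) + μ)⁻¹)

theorem isOpen_rightHalfPlane : IsOpen {z : ℂ | 0 < z.re} :=
  isOpen_lt continuous_const Complex.continuous_re

theorem cpow_add_ne_zero {α : ℝ} (hα0 : 0 < α) (hα1 : α < 1) {μ : ℝ} (hμ : 0 < μ) {z : ℂ}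
    (hz : 0 < z.re) : z ^ (α : ℂ) + μ ≠ 0 := by
  rw [← norm_pos_iff]
  refine lt_of_lt_of_le (mul_pos (cos_alpha_pos hα0 hα1) ?_) (le_norm_cpow_add hα0 hα1 hμ.le hz)
  positivity

theorem mlLaplace_eq {α : ℝ} (hα0 : 0 < α) (hα1 : α < 1) {μ : ℝ} (hμ : 0 < μ) {z : ℂ}
    (hz : 0 < z.re) : mlLaplace α μ z = mlLaplaceReg α μ z + z ^ ((-1 : ℝ) : ℂ) := by
  have hz0 : z ≠ 0 := fun h => by simp [h] at hz
  have h1 := cpow_add_ne_zero hα0 hα1 hμ hz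
  have h2 : z ^ ((α - 1 : ℝ) : ℂ) = z ^ (α : ℂ) * z ^ ((-1 : ℝ) : ℂ) := by
    rw [← Complex.cpow_add _ _ hz0]; congr 1; push_cast; ring
  rw [mlLaplace, mlLaplaceReg, h2]
  generalize z ^ ((-1 : ℝ) : ℂ) = a
  field_simp
  ring

theorem isSymbol_mlLaplaceReg {α : ℝ} (hα0 : 0 < α) (hα1 : α < 1) {μ : ℝ} (hμ : 0 < μ) (k : ℕ) :
    IsSymbol {z : ℂ | 0 < z.re} k (-(α + 1)) (fun (_ : Unit) => mlLaplaceReg α μ) := by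
  have h0 : (0 : ℂ) ∉ {z : ℂ | 0 < z.re} := by simp
  have hD := isOpen_rightHalfPlane
  have h1 := (isSymbol_inv_cpow_add hα0 hα1 hD (fun _ h => h) k).comp
    (fun _ : Unit => (⟨μ, hμ⟩ : PosReal))
  have h2 := ((IsSymbol.cpow (ι := Unit) (k := k) hD (fun _ h => h) (-1)).mul hD h0 h1).const_mul
    hD h0 (-μ)
  rw [show -1 + -α = -(α + 1) by ring] at h2
  exact h2

theorem IsSymbol.bound_third {ι : Type*} {D : Set ℂ} {m : ℝ} {f : ι → ℂ → ℂ}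
    (h : IsSymbol D 3 m f) :
    ∃ C : ℝ, ∀ i, ∀ z ∈ D, ‖deriv (deriv (deriv (f i))) z‖ ≤ C * ‖z‖ ^ (m - 3) := by
  obtain ⟨C, hC⟩ := h.2.2.2.2.2.2
  refine ⟨C, fun i z hz => (hC i z hz).trans_eq ?_⟩
  congr 2
  ring

theorem continuous_vertical {f : ℂ → ℂ} (hf : ContinuousOn f {z : ℂ | 0 < z.re}) {x : ℝ}
    (hx : 0 < x) : Continuous fun y : ℝ => f (x + y * Complex.I) :=
  hf.comp_continuous (by fun_prop) fun y => by simpa using hx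

theorem norm_exp_vertical (x y t : ℝ) :
    ‖Complex.exp ((x + y * Complex.I) * t)‖ = Real.exp (x * t) := by
  rw [Complex.norm_exp]; simp

/-- Vertical integrals of a decaying holomorphic function do not depend on the line. -/
theorem integral_vertical_eq {f : ℂ → ℂ} (hf : DifferentiableOn ℂ f {z : ℂ | 0 < z.re})
    {x X : ℝ} (hx : 0 < x) (hxX : x ≤ X) {C s : ℝ} (hs : 1 < s)
    (hC : ∀ z : ℂ, 0 < z.re → z.re ≤ X → ‖f z‖ ≤ C * ‖z‖ ^ (-s)) :
    ∫ y : ℝ, f (x + y * Complex.I) = ∫ y : ℝ, f (X + y * Complex.I) := by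
  have hX : 0 < X := hx.trans_le hxX
  have hint : ∀ u : ℝ, 0 < u → u ≤ X → Integrable fun y : ℝ => f (u + y * Complex.I) := by
    intro u hu huX
    refine ((integrable_norm_vertical hu hs).const_mul C).mono'
      (continuous_vertical hf.continuousOn hu).aestronglyMeasurable (ae_of_all _ fun y => ?_)
    exact hC _ (by simpa using hu) (by simpa using huX)
  have hlim : ∀ u : ℝ, 0 < u → u ≤ X →
      Tendsto (fun R : ℝ => ∫ y in (-R)..R, f (u + y * Complex.I)) atTop
        (𝓝 (∫ y : ℝ, f (u + y * Complex.I))) := fun u hu huX =>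
    intervalIntegral_tendsto_integral (hint u hu huX) tendsto_neg_atTop_atBot tendsto_id
  have hC0 : 0 ≤ C := by
    have h := (norm_nonneg _).trans (hC X (by simpa using hX) (by simp))
    have h2 : 0 < ‖(X : ℂ)‖ ^ (-s) :=
      Real.rpow_pos_of_pos (norm_pos_iff.2 (Complex.ofReal_ne_zero.2 hX.ne')) _
    nlinarith
  have hhor : ∀ σ : ℝ, |σ| = 1 →
      Tendsto (fun R : ℝ => ∫ u in x..X, f (u + (σ * R : ℝ) * Complex.I)) atTop (𝓝 0) := by
    intro σ hσ
    have h1 : Tendsto (fun R : ℝ => C * R ^ (-s) * |X - x|) atTop (𝓝 0) := by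
      have := ((tendsto_rpow_neg_atTop (y := s) (by linarith)).const_mul C).mul_const |X - x|
      simpa using this
    refine squeeze_zero_norm' ?_ h1
    filter_upwards [eventually_gt_atTop 0] with R hR
    refine intervalIntegral.norm_integral_le_of_norm_le_const fun u hu => ?_
    rw [Set.uIoc_of_le hxX] at hu
    refine (hC _ (by simpa using hx.trans hu.1) (by simpa using hu.2)).trans ?_
    refine mul_le_mul_of_nonneg_left (Real.rpow_le_rpow_of_nonpos hR ?_ (by linarith)) hC0
    have := Complex.abs_im_le_norm ((u : ℂ) + (σ * R : ℝ) * Complex.I)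
    simpa [abs_mul, hσ, abs_of_pos hR] using this
  have hrect : ∀ R : ℝ, (∫ u in x..X, f (u + (-1 * R : ℝ) * Complex.I))
      - (∫ u in x..X, f (u + (1 * R : ℝ) * Complex.I))
      + Complex.I * (∫ y in (-R)..R, f (X + y * Complex.I))
      - Complex.I * (∫ y in (-R)..R, f (x + y * Complex.I)) = 0 := by
    intro R
    have h := Complex.integral_boundary_rect_eq_zero_of_differentiableOn f
      (x + (-R : ℝ) * Complex.I) (X + (R : ℝ) * Complex.I) (hf.mono ?_)
    · simpa [smul_eq_mul] using h
    · rintro z ⟨hz, -⟩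
      simp only [Complex.add_re, Complex.ofReal_re, Complex.re_ofReal_mul, Complex.I_re, mul_zero,
        add_zero, Set.uIcc_of_le hxX] at hz
      exact hx.trans_le hz.1
  have h := ((((hhor (-1) (by simp)).sub (hhor 1 (by simp))).add
    ((hlim X hX le_rfl).const_mul Complex.I)).sub ((hlim x hx hxX).const_mul Complex.I))
  simp only [hrect] at h
  have h' := tendsto_nhds_unique h tendsto_const_nhds
  have hI := Complex.I_ne_zero
  have : Complex.I * ((∫ y : ℝ, f (X + y * Complex.I)) - ∫ y : ℝ, f (x + y * Complex.I)) = 0 := by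
    rw [mul_sub]; simpa using h'
  rcases mul_eq_zero.1 this with h1 | h1
  · exact absurd h1 hI
  · exact (sub_eq_zero.1 h1).symm

/-- Integration by parts on a vertical line. -/
theorem mul_integral_vertical {f : ℂ → ℂ} (hf : DifferentiableOn ℂ f {z : ℂ | 0 < z.re})
    {x : ℝ} (hx : 0 < x) (t : ℝ) {C C' s s' : ℝ} (hs : 1 < s) (hs' : 1 < s')
    (hC : ∀ z : ℂ, 0 < z.re → ‖f z‖ ≤ C * ‖z‖ ^ (-s))
    (hC' : ∀ z : ℂ, 0 < z.re → ‖deriv f z‖ ≤ C' * ‖z‖ ^ (-s')) :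
    t * ∫ y : ℝ, f (x + y * Complex.I) * Complex.exp ((x + y * Complex.I) * t)
      = -∫ y : ℝ, deriv f (x + y * Complex.I) * Complex.exp ((x + y * Complex.I) * t) := by
  have hint : ∀ {g : ℂ → ℂ} {C s : ℝ}, 1 < s → ContinuousOn g {z : ℂ | 0 < z.re} →
      (∀ z : ℂ, 0 < z.re → ‖g z‖ ≤ C * ‖z‖ ^ (-s)) →
      Integrable fun y : ℝ => g (x + y * Complex.I) * Complex.exp ((x + y * Complex.I) * t) := by
    intro g C s hs hg hC
    refine (((integrable_norm_vertical hx hs).const_mul C).mul_const (Real.exp (x * t))).mono'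
      ((continuous_vertical hg hx).mul (by fun_prop)).aestronglyMeasurable
      (ae_of_all _ fun y => ?_)
    rw [norm_mul, norm_exp_vertical]
    gcongr
    exact hC _ (by simpa using hx)
  have h1 := hint hs hf.continuousOn hC
  have h2 := hint hs' (hf.deriv isOpen_rightHalfPlane).continuousOn hC'
  have hder : ∀ y : ℝ, HasDerivAt
      (fun y : ℝ => f (x + y * Complex.I) * Complex.exp ((x + y * Complex.I) * t))
      (Complex.I * (deriv f (x + y * Complex.I) * Complex.exp ((x + y * Complex.I) * t))
        + Complex.I * t * (f (x + y * Complex.I) * Complex.exp ((x + y * Complex.I) * t))) y := by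
    intro y
    have hmem : (x + y * Complex.I : ℂ) ∈ {z : ℂ | 0 < z.re} := by simpa using hx
    have e1 : HasDerivAt f (deriv f (x + y * Complex.I)) (x + y * Complex.I) :=
      (hf.differentiableAt (isOpen_rightHalfPlane.mem_nhds hmem)).hasDerivAt
    have e2 : HasDerivAt (fun y : ℝ => (x + y * Complex.I : ℂ)) Complex.I y := by
      simpa using ((hasDerivAt_id y).ofReal_comp.mul_const Complex.I).const_add (x : ℂ)
    have e3 := HasDerivAt.comp y e1 e2
    have e4 := (e2.mul_const (t : ℂ)).cexp
    refine (e3.fun_mul e4).congr_deriv ?_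
    simp only [Function.comp_apply]
    ring
  have h0 := integral_eq_zero_of_hasDerivAt_of_integrable hder
    ((h2.const_mul _).add (h1.const_mul _)) h1
  rw [integral_add (h2.const_mul _) (h1.const_mul _), integral_const_mul, integral_const_mul] at h0
  have : Complex.I * (((∫ y : ℝ, deriv f (x + y * Complex.I)
      * Complex.exp ((x + y * Complex.I) * t)))
      + t * ∫ y : ℝ, f (x + y * Complex.I) * Complex.exp ((x + y * Complex.I) * t)) = 0 := by
    rw [← h0]; ring
  rcases mul_eq_zero.1 this with h | h
  · exact absurd h Complex.I_ne_zero
  · linear_combination h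

/-- The Mittag-Leffler series without its first term, far to the right of the singularities, where
the Laplace transform is a geometric series. -/
theorem hasSum_mlTerm_succ {α : ℝ} (hα0 : 0 < α) (hα1 : α < 1) {μ : ℝ} (hμ : 0 < μ) {X : ℝ}
    (hX : 0 < X) (hμX : μ < X ^ α) {t : ℝ} (ht : 0 < t) :
    HasSum (fun k : ℕ => (2 * Real.pi * mlTerm α μ t (k + 1) : ℂ))
      (∫ y : ℝ, mlLaplaceReg α μ (X + y * Complex.I) * Complex.exp ((X + y * Complex.I) * t)) := by
  set F : ℕ → ℝ → ℂ := fun k y => (-μ : ℂ) ^ (k + 1) *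
    ((X + y * Complex.I) ^ ((-(α * (k + 1 : ℕ) + 1) : ℝ) : ℂ)
      * Complex.exp ((X + y * Complex.I) * t)) with hF
  have hz0 : ∀ y : ℝ, (X + y * Complex.I : ℂ) ≠ 0 := fun y h => by
    have := congrArg Complex.re h
    simp at this
    exact hX.ne' this
  have hnz : ∀ y : ℝ, X ≤ ‖(X + y * Complex.I : ℂ)‖ := fun y => by
    have := Complex.re_le_norm (X + y * Complex.I : ℂ)
    simpa using this
  have hbound : ∀ k y, ‖F k y‖ ≤ (μ * (μ * X ^ (-α)) ^ k * Real.exp (X * t)) *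
      ‖(X + y * Complex.I : ℂ)‖ ^ (-(α + 1)) := by
    intro k y
    have hpos : 0 < ‖(X + y * Complex.I : ℂ)‖ := norm_pos_iff.2 (hz0 y)
    simp only [hF]
    rw [norm_mul, norm_mul, norm_exp_vertical, Complex.norm_cpow_real, norm_pow, norm_neg,
      Complex.norm_real, Real.norm_of_nonneg hμ.le]
    have e1 : -(α * ((k + 1 : ℕ) : ℝ) + 1) = -α * k + -(α + 1) := by push_cast; ring
    rw [e1, Real.rpow_add hpos, Real.rpow_mul hpos.le, Real.rpow_natCast, mul_pow]
    have e2 : ‖(X + y * Complex.I : ℂ)‖ ^ (-α) ≤ X ^ (-α) :=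
      Real.rpow_le_rpow_of_nonpos hX (hnz y) (by linarith)
    calc _ = μ * μ ^ k * Real.exp (X * t) * ‖(X + y * Complex.I : ℂ)‖ ^ (-(α + 1))
          * (‖(X + y * Complex.I : ℂ)‖ ^ (-α)) ^ k := by ring
      _ ≤ μ * μ ^ k * Real.exp (X * t) * ‖(X + y * Complex.I : ℂ)‖ ^ (-(α + 1))
          * (X ^ (-α)) ^ k := by gcongr
      _ = _ := by ring
  have hFm : ∀ k, AEStronglyMeasurable (F k) := fun k =>
    (by simp only [hF]; fun_prop : Measurable (F k)).aestronglyMeasurable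
  have hbase := integrable_norm_vertical hX (s := α + 1) (by linarith)
  have hFi : ∀ k, Integrable (F k) := fun k =>
    (hbase.const_mul _).mono' (hFm k) (ae_of_all _ (hbound k))
  have hq : μ * X ^ (-α) < 1 := by
    rw [Real.rpow_neg hX.le, ← div_eq_mul_inv, div_lt_one (by positivity)]
    exact hμX
  have hq0 : 0 ≤ μ * X ^ (-α) := by positivity
  have hsum : Summable fun k => ∫ y, ‖F k y‖ := by
    refine Summable.of_nonneg_of_le (fun k => integral_nonneg fun y => norm_nonneg _)
      (fun k => integral_mono (hFi k).norm (hbase.const_mul _) (hbound k)) ?_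
    simp only [integral_const_mul]
    exact (((summable_geometric_of_lt_one hq0 hq).mul_left μ).mul_right _).mul_right _
  have h := hasSum_integral_of_summable_integral_norm hFi hsum
  have hterm : ∀ k, ∫ y, F k y = 2 * Real.pi * mlTerm α μ t (k + 1) := by
    intro k
    simp only [hF]
    rw [integral_const_mul, integral_cpow_mul_exp (a := α * (k + 1 : ℕ)) (by positivity) hX ht,
      mlTerm]
    push_cast
    ring
  have htsum : ∀ y : ℝ, ∑' k, F k y
      = mlLaplaceReg α μ (X + y * Complex.I) * Complex.exp ((X + y * Complex.I) * t) := by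
    intro y
    set z : ℂ := X + y * Complex.I with hz
    have hzre : 0 < z.re := by simpa [hz] using hX
    have hne := cpow_add_ne_zero hα0 hα1 hμ hzre
    have hzα : z ^ (α : ℂ) ≠ 0 := by simp [Complex.cpow_eq_zero_iff, hz0 y, hz]
    have hnorm : ‖-μ * z ^ ((-α : ℝ) : ℂ)‖ < 1 := by
      rw [norm_mul, norm_neg, Complex.norm_real, Real.norm_of_nonneg hμ.le, Complex.norm_cpow_real]
      refine lt_of_le_of_lt ?_ hq
      gcongr 1
      exact Real.rpow_le_rpow_of_nonpos hX (hnz y) (by linarith)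
    have hgeo : ∀ k, F k y = (-μ * z ^ ((-α : ℝ) : ℂ)) ^ k
        * (-μ * z ^ ((-α : ℝ) : ℂ) * z ^ ((-1 : ℝ) : ℂ) * Complex.exp (z * t)) := by
      intro k
      simp only [hF]
      have : z ^ ((-(α * (k + 1 : ℕ) + 1) : ℝ) : ℂ)
          = (z ^ ((-α : ℝ) : ℂ)) ^ (k + 1) * z ^ ((-1 : ℝ) : ℂ) := by
        rw [← Complex.cpow_nat_mul, ← Complex.cpow_add _ _ (hz0 y)]
        congr 1
        push_cast
        ring
      rw [this]
      ring
    simp only [hgeo]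
    rw [tsum_mul_right, tsum_geometric_of_norm_lt_one hnorm, mlLaplaceReg]
    have hinv : z ^ ((-α : ℝ) : ℂ) = (z ^ (α : ℂ))⁻¹ := by
      rw [Complex.ofReal_neg, Complex.cpow_neg]
    rw [hinv]
    have h1 : 1 - -μ * (z ^ (α : ℂ))⁻¹ = (z ^ (α : ℂ) + μ) / z ^ (α : ℂ) := by
      field_simp
      ring
    rw [h1]
    field_simp
  simp only [hterm, htsum] at h
  exact h

theorem summable_mlTerm {α : ℝ} (hα0 : 0 < α) (hα1 : α < 1) {μ : ℝ} (hμ : 0 < μ) {t : ℝ}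
    (ht : 0 < t) : Summable (mlTerm α μ t) := by
  have hX : (0 : ℝ) < (2 * μ) ^ α⁻¹ := by positivity
  have hμX : μ < ((2 * μ) ^ α⁻¹) ^ α := by
    rw [← Real.rpow_mul (by positivity), inv_mul_cancel₀ hα0.ne', Real.rpow_one]
    linarith
  have h := (hasSum_mlTerm_succ hα0 hα1 hμ hX hμX ht).summable.mul_left ((2 * Real.pi : ℂ)⁻¹)
  have hπ : (2 * Real.pi : ℂ) ≠ 0 := by simp [Real.pi_ne_zero]
  simp only [inv_mul_cancel_left₀ hπ] at h
  exact (summable_nat_add_iff 1).1 (Complex.summable_ofReal.1 h)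

/-- Three integrations by parts turn the inversion integral for `E(-μ t ^ α)` into an absolutely
convergent one, on any vertical line in the right half-plane. -/
theorem integral_third_deriv_mlLaplace {α : ℝ} (hα0 : 0 < α) (hα1 : α < 1) {μ : ℝ} (hμ : 0 < μ)
    {x : ℝ} (hx : 0 < x) {t : ℝ} (ht : 0 < t) :
    ∫ y : ℝ, deriv (deriv (deriv (mlLaplace α μ))) (x + y * Complex.I)
        * Complex.exp ((x + y * Complex.I) * t)
      = -(2 * Real.pi * t ^ 3 * (∑' k, mlTerm α μ t k : ℝ)) := by
  have hD := isOpen_rightHalfPlane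
  obtain ⟨⟨C0, hC0⟩, d0, ⟨C1, hC1⟩, d1, ⟨C2, hC2⟩, d2, C3, hC3⟩ :=
    isSymbol_mlLaplaceReg hα0 hα1 hμ 3
  replace d0 := d0 ()
  replace d1 := d1 ()
  replace d2 := d2 ()
  -- the inversion formula for the regularized transform on the given line
  have hinv : ∫ y : ℝ, mlLaplaceReg α μ (x + y * Complex.I) * Complex.exp ((x + y * Complex.I) * t)
      = 2 * Real.pi * ((∑' k, mlTerm α μ t k : ℝ) - 1) := by
    set X : ℝ := max x ((2 * μ) ^ α⁻¹) with hXdef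
    have hX : 0 < X := hx.trans_le (le_max_left _ _)
    have hμX : μ < X ^ α := by
      have h1 : ((2 * μ) ^ α⁻¹) ^ α = 2 * μ := by
        rw [← Real.rpow_mul (by positivity), inv_mul_cancel₀ hα0.ne', Real.rpow_one]
      have h2 := Real.rpow_le_rpow (by positivity) (le_max_right x ((2 * μ) ^ α⁻¹)) hα0.le
      rw [h1] at h2
      linarith
    have hs := hasSum_mlTerm_succ hα0 hα1 hμ hX hμX ht
    have hshift := integral_vertical_eq
      (f := fun z => mlLaplaceReg α μ z * Complex.exp (z * t)) (C := C0 * Real.exp (X * t))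
      (s := α + 1) (d0.mul (by fun_prop)) hx (le_max_left x ((2 * μ) ^ α⁻¹)) (by linarith) ?_
    · rw [hshift, ← hs.tsum_eq, tsum_mul_left]
      have h0 : mlTerm α μ t 0 = 1 := by simp [mlTerm]
      rw [(summable_mlTerm hα0 hα1 hμ ht).tsum_eq_zero_add, h0]
      push_cast
      ring
    · intro z hz hzX
      have h1 := hC0 () z hz
      rw [norm_mul, Complex.norm_exp, mul_right_comm]
      refine mul_le_mul h1 ?_ (Real.exp_nonneg _) ((norm_nonneg _).trans h1)
      refine Real.exp_le_exp.2 ?_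
      simp only [Complex.mul_re, Complex.ofReal_re, Complex.ofReal_im, mul_zero, sub_zero]
      exact mul_le_mul_of_nonneg_right hzX ht.le
  have p1 := mul_integral_vertical d0 hx t (s := α + 1) (s' := α + 2) (by linarith) (by linarith)
    (hC0 ()) (fun z hz => (hC1 () z hz).trans_eq (by ring_nf))
  have p2 := mul_integral_vertical d1 hx t (s := α + 2) (s' := α + 3) (by linarith) (by linarith)
    (fun z hz => (hC1 () z hz).trans_eq (by ring_nf))
    (fun z hz => (hC2 () z hz).trans_eq (by ring_nf))
  have p3 := mul_integral_vertical d2 hx t (s := α + 3) (s' := α + 4) (by linarith) (by linarith)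
    (fun z hz => (hC2 () z hz).trans_eq (by ring_nf))
    (fun z hz => (hC3 () z hz).trans_eq (by ring_nf))
  have hpow := integral_cpow_mul_exp (a := 3) (by norm_num) hx ht
  have hΓ : Real.Gamma (3 + 1) = 6 := by
    norm_num [Nat.factorial]
  -- the third derivative of the full transform
  have hpd : ∀ a : ℝ, Set.EqOn (deriv fun z : ℂ => z ^ (a : ℂ))
      (fun z => (a : ℂ) * z ^ ((a - 1 : ℝ) : ℂ)) {z : ℂ | 0 < z.re} := by
    intro a z hz
    have := (hasDerivAt_id z).cpow_const (c := (a : ℂ)) (Or.inl hz)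
    simpa using this.deriv
  have hpdiff : ∀ a : ℝ, ∀ z ∈ {z : ℂ | 0 < z.re},
      DifferentiableAt ℂ (fun z : ℂ => z ^ (a : ℂ)) z := fun a z hz =>
    differentiableAt_id.cpow_const (Or.inl hz)
  have D1 : Set.EqOn (deriv (mlLaplace α μ))
      (fun z => deriv (mlLaplaceReg α μ) z + (-1) * z ^ ((-2 : ℝ) : ℂ)) {z : ℂ | 0 < z.re} := by
    have h : Set.EqOn (mlLaplace α μ) (fun z => mlLaplaceReg α μ z + z ^ ((-1 : ℝ) : ℂ))
      {z : ℂ | 0 < z.re} := fun z hz => mlLaplace_eq hα0 hα1 hμ hz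
    intro z hz
    rw [h.deriv hD hz, deriv_fun_add (d0.differentiableAt (hD.mem_nhds hz)) (hpdiff _ z hz),
      hpd _ hz]
    norm_num
  have D2 : Set.EqOn (deriv (deriv (mlLaplace α μ)))
      (fun z => deriv (deriv (mlLaplaceReg α μ)) z + 2 * z ^ ((-3 : ℝ) : ℂ)) {z : ℂ | 0 < z.re} := by
    intro z hz
    rw [D1.deriv hD hz, deriv_fun_add (d1.differentiableAt (hD.mem_nhds hz))
      ((hpdiff _ z hz).const_mul _), deriv_const_mul _ (hpdiff _ z hz), hpd _ hz]
    norm_num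
  have D3 : Set.EqOn (deriv (deriv (deriv (mlLaplace α μ))))
      (fun z => deriv (deriv (deriv (mlLaplaceReg α μ))) z + (-6) * z ^ ((-(3 + 1) : ℝ) : ℂ))
      {z : ℂ | 0 < z.re} := by
    intro z hz
    rw [D2.deriv hD hz, deriv_fun_add (d2.differentiableAt (hD.mem_nhds hz))
      ((hpdiff _ z hz).const_mul _), deriv_const_mul _ (hpdiff _ z hz), hpd _ hz]
    norm_num
    ring
  have hmem : ∀ y : ℝ, (x + y * Complex.I : ℂ) ∈ {z : ℂ | 0 < z.re} := fun y => by simpa using hx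
  have i1 : Integrable fun y : ℝ => deriv (deriv (deriv (mlLaplaceReg α μ))) (x + y * Complex.I)
      * Complex.exp ((x + y * Complex.I) * t) := by
    refine (((integrable_norm_vertical hx (s := α + 4) (by linarith)).const_mul C3).mul_const
      (Real.exp (x * t))).mono' ((continuous_vertical (d2.deriv hD).continuousOn hx).mul
        (by fun_prop)).aestronglyMeasurable (ae_of_all _ fun y => ?_)
    rw [norm_mul, norm_exp_vertical]
    gcongr
    exact (hC3 () _ (hmem y)).trans_eq (by ring_nf)
  have i2 : Integrable fun y : ℝ => (x + y * Complex.I) ^ ((-(3 + 1) : ℝ) : ℂ)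
      * Complex.exp ((x + y * Complex.I) * t) := by
    refine ((integrable_norm_vertical hx (s := 3 + 1) (by norm_num)).mul_const
      (Real.exp (x * t))).mono' (by fun_prop : Measurable fun y : ℝ =>
        ((x : ℂ) + y * Complex.I) ^ ((-(3 + 1) : ℝ) : ℂ)
          * Complex.exp ((x + y * Complex.I) * t)).aestronglyMeasurable (ae_of_all _ fun y => ?_)
    rw [norm_mul, norm_exp_vertical, Complex.norm_cpow_real]
  have hsplit : ∫ y : ℝ, deriv (deriv (deriv (mlLaplace α μ))) (x + y * Complex.I)
        * Complex.exp ((x + y * Complex.I) * t)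
      = (∫ y : ℝ, deriv (deriv (deriv (mlLaplaceReg α μ))) (x + y * Complex.I)
          * Complex.exp ((x + y * Complex.I) * t))
        + (-6) * ∫ y : ℝ, (x + y * Complex.I) ^ ((-(3 + 1) : ℝ) : ℂ)
          * Complex.exp ((x + y * Complex.I) * t) := by
    rw [← integral_const_mul, ← integral_add i1 (i2.const_mul _)]
    refine integral_congr_ae (ae_of_all _ fun y => ?_)
    simp only [D3 (hmem y)]
    ring
  rw [hsplit, hpow, hΓ]
  rw [hinv] at p1
  have ht3 : (t ^ (3 : ℝ) : ℝ) = t ^ 3 := by norm_cast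
  rw [ht3]
  generalize (∑' k, mlTerm α μ t k) = S at p1 ⊢
  push_cast
  linear_combination (t : ℂ) ^ 2 * p1 - t * p2 + p3

/-! ### Taylor coefficients and the scalar scheme -/

/-- The Taylor coefficients of `f` at the origin, extended by zero to negative indices. -/
noncomputable def taylorCoeff (f : ℂ → ℂ) (k : ℤ) : ℂ :=
  if 0 ≤ k then iteratedDeriv k.toNat f 0 / (k.toNat.factorial : ℂ) else 0

theorem taylorCoeff_of_neg (f : ℂ → ℂ) {k : ℤ} (hk : k < 0) : taylorCoeff f k = 0 := by
  simp [taylorCoeff, not_le.2 hk]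

theorem taylorCoeff_natCast (f : ℂ → ℂ) (n : ℕ) :
    taylorCoeff f n = iteratedDeriv n f 0 / (n.factorial : ℂ) := by
  simp [taylorCoeff]

theorem taylorCoeff_congr {f g : ℂ → ℂ} (h : f =ᶠ[𝓝 0] g) (k : ℤ) :
    taylorCoeff f k = taylorCoeff g k := by
  simp only [taylorCoeff, h.iteratedDeriv_eq]

theorem taylorCoeff_add {f g : ℂ → ℂ} (hf : AnalyticAt ℂ f 0) (hg : AnalyticAt ℂ g 0) (k : ℤ) :
    taylorCoeff (fun ζ => f ζ + g ζ) k = taylorCoeff f k + taylorCoeff g k := by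
  unfold taylorCoeff
  split_ifs
  · rw [iteratedDeriv_fun_add hf.contDiffAt hg.contDiffAt, add_div]
  · simp

theorem taylorCoeff_const_mul {f : ℂ → ℂ} (c : ℂ) (k : ℤ) :
    taylorCoeff (fun ζ => c * f ζ) k = c * taylorCoeff f k := by
  unfold taylorCoeff
  split_ifs
  · rw [iteratedDeriv_const_mul_field, mul_div_assoc]
  · simp

theorem taylorCoeff_mul {f g : ℂ → ℂ} (hf : AnalyticAt ℂ f 0) (hg : AnalyticAt ℂ g 0) (n : ℕ) :
    taylorCoeff (fun ζ => f ζ * g ζ) n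
      = ∑ i ∈ Finset.range (n + 1), taylorCoeff f i * taylorCoeff g (n - i) := by
  rw [taylorCoeff_natCast, iteratedDeriv_fun_mul hf.contDiffAt hg.contDiffAt, Finset.sum_div]
  refine Finset.sum_congr rfl fun i hi => ?_
  have hin : i ≤ n := Nat.lt_succ_iff.1 (Finset.mem_range.1 hi)
  rw [← Nat.cast_sub hin, taylorCoeff_natCast, taylorCoeff_natCast, Nat.cast_choose ℂ hin]
  have h1 : (n.factorial : ℂ) ≠ 0 := by exact_mod_cast n.factorial_ne_zero
  have h2 : (i.factorial : ℂ) ≠ 0 := by exact_mod_cast i.factorial_ne_zero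
  have h3 : ((n - i).factorial : ℂ) ≠ 0 := by exact_mod_cast (n - i).factorial_ne_zero
  field_simp

theorem taylorCoeff_id_mul {f : ℂ → ℂ} (hf : AnalyticAt ℂ f 0) (k : ℤ) :
    taylorCoeff (fun ζ => ζ * f ζ) k = taylorCoeff f (k - 1) := by
  rcases lt_or_ge k 0 with hk | hk
  · rw [taylorCoeff_of_neg _ hk, taylorCoeff_of_neg _ (by omega)]
  · lift k to ℕ using hk
    have hid : ∀ i : ℕ, taylorCoeff (fun ζ => ζ) i = if i = 1 then 1 else 0 := by
      intro i
      rw [taylorCoeff_natCast, iteratedDeriv_fun_id_zero]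
      split_ifs with h <;> simp [h]
    rw [taylorCoeff_mul (f := fun ζ => ζ) analyticAt_id hf]
    simp only [hid, ite_mul, one_mul, zero_mul, Finset.sum_ite_eq', Finset.mem_range]
    split_ifs with h
    · simp
    · rw [taylorCoeff_of_neg _ (by omega)]

theorem taylorCoeff_deriv (f : ℂ → ℂ) (n : ℕ) :
    taylorCoeff (deriv f) n = (n + 1) * taylorCoeff f (n + 1 : ℕ) := by
  rw [taylorCoeff_natCast, taylorCoeff_natCast, iteratedDeriv_succ', Nat.factorial_succ]
  push_cast
  have : (n + 1 : ℂ) ≠ 0 := by exact_mod_cast n.succ_ne_zero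
  have h1 : (n.factorial : ℂ) ≠ 0 := by exact_mod_cast n.factorial_ne_zero
  field_simp

/-- Taylor coefficients as integrals over a vertical segment, by the substitution `ζ = e⁻ᶻ` in
Cauchy's formula. -/
theorem integral_exp_neg_eq_taylorCoeff {f : ℂ → ℂ} (hf : DifferentiableOn ℂ f (Metric.ball 0 1))
    {x : ℝ} (hx : 0 < x) (n : ℕ) :
    ∫ y in (-Real.pi)..Real.pi, f (Complex.exp (-(x + y * Complex.I)))
        * Complex.exp ((x + y * Complex.I) * n) = 2 * Real.pi * taylorCoeff f n := by
  set r : ℝ := Real.exp (-x) with hr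
  have hr0 : 0 < r := Real.exp_pos _
  have hr1 : r < 1 := Real.exp_lt_one_iff.2 (by simpa using hx)
  have hcl : Metric.closedBall (0 : ℂ) r ⊆ Metric.ball 0 1 := Metric.closedBall_subset_ball hr1
  have hc : DiffContOnCl ℂ f (Metric.ball 0 r) :=
    DifferentiableOn.diffContOnCl (hf.mono ((closure_mono Metric.ball_subset_closedBall).trans
      (by rwa [Metric.isClosed_closedBall.closure_eq])))
  have h := hc.circleIntegral_one_div_sub_center_pow_smul hr0 n
  set g : ℝ → ℂ := fun θ => f (Complex.exp (-(x - θ * Complex.I)))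
    * Complex.exp ((x - θ * Complex.I) * n) with hg
  have hmap : ∀ θ : ℝ, circleMap 0 r θ = Complex.exp (-(x - θ * Complex.I)) := by
    intro θ
    rw [circleMap_zero, hr, Complex.ofReal_exp, ← Complex.exp_add]
    congr 1
    push_cast
    ring
  have hint : (∮ z in C(0, r), (1 / (z - 0) ^ (n + 1)) • f z)
      = Complex.I * ∫ θ in (0 : ℝ)..(2 * Real.pi), g θ := by
    rw [circleIntegral, ← intervalIntegral.integral_const_mul]
    refine intervalIntegral.integral_congr fun θ _ => ?_
    simp only [deriv_circleMap, hmap, smul_eq_mul, sub_zero, hg]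
    have h1 : Complex.exp (-(x - θ * Complex.I)) ≠ 0 := Complex.exp_ne_zero _
    have h2 : Complex.exp ((x - θ * Complex.I) * n)
        = (Complex.exp (-(x - θ * Complex.I)) ^ n)⁻¹ := by
      rw [← Complex.exp_nat_mul, ← Complex.exp_neg]
      congr 1
      ring
    rw [h2]
    field_simp
    ring
  have hper : Function.Periodic g (2 * Real.pi) := by
    intro θ
    simp only [hg]
    have e1 : Complex.exp (-((x : ℂ) - (θ + 2 * Real.pi : ℝ) * Complex.I))
        = Complex.exp (-(x - θ * Complex.I)) := by
      rw [← Complex.exp_periodic (-((x : ℂ) - θ * Complex.I))]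
      congr 1
      push_cast
      ring
    have e2 : Complex.exp (((x : ℂ) - (θ + 2 * Real.pi : ℝ) * Complex.I) * n)
        = Complex.exp ((x - θ * Complex.I) * n) := by
      rw [← Complex.exp_periodic.nat_mul n ((x - (θ + 2 * Real.pi : ℝ) * Complex.I) * n)]
      congr 1
      push_cast
      ring
    rw [e1, e2]
  have hshift := hper.intervalIntegral_add_eq 0 (-Real.pi)
  rw [zero_add, show -Real.pi + 2 * Real.pi = Real.pi by ring] at hshift
  have hneg : ∫ y in (-Real.pi)..Real.pi, f (Complex.exp (-(x + y * Complex.I)))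
        * Complex.exp ((x + y * Complex.I) * n) = ∫ θ in (-Real.pi)..Real.pi, g θ := by
    have := intervalIntegral.integral_comp_neg (f := g) (a := -Real.pi) (b := Real.pi)
    rw [neg_neg] at this
    rw [← this]
    refine intervalIntegral.integral_congr fun θ _ => ?_
    simp only [hg, Complex.ofReal_neg, neg_mul, sub_neg_eq_add]
  rw [hneg, ← hshift, taylorCoeff_natCast]
  rw [hint, smul_eq_mul] at h
  refine mul_left_cancel₀ Complex.I_ne_zero ?_
  rw [h]
  ring

/-- Multiplying Taylor coefficients by `-n³` means differentiating three times in `z = -log ζ`. -/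
theorem integral_third_deriv_comp_exp_neg {f : ℂ → ℂ}
    (hf : DifferentiableOn ℂ f (Metric.ball 0 1)) {x : ℝ} (hx : 0 < x) (n : ℕ) :
    ∫ y in (-Real.pi)..Real.pi, deriv (deriv (deriv fun z => f (Complex.exp (-z))))
        (x + y * Complex.I) * Complex.exp ((x + y * Complex.I) * n)
      = -(2 * Real.pi * n ^ 3 * taylorCoeff f n) := by
  set E : (ℂ → ℂ) → ℂ → ℂ := fun f ζ => (-1) * (ζ * deriv f ζ) with hE
  have hEd : ∀ f : ℂ → ℂ, DifferentiableOn ℂ f (Metric.ball 0 1) →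
      DifferentiableOn ℂ (E f) (Metric.ball 0 1) := by
    intro f hf
    have := hf.deriv Metric.isOpen_ball
    exact (differentiableOn_id.mul this).const_mul _
  have han : ∀ f : ℂ → ℂ, DifferentiableOn ℂ f (Metric.ball 0 1) → AnalyticAt ℂ f 0 :=
    fun f hf => hf.analyticAt (Metric.ball_mem_nhds 0 one_pos)
  have hEc : ∀ f : ℂ → ℂ, DifferentiableOn ℂ f (Metric.ball 0 1) →
      taylorCoeff (E f) n = -n * taylorCoeff f n := by
    intro f hf
    rw [hE, taylorCoeff_const_mul, taylorCoeff_id_mul (han _ (hf.deriv Metric.isOpen_ball))]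
    rcases n with _ | n
    · rw [taylorCoeff_of_neg _ (by simp)]; simp
    · have := taylorCoeff_deriv f n
      push_cast at this ⊢
      rw [add_sub_cancel_right, this]
      ring
  have hball : ∀ z : ℂ, 0 < z.re → Complex.exp (-z) ∈ Metric.ball (0 : ℂ) 1 := fun z hz => by
    simpa using norm_exp_neg_lt_one hz
  have hEe : ∀ f : ℂ → ℂ, DifferentiableOn ℂ f (Metric.ball 0 1) →
      Set.EqOn (deriv fun z => f (Complex.exp (-z))) (fun z => E f (Complex.exp (-z)))
        {z : ℂ | 0 < z.re} := by
    intro f hf z hz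
    have h1 := (hf.differentiableAt (Metric.isOpen_ball.mem_nhds (hball z hz))).hasDerivAt
    have h2 : HasDerivAt (fun z : ℂ => Complex.exp (-z)) (-Complex.exp (-z)) z := by
      simpa using (hasDerivAt_id z).neg.cexp
    have h3 : HasDerivAt (fun z => f (Complex.exp (-z))) _ z := HasDerivAt.comp z h1 h2
    rw [h3.deriv]
    simp only [hE]
    ring
  have hD := isOpen_rightHalfPlane
  have e1 := hEe f hf
  have e2 := (e1.deriv hD).trans (hEe _ (hEd f hf))
  have e3 := (e2.deriv hD).trans (hEe _ (hEd _ (hEd f hf)))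
  have h := integral_exp_neg_eq_taylorCoeff (hEd _ (hEd _ (hEd f hf))) hx n
  rw [hEc _ (hEd _ (hEd f hf)), hEc _ (hEd f hf), hEc _ hf] at h
  rw [show -(2 * Real.pi * (n : ℂ) ^ 3 * taylorCoeff f n)
    = 2 * Real.pi * (-n * (-n * (-n * taylorCoeff f n))) by ring, ← h]
  refine intervalIntegral.integral_congr fun y _ => ?_
  rw [e3 (by simpa using hx)]

theorem taylorCoeff_avgSymbol_mul (α : ℝ) {f : ℂ → ℂ} (hf : AnalyticAt ℂ f 0) (k : ℤ) :
    taylorCoeff (fun ζ => avgSymbol α ζ * f ζ) k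
      = (1 - α / 2) * taylorCoeff f k + (α / 2) * taylorCoeff f (k - 1) := by
  have h1 : AnalyticAt ℂ (fun ζ => ζ * f ζ) 0 := analyticAt_id.mul hf
  have : (fun ζ => avgSymbol α ζ * f ζ)
      = fun ζ => (1 - (α : ℂ) / 2) * f ζ + (α / 2) * (ζ * f ζ) := by
    ext ζ; rw [avgSymbol]; ring
  rw [this, taylorCoeff_add (analyticAt_const.fun_mul hf) (analyticAt_const.fun_mul h1),
    taylorCoeff_const_mul, taylorCoeff_const_mul, taylorCoeff_id_mul hf]

theorem taylorCoeff_bdfSymbol_mul {f : ℂ → ℂ} (hf : AnalyticAt ℂ f 0) (k : ℤ) :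
    taylorCoeff (fun ζ => bdfSymbol ζ * f ζ) k = bdf2 1 (taylorCoeff f) k := by
  have h1 : AnalyticAt ℂ (fun ζ => ζ * f ζ) 0 := analyticAt_id.mul hf
  have h2 : AnalyticAt ℂ (fun ζ => ζ * (ζ * f ζ)) 0 := analyticAt_id.mul h1
  have : (fun ζ => bdfSymbol ζ * f ζ)
      = fun ζ => (3 / 2) * f ζ + ((-2) * (ζ * f ζ) + (1 / 2) * (ζ * (ζ * f ζ))) := by
    ext ζ; rw [bdfSymbol]; ring
  rw [this, taylorCoeff_add (analyticAt_const.fun_mul hf)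
    ((analyticAt_const.fun_mul h1).fun_add (analyticAt_const.fun_mul h2)),
    taylorCoeff_add (analyticAt_const.fun_mul h1) (analyticAt_const.fun_mul h2),
    taylorCoeff_const_mul, taylorCoeff_const_mul, taylorCoeff_const_mul, taylorCoeff_id_mul h1,
    taylorCoeff_id_mul hf, taylorCoeff_id_mul hf, sub_sub, one_add_one_eq_two, bdf2]
  simp only [inv_one, one_smul, Complex.real_smul]
  push_cast
  ring

theorem one_sub_mem_slitPlane {ζ : ℂ} (hζ : ζ ∈ Metric.ball (0 : ℂ) 1) :
    1 - ζ ∈ Complex.slitPlane := by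
  refine Or.inl ?_
  have h1 : ‖ζ‖ < 1 := by simpa using hζ
  have := Complex.re_le_norm ζ
  simp only [Complex.sub_re, Complex.one_re]
  linarith

theorem hasDerivAt_one_sub_cpow (a : ℂ) {ζ : ℂ} (hζ : ζ ∈ Metric.ball (0 : ℂ) 1) :
    HasDerivAt (fun ζ : ℂ => (1 - ζ) ^ a) (-(a * (1 - ζ) ^ (a - 1))) ζ := by
  have := ((hasDerivAt_id ζ).const_sub 1).cpow_const (c := a) (one_sub_mem_slitPlane hζ)
  simpa using this

theorem differentiableOn_one_sub_cpow (a : ℂ) :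
    DifferentiableOn ℂ (fun ζ : ℂ => (1 - ζ) ^ a) (Metric.ball 0 1) := fun _ hζ =>
  (hasDerivAt_one_sub_cpow a hζ).differentiableAt.differentiableWithinAt

/-- The Grünwald-Letnikov weights are the Taylor coefficients of `(1 - ζ) ^ α`, by the differential
equation `(1 - ζ) f' = -α f`. -/
theorem taylorCoeff_one_sub_cpow (α : ℝ) (n : ℕ) :
    taylorCoeff (fun ζ => (1 - ζ) ^ (α : ℂ)) n = glWeight α n := by
  set f : ℂ → ℂ := fun ζ => (1 - ζ) ^ (α : ℂ) with hf
  have hball : Metric.ball (0 : ℂ) 1 ∈ 𝓝 0 := Metric.ball_mem_nhds 0 one_pos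
  have hfa : AnalyticAt ℂ f 0 := (differentiableOn_one_sub_cpow α).analyticAt hball
  have hfd : AnalyticAt ℂ (deriv f) 0 := hfa.deriv
  have hid : AnalyticAt ℂ (fun ζ => ζ * deriv f ζ) 0 := analyticAt_id.mul hfd
  have hode : (fun ζ => deriv f ζ + (-1) * (ζ * deriv f ζ)) =ᶠ[𝓝 0] fun ζ => (-α) * f ζ := by
    filter_upwards [hball] with ζ hζ
    have h0 : 1 - ζ ≠ 0 := Complex.slitPlane_ne_zero (one_sub_mem_slitPlane hζ)
    rw [hf, (hasDerivAt_one_sub_cpow α hζ).deriv, Complex.cpow_sub _ _ h0, Complex.cpow_one]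
    field_simp
    ring
  induction n with
  | zero => simp [taylorCoeff, hf, glWeight]
  | succ n ih =>
    have h := taylorCoeff_congr hode n
    rw [taylorCoeff_const_mul, taylorCoeff_add hfd
      (analyticAt_const.fun_mul hid), taylorCoeff_const_mul,
      taylorCoeff_id_mul hfd, taylorCoeff_deriv, ih] at h
    have h2 : taylorCoeff (deriv f) ((n : ℤ) - 1) = n * glWeight α n := by
      rcases n with _ | m
      · rw [taylorCoeff_of_neg _ (by simp)]; simp
      · have := taylorCoeff_deriv f m
        rw [ih] at this
        push_cast at this ⊢
        rw [add_sub_cancel_right, this]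
    rw [h2] at h
    have h3 : (n + 1 : ℂ) ≠ 0 := by exact_mod_cast n.succ_ne_zero
    rw [glWeight]
    push_cast
    refine mul_left_cancel₀ h3 ?_
    push_cast at h
    field_simp
    linear_combination h

theorem hasFPowerSeriesOnBall_powerSeriesFun {α : ℝ} (hα0 : 0 < α) (hα1 : α < 1) :
    HasFPowerSeriesOnBall (powerSeriesFun α) (FormalMultilinearSeries.ofScalars ℂ
      fun n : ℕ => (((n : ℝ) ^ (2 - α) / Real.Gamma (3 - α) : ℝ) : ℂ)) 0 1 := by
  have hΓ := Real.Gamma_pos_of_pos (show 0 < 3 - α by linarith)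
  have hle : ∀ (n : ℕ), ‖(((n : ℝ) ^ (2 - α) / Real.Gamma (3 - α) : ℝ) : ℂ)‖
      ≤ (Real.Gamma (3 - α))⁻¹ * (n : ℝ) ^ 2 := by
    intro n
    rw [Complex.norm_real, Real.norm_of_nonneg (by positivity), div_eq_inv_mul]
    gcongr
    rcases n.eq_zero_or_pos with h | h
    · simp [h, Real.zero_rpow (show 2 - α ≠ 0 by linarith)]
    · rw [← Real.rpow_natCast (n : ℝ) 2]
      exact Real.rpow_le_rpow_of_exponent_le (by exact_mod_cast h) (by push_cast; linarith)
  have hsum : ∀ r : ℝ, 0 ≤ r → r < 1 → Summable fun n : ℕ =>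
      ‖(((n : ℝ) ^ (2 - α) / Real.Gamma (3 - α) : ℝ) : ℂ)‖ * r ^ n := by
    intro r hr0 hr1
    refine Summable.of_nonneg_of_le (fun n => by positivity)
      (fun n => mul_le_mul_of_nonneg_right (hle n) (by positivity)) ?_
    have := (summable_pow_mul_geometric_of_norm_lt_one 2
      (show ‖r‖ < 1 by rwa [Real.norm_of_nonneg hr0])).mul_left (Real.Gamma (3 - α))⁻¹
    simpa only [mul_assoc] using this
  refine ⟨?_, one_pos, ?_⟩
  · refine ENNReal.le_of_forall_nnreal_lt fun r hr => ?_
    refine FormalMultilinearSeries.le_radius_of_summable _ ?_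
    simpa only [FormalMultilinearSeries.ofScalars_norm] using
      hsum r r.2 (by exact_mod_cast hr)
  · intro ζ hζ
    have hζ1 : ‖ζ‖ < 1 := by
      rw [← ENNReal.coe_one, Metric.eball_coe] at hζ
      simpa using hζ
    simp only [FormalMultilinearSeries.ofScalars_apply_eq, zero_add, smul_eq_mul]
    refine Summable.hasSum (Summable.of_norm ?_)
    simpa only [norm_mul, norm_pow] using hsum ‖ζ‖ (norm_nonneg _) hζ1

theorem differentiableOn_powerSeriesFun {α : ℝ} (hα0 : 0 < α) (hα1 : α < 1) :
    DifferentiableOn ℂ (powerSeriesFun α) (Metric.ball 0 1) := by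
  have := (hasFPowerSeriesOnBall_powerSeriesFun hα0 hα1).differentiableOn
  rwa [← ENNReal.coe_one, Metric.eball_coe] at this

theorem taylorCoeff_powerSeriesFun {α : ℝ} (hα0 : 0 < α) (hα1 : α < 1) (k : ℤ) :
    taylorCoeff (powerSeriesFun α) k = powerGrid α 1 k := by
  rcases lt_or_ge k 0 with hk | hk
  · rw [taylorCoeff_of_neg _ hk, powerGrid, if_neg (by omega)]; simp
  · lift k to ℕ using hk
    have h := hasFPowerSeriesOnBall_powerSeriesFun hα0 hα1
    have h1 := h.analyticAt.hasFPowerSeriesAt.eq_formalMultilinearSeries h.hasFPowerSeriesAt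
    have h2 := congrFun (FormalMultilinearSeries.ofScalars_series_injective ℂ ℂ h1) k
    rw [taylorCoeff_natCast]
    rw [h2, powerGrid]
    rcases k.eq_zero_or_pos with h0 | h0
    · simp [h0, Real.zero_rpow (show 2 - α ≠ 0 by linarith)]
    · simp [h0]

/-- The generating function of the unknowns `U n` of the scheme with unit step size for the scalar
equation with eigenvalue `μ` and initial value `1`. -/
noncomputable def unknownFun (α μ : ℝ) (ζ : ℂ) : ℂ :=
  bdfSymbol ζ * powerSeriesFun α ζ * avgSymbol α ζ / ((1 - ζ) ^ (α : ℂ) + μ * avgSymbol α ζ)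

theorem differentiableOn_unknownFun {α : ℝ} (hα0 : 0 < α) (hα1 : α < 1) {μ : ℝ} (hμ : 0 < μ) :
    DifferentiableOn ℂ (unknownFun α μ) (Metric.ball 0 1) := by
  have h1 : Differentiable ℂ bdfSymbol := by unfold bdfSymbol; fun_prop
  have h2 : Differentiable ℂ (avgSymbol α) := by unfold avgSymbol; fun_prop
  refine DifferentiableOn.div ((h1.differentiableOn.mul
    (differentiableOn_powerSeriesFun hα0 hα1)).mul h2.differentiableOn)
    ((differentiableOn_one_sub_cpow α).add (h2.differentiableOn.const_mul _)) fun ζ hζ => ?_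
  exact denominator_ne_zero hα0 hα1 hμ (by simpa using hζ)

theorem schemeFun_eq (α μ : ℝ) : schemeFun α μ = fun ζ => bdfSymbol ζ * unknownFun α μ ζ := by
  ext ζ
  rw [schemeFun, unknownFun]
  ring

theorem differentiableOn_schemeFun {α : ℝ} (hα0 : 0 < α) (hα1 : α < 1) {μ : ℝ} (hμ : 0 < μ) :
    DifferentiableOn ℂ (schemeFun α μ) (Metric.ball 0 1) := by
  have h1 : Differentiable ℂ bdfSymbol := by unfold bdfSymbol; fun_prop
  rw [schemeFun_eq]
  exact h1.differentiableOn.mul (differentiableOn_unknownFun hα0 hα1 hμ)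

/-- The Taylor coefficients of `unknownFun` solve the scalar scheme. -/
theorem taylorCoeff_unknownFun {α : ℝ} (hα0 : 0 < α) (hα1 : α < 1) {μ : ℝ} (hμ : 0 < μ) (n : ℕ) :
    ∑ j ∈ Finset.range (n + 1), (glWeight α j : ℂ) * taylorCoeff (unknownFun α μ) (n - j)
      + μ * ((1 - α / 2) * taylorCoeff (unknownFun α μ) n
        + (α / 2) * taylorCoeff (unknownFun α μ) (n - 1))
    = (1 - α / 2) * (bdf2 1 (powerGrid α 1) n : ℝ)
      + (α / 2) * (bdf2 1 (powerGrid α 1) (n - 1) : ℝ) := by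
  have hball : Metric.ball (0 : ℂ) 1 ∈ 𝓝 0 := Metric.ball_mem_nhds 0 one_pos
  have hV := (differentiableOn_unknownFun hα0 hα1 hμ).analyticAt hball
  have hG := (differentiableOn_powerSeriesFun hα0 hα1).analyticAt hball
  have hp := (differentiableOn_one_sub_cpow (α : ℂ)).analyticAt hball
  have hd : AnalyticAt ℂ (avgSymbol α) 0 :=
    (by unfold avgSymbol; fun_prop : Differentiable ℂ (avgSymbol α)).analyticAt 0
  have hb : AnalyticAt ℂ bdfSymbol 0 :=
    (by unfold bdfSymbol; fun_prop : Differentiable ℂ bdfSymbol).analyticAt 0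
  have hG' : AnalyticAt ℂ (fun ζ => bdfSymbol ζ * powerSeriesFun α ζ) 0 := hb.mul hG
  have hdV : AnalyticAt ℂ (fun ζ => avgSymbol α ζ * unknownFun α μ ζ) 0 := hd.mul hV
  have heq : (fun ζ => (1 - ζ) ^ (α : ℂ) * unknownFun α μ ζ
      + μ * (avgSymbol α ζ * unknownFun α μ ζ))
      =ᶠ[𝓝 0] fun ζ => avgSymbol α ζ * (bdfSymbol ζ * powerSeriesFun α ζ) := by
    filter_upwards [hball] with ζ hζ
    have hne := denominator_ne_zero hα0 hα1 hμ (ζ := ζ) (by simpa using hζ)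
    rw [unknownFun, ← mul_assoc, ← add_mul, mul_div_cancel₀ _ hne]
    ring
  have hgrid : taylorCoeff (powerSeriesFun α) = fun k => ((powerGrid α 1 k : ℝ) : ℂ) :=
    funext (taylorCoeff_powerSeriesFun hα0 hα1)
  have hbdf : ∀ k : ℤ, taylorCoeff (fun ζ => bdfSymbol ζ * powerSeriesFun α ζ) k
      = (bdf2 1 (powerGrid α 1) k : ℝ) := by
    intro k
    rw [taylorCoeff_bdfSymbol_mul hG, hgrid]
    simp [bdf2]
  have h := taylorCoeff_congr heq n
  rw [taylorCoeff_add (hp.fun_mul hV) (analyticAt_const.fun_mul hdV), taylorCoeff_const_mul,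
    taylorCoeff_avgSymbol_mul α hV, taylorCoeff_avgSymbol_mul α hG', taylorCoeff_mul hp hV,
    hbdf, hbdf] at h
  simpa only [taylorCoeff_one_sub_cpow] using h

/-- The scalar scheme with unit step size determines its unknowns. -/
theorem eq_taylorCoeff_unknownFun {α : ℝ} (hα0 : 0 < α) (hα1 : α < 1) {μ : ℝ} (hμ : 0 < μ)
    {v0 : ℝ} {U : ℤ → ℝ} {N : ℕ} (hU0 : ∀ k : ℤ, k ≤ 0 → U k = 0)
    (hU : ∀ n : ℕ, 1 ≤ n → n ≤ N → ∑ j ∈ Finset.range (n + 1), glWeight α j * U (n - j)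
      + μ * ((1 - α / 2) * U n + (α / 2) * U (n - 1))
      = ((1 - α / 2) * bdf2 1 (powerGrid α 1) n + (α / 2) * bdf2 1 (powerGrid α 1) (n - 1)) * v0)
    (k : ℤ) (hk : k ≤ N) : (U k : ℂ) = v0 * taylorCoeff (unknownFun α μ) k := by
  have hpos : 0 < 1 + μ * (1 - α / 2) := by
    have : 0 < 1 - α / 2 := by linarith
    positivity
  have hpos' : ((1 + μ * (1 - α / 2) : ℝ) : ℂ) ≠ 0 := Complex.ofReal_ne_zero.2 hpos.ne'
  rcases lt_or_ge k 0 with hk0 | hk0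
  · rw [hU0 k hk0.le, taylorCoeff_of_neg _ hk0]; simp
  lift k to ℕ using hk0
  induction k using Nat.strong_induction_on with
  | _ n ih =>
    have ih' : ∀ m : ℤ, m < n → (U m : ℂ) = v0 * taylorCoeff (unknownFun α μ) m := by
      intro m hm
      rcases lt_or_ge m 0 with h | h
      · rw [hU0 m h.le, taylorCoeff_of_neg _ h]; simp
      · lift m to ℕ using h
        exact ih m (by exact_mod_cast hm) (by omega)
    have hV := taylorCoeff_unknownFun hα0 hα1 hμ n
    rw [Finset.sum_range_succ'] at hV
    refine mul_left_cancel₀ hpos' ?_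
    rcases n.eq_zero_or_pos with h0 | h0
    · -- the source vanishes at the index `0`, and with it the coefficient
      subst h0
      have hneg : taylorCoeff (unknownFun α μ) (-1) = 0 := taylorCoeff_of_neg _ (by norm_num)
      simp [bdf2, powerGrid, glWeight, hneg] at hV
      rw [hU0 _ (by simp)]
      push_cast
      linear_combination (-v0 : ℂ) * hV
    · have h1 := congrArg (fun r : ℝ => (r : ℂ)) (hU n h0 (by exact_mod_cast hk))
      push_cast at h1
      rw [Finset.sum_range_succ', ih' ((n : ℤ) - 1) (by omega)] at h1
      have hsum : ∑ j ∈ Finset.range n, (glWeight α (j + 1) : ℂ) * (U (n - (j + 1 : ℕ)) : ℂ)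
          = v0 * ∑ j ∈ Finset.range n, (glWeight α (j + 1) : ℂ)
            * taylorCoeff (unknownFun α μ) (n - (j + 1 : ℕ)) := by
        rw [Finset.mul_sum]
        refine Finset.sum_congr rfl fun j _ => ?_
        rw [ih' _ (by push_cast; omega)]
        ring
      have hg0 : glWeight α 0 = 1 := rfl
      simp only [hg0, Nat.cast_zero, sub_zero, Complex.ofReal_one, one_mul] at h1 hV
      rw [hsum] at h1
      push_cast
      linear_combination h1 - v0 * hV

/-! ### The scalar error estimate -/

theorem third_deriv_sub {D : Set ℂ} (hD : IsOpen D) {f g : ℂ → ℂ} (hf : DifferentiableOn ℂ f D)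
    (hg : DifferentiableOn ℂ g D) :
    Set.EqOn (deriv (deriv (deriv fun z => f z - g z)))
      (fun z => deriv (deriv (deriv f)) z - deriv (deriv (deriv g)) z) D := by
  have key : ∀ {f g : ℂ → ℂ}, DifferentiableOn ℂ f D → DifferentiableOn ℂ g D →
      Set.EqOn (deriv fun z => f z - g z) (fun z => deriv f z - deriv g z) D :=
    fun hf hg z hz => deriv_fun_sub (hf.differentiableAt (hD.mem_nhds hz))
      (hg.differentiableAt (hD.mem_nhds hz))
  have e1 := key hf hg
  have e2 := (e1.deriv hD).trans (key (hf.deriv hD) (hg.deriv hD))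
  exact (e2.deriv hD).trans (key ((hf.deriv hD).deriv hD) ((hg.deriv hD).deriv hD))

theorem integral_norm_vertical_neg_two {x : ℝ} (hx : 0 < x) :
    ∫ y : ℝ, ‖(x + y * Complex.I : ℂ)‖ ^ (-2 : ℝ) = Real.pi / x := by
  have h : ∀ y : ℝ, ‖(x + y * Complex.I : ℂ)‖ ^ (-2 : ℝ) = (x ^ 2)⁻¹ * (1 + (y / x) ^ 2)⁻¹ := by
    intro y
    have h1 : ‖(x + y * Complex.I : ℂ)‖ ^ 2 = x ^ 2 + y ^ 2 := by
      rw [Complex.sq_norm, Complex.normSq_add_mul_I]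
    rw [Real.rpow_neg (norm_nonneg _), show (2 : ℝ) = (2 : ℕ) by norm_num, Real.rpow_natCast, h1,
      ← mul_inv]
    congr 1
    field_simp
  simp only [h]
  rw [integral_const_mul, Measure.integral_comp_div (fun s : ℝ => (1 + s ^ 2)⁻¹),
    integral_univ_inv_one_add_sq, abs_of_pos hx, smul_eq_mul]
  field_simp

/-- The error of the scheme with unit step size for the scalar equation, uniformly in the
eigenvalue. On the line `Re z = 1/n` the third derivative of the difference of the transforms is
`O(|z|⁻²)`, and its integral is of size `n`, which leaves `n⁻²` for the coefficient. -/
theorem exists_scalar_error {α : ℝ} (hα0 : 0 < α) (hα1 : α < 1) :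
    ∃ c : ℝ, 0 < c ∧ ∀ μ : ℝ, 0 < μ → ∀ n : ℕ, 1 ≤ n →
      ‖((∑' k, mlTerm α μ n k : ℝ) : ℂ) - taylorCoeff (schemeFun α μ) n‖ ≤ c * ((n : ℝ) ^ 2)⁻¹ := by
  have hD := isOpen_rightHalfPlane
  obtain ⟨C1, hC1⟩ := (isSymbol_error hα0 hα1 isOpen_wideStrip closedHalfStrip_subset_wideStrip
    (differentiableOn_shiftedPowers hα1) (fun z hz => powerSeriesFun_exp_neg hα1 hz) 3).bound_third
  have hsym := isSymbol_mlLaplace hα0 hα1 hD (fun _ h => h) 3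
  obtain ⟨C2, hC2⟩ := hsym.bound_third
  set C := |C1| + |C2| + 1 with hC
  have hCpos : 0 < C := by positivity
  refine ⟨C * Real.exp 1, by positivity, fun μ hμ n hn => ?_⟩
  have hn0 : (0 : ℝ) < n := by exact_mod_cast hn
  set x : ℝ := (n : ℝ)⁻¹ with hx
  have hx0 : 0 < x := by positivity
  have hx1 : x ≤ 1 := inv_le_one_of_one_le₀ (by exact_mod_cast hn)
  have hxn : x * n = 1 := inv_mul_cancel₀ hn0.ne'
  set f : ℂ → ℂ := mlLaplace α μ with hf
  set g : ℂ → ℂ := fun z => schemeFun α μ (Complex.exp (-z)) with hg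
  have hfd : DifferentiableOn ℂ f {z : ℂ | 0 < z.re} := hsym.2.1 ⟨μ, hμ⟩
  have hgd : DifferentiableOn ℂ g {z : ℂ | 0 < z.re} :=
    (differentiableOn_schemeFun hα0 hα1 hμ).comp (by fun_prop) fun z hz => by
      simpa using norm_exp_neg_lt_one hz
  have hf3 := (((hfd.deriv hD).deriv hD).deriv hD).continuousOn
  have hg3 := (((hgd.deriv hD).deriv hD).deriv hD).continuousOn
  set e : ℝ → ℂ := fun y => Complex.exp ((x + y * Complex.I) * n) with he
  have hec : Continuous e := by simp only [he]; fun_prop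
  have henorm : ∀ y, ‖e y‖ = Real.exp 1 := by
    intro y
    have := norm_exp_vertical x y n
    rw [hxn] at this
    simpa [he] using this
  set F : ℝ → ℂ := fun y => deriv (deriv (deriv f)) (x + y * Complex.I) * e y with hF
  set G : ℝ → ℂ := fun y => deriv (deriv (deriv g)) (x + y * Complex.I) * e y with hG
  have hFc : Continuous F := (continuous_vertical hf3 hx0).mul hec
  have hGc : Continuous G := (continuous_vertical hg3 hx0).mul hec
  have hexact : ∫ y, F y = -(2 * Real.pi * n ^ 3 * (∑' k, mlTerm α μ n k : ℝ)) := by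
    have := integral_third_deriv_mlLaplace hα0 hα1 hμ hx0 hn0
    simpa [hF, he] using this
  have hscheme : ∫ y in Set.Ioc (-Real.pi) Real.pi, G y
      = -(2 * Real.pi * n ^ 3 * taylorCoeff (schemeFun α μ) n) := by
    rw [← integral_third_deriv_comp_exp_neg (differentiableOn_schemeFun hα0 hα1 hμ) hx0 n,
      intervalIntegral.integral_of_le (by linarith [Real.pi_pos])]
  have hmem : ∀ y : ℝ, (x + y * Complex.I : ℂ) ∈ {z : ℂ | 0 < z.re} := fun y => by simpa using hx0
  have hFi : Integrable F := by
    refine (((integrable_norm_vertical hx0 (s := 4) (by norm_num)).const_mul C2).mul_const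
      (Real.exp 1)).mono' hFc.aestronglyMeasurable (ae_of_all _ fun y => ?_)
    rw [norm_mul, henorm]
    gcongr
    refine (hC2 ⟨μ, hμ⟩ _ (hmem y)).trans_eq ?_
    norm_num
  have hGi : Integrable ((Set.Ioc (-Real.pi) Real.pi).indicator G) :=
    (integrable_indicator_iff measurableSet_Ioc).2
      ((hGc.integrableOn_Icc).mono_set Set.Ioc_subset_Icc_self)
  have hbound : ∀ y, ‖F y - (Set.Ioc (-Real.pi) Real.pi).indicator G y‖
      ≤ C * Real.exp 1 * ‖(x + y * Complex.I : ℂ)‖ ^ (-2 : ℝ) := by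
    intro y
    have hy : |y| ≤ ‖(x + y * Complex.I : ℂ)‖ := by
      simpa using Complex.abs_im_le_norm (x + y * Complex.I : ℂ)
    by_cases hyS : y ∈ Set.Ioc (-Real.pi) Real.pi
    · have hpi := Real.pi_lt_four
      have hstrip : (x + y * Complex.I : ℂ) ∈ halfStrip := by
        refine ⟨?_, ?_⟩
        · change (x + y * Complex.I : ℂ).re ∈ Set.Ioo 0 2
          simp only [Complex.add_re, Complex.ofReal_re, Complex.re_ofReal_mul, Complex.I_re,
            mul_zero, add_zero]
          exact ⟨hx0, by linarith⟩
        · change (x + y * Complex.I : ℂ).im ∈ Set.Ioo (-4) 4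
          simp only [Complex.add_im, Complex.ofReal_im, Complex.im_ofReal_mul, Complex.I_im,
            mul_one, zero_add]
          exact ⟨by linarith [hyS.1], by linarith [hyS.2]⟩
      have h1 := hC1 ⟨μ, hμ⟩ _ hstrip
      have h2 := third_deriv_sub hD hfd hgd (hmem y)
      simp only at h2
      rw [Set.indicator_of_mem hyS]
      simp only [hF, hG]
      rw [← sub_mul, norm_mul, henorm, ← h2, mul_right_comm]
      gcongr
      refine h1.trans ?_
      rw [show (1 : ℝ) - 3 = -2 by norm_num]
      gcongr
      rw [hC]
      linarith [le_abs_self C1, abs_nonneg C2]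
    · -- here `1 ≤ |z|`, and `|z|⁻⁴` is at most `|z|⁻²`
      rw [Set.indicator_of_notMem hyS, sub_zero]
      simp only [hF]
      rw [norm_mul, henorm, mul_right_comm]
      gcongr
      have hy1 : 1 ≤ ‖(x + y * Complex.I : ℂ)‖ := by
        refine le_trans ?_ hy
        have hpi := Real.pi_gt_three
        rw [Set.mem_Ioc, not_and_or, not_lt, not_le] at hyS
        rcases hyS with h | h
        · rw [abs_of_neg (by linarith)]; linarith
        · rw [abs_of_pos (by linarith)]; linarith
      refine (hC2 ⟨μ, hμ⟩ _ (hmem y)).trans ?_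
      refine mul_le_mul ?_ (Real.rpow_le_rpow_of_exponent_le hy1 (by norm_num)) (by positivity)
        hCpos.le
      rw [hC]
      linarith [le_abs_self C2, abs_nonneg C1]
  have hdiff : (2 * Real.pi * n ^ 3 : ℂ) * (((∑' k, mlTerm α μ n k : ℝ) : ℂ)
      - taylorCoeff (schemeFun α μ) n)
      = -∫ y, (F y - (Set.Ioc (-Real.pi) Real.pi).indicator G y) := by
    rw [integral_sub hFi hGi, integral_indicator measurableSet_Ioc, hexact, hscheme]
    ring
  have hnorm : 2 * Real.pi * n ^ 3 * ‖((∑' k, mlTerm α μ n k : ℝ) : ℂ)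
      - taylorCoeff (schemeFun α μ) n‖ ≤ C * Real.exp 1 * (Real.pi * n) := by
    have h1 : ‖(2 * Real.pi * n ^ 3 : ℂ)‖ = 2 * Real.pi * n ^ 3 := by
      simp [abs_of_pos Real.pi_pos]
    rw [← h1, ← norm_mul, hdiff, norm_neg]
    refine (norm_integral_le_of_norm_le ((integrable_norm_vertical hx0 (s := 2)
      (by norm_num)).const_mul _) (ae_of_all _ hbound)).trans_eq ?_
    rw [integral_const_mul, integral_norm_vertical_neg_two hx0, hx, div_inv_eq_mul]
  have hpi := Real.pi_pos
  rw [← div_eq_mul_inv, le_div_iff₀ (by positivity)]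
  refine le_of_mul_le_mul_left ?_ (show 0 < Real.pi * n by positivity)
  have h0 : 0 ≤ Real.pi * n ^ 3 * ‖((∑' k, mlTerm α μ n k : ℝ) : ℂ)
      - taylorCoeff (schemeFun α μ) n‖ := by positivity
  nlinarith [hnorm, h0]

/-! ### Fractional integrals and the semidiscrete solution -/

theorem integral_beta {a b : ℝ} (ha : 0 < a) (hb : 0 < b) {s t : ℝ} (hst : s < t) :
    ∫ r in s..t, (t - r) ^ (a - 1) * (r - s) ^ (b - 1)
      = Real.Gamma a * Real.Gamma b / Real.Gamma (a + b) * (t - s) ^ (a + b - 1) := by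
  have hts : 0 < t - s := sub_pos.2 hst
  have h := Complex.betaIntegral_scaled (b : ℂ) (a : ℂ) hts
  rw [Complex.betaIntegral_eq_Gamma_mul_div _ _ (by simpa using hb) (by simpa using ha)] at h
  have h1 : ∫ r in s..t, (t - r) ^ (a - 1) * (r - s) ^ (b - 1)
      = ∫ x in (0 : ℝ)..(t - s), x ^ (b - 1) * (t - s - x) ^ (a - 1) := by
    have := intervalIntegral.integral_comp_sub_right (a := s) (b := t)
      (fun x => x ^ (b - 1) * (t - s - x) ^ (a - 1)) s
    rw [sub_self] at this
    rw [← this]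
    refine intervalIntegral.integral_congr fun r _ => ?_
    rw [mul_comm, show t - s - (r - s) = t - r by ring]
  rw [h1]
  apply Complex.ofReal_injective
  rw [← intervalIntegral.integral_ofReal]
  have h2 : ∫ x in (0 : ℝ)..(t - s), ((x ^ (b - 1) * (t - s - x) ^ (a - 1) : ℝ) : ℂ)
      = ∫ x in (0 : ℝ)..(t - s), (x : ℂ) ^ ((b : ℂ) - 1) * (((t - s : ℝ) : ℂ) - x) ^ ((a : ℂ) - 1) := by
    refine intervalIntegral.integral_congr fun x hx => ?_
    rw [Set.uIcc_of_le hts.le] at hx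
    rw [Complex.ofReal_mul, Complex.ofReal_cpow hx.1, Complex.ofReal_cpow (by linarith [hx.2])]
    push_cast
    rfl
  rw [h2, h]
  push_cast
  rw [Complex.Gamma_ofReal, Complex.Gamma_ofReal, ← Complex.ofReal_add, Complex.Gamma_ofReal,
    Complex.ofReal_cpow hts.le, add_comm b a]
  push_cast
  ring

theorem intervalIntegrable_beta {a b : ℝ} (ha : 0 < a) (hb : 0 < b) {s t : ℝ} (hst : s < t) :
    IntervalIntegrable (fun r => (t - r) ^ (a - 1) * (r - s) ^ (b - 1)) volume s t := by
  refine intervalIntegral.intervalIntegrable_of_integral_ne_zero ?_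
  rw [integral_beta ha hb hst]
  have h1 := Real.Gamma_pos_of_pos ha
  have h2 := Real.Gamma_pos_of_pos hb
  have h3 := Real.Gamma_pos_of_pos (add_pos ha hb)
  have h4 : 0 < (t - s) ^ (a + b - 1) := Real.rpow_pos_of_pos (sub_pos.2 hst) _
  positivity

/-- The composition of the fractional integrals of orders `α` and `1 - α` is integration. -/
theorem fractional_integral_comp {F : Type*} [NormedAddCommGroup F] [NormedSpace ℝ F]
    [CompleteSpace F] {α : ℝ} (hα0 : 0 < α) (hα1 : α < 1) {t : ℝ} (ht : 0 < t)
    {g : ℝ → F} (hg : IntervalIntegrable g volume 0 t) :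
    IntervalIntegrable (fun r => (t - r) ^ (α - 1) • ∫ s in (0 : ℝ)..r, (r - s) ^ (-α) • g s)
        volume 0 t ∧
      ∫ r in (0 : ℝ)..t, (t - r) ^ (α - 1) • ∫ s in (0 : ℝ)..r, (r - s) ^ (-α) • g s
        = (Real.Gamma α * Real.Gamma (1 - α)) • ∫ s in (0 : ℝ)..t, g s := by
  set ν : Measure ℝ := volume.restrict (Set.Ioc 0 t) with hν
  have hgi : Integrable g ν := (intervalIntegrable_iff_integrableOn_Ioc_of_le ht.le).1 hg
  set k : ℝ → ℝ → ℝ := fun r s => if s ≤ r then (t - r) ^ (α - 1) * (r - s) ^ (-α) else 0 with hk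
  set B : ℝ := Real.Gamma α * Real.Gamma (1 - α) with hB
  have hkm : Measurable fun p : ℝ × ℝ => k p.1 p.2 := by
    refine Measurable.ite (measurableSet_le measurable_snd measurable_fst) ?_ measurable_const
    fun_prop
  have hksec : ∀ s, (fun r => k r s) =
      (Set.Ici s).indicator fun r => (t - r) ^ (α - 1) * (r - s) ^ (-α) := by
    intro s
    ext r
    by_cases h : s ≤ r
    · simp [hk, h]
    · simp [hk, h]
  -- the Beta integral over the columns of the triangle `s ≤ r ≤ t`
  have hcol : ∀ s ∈ Set.Ioo 0 t, Integrable (fun r => k r s) ν ∧ ∫ r, k r s ∂ν = B := by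
    intro s hs
    have e1 := intervalIntegrable_beta hα0 (show 0 < 1 - α by linarith) hs.2
    have e2 := integral_beta hα0 (show 0 < 1 - α by linarith) hs.2
    rw [show (1 : ℝ) - α - 1 = -α by ring] at e1 e2
    rw [show α + (1 - α) = 1 by ring, Real.Gamma_one, div_one, sub_self, Real.rpow_zero,
      mul_one] at e2
    have hset : Set.Ioc 0 t ∩ Set.Ici s = Set.Icc s t := by
      ext r
      simp only [Set.mem_inter_iff, Set.mem_Ioc, Set.mem_Ici, Set.mem_Icc]
      constructor
      · rintro ⟨⟨-, h2⟩, h3⟩; exact ⟨h3, h2⟩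
      · rintro ⟨h1, h2⟩; exact ⟨⟨hs.1.trans_le h1, h2⟩, h1⟩
    rw [hksec]
    constructor
    · rw [integrable_indicator_iff measurableSet_Ici, hν, IntegrableOn,
        Measure.restrict_restrict measurableSet_Ici, Set.inter_comm, hset]
      exact (intervalIntegrable_iff_integrableOn_Icc_of_le hs.2.le).1 e1
    · rw [hν, setIntegral_indicator measurableSet_Ici, hset, integral_Icc_eq_integral_Ioc,
        ← intervalIntegral.integral_of_le hs.2.le, e2]
  have hk0 : ∀ r ∈ Set.Ioc 0 t, ∀ s, 0 ≤ k r s := by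
    intro r hr s
    simp only [hk]
    split_ifs with h
    · exact mul_nonneg (Real.rpow_nonneg (by linarith [hr.2]) _)
        (Real.rpow_nonneg (by linarith) _)
    · exact le_rfl
  have hae : ∀ᵐ s ∂ν, s ∈ Set.Ioo 0 t := by
    rw [hν, ← Measure.restrict_congr_set Ioo_ae_eq_Ioc]
    exact ae_restrict_mem measurableSet_Ioo
  have hae' : ∀ᵐ r ∂ν, r ∈ Set.Ioc 0 t := ae_restrict_mem measurableSet_Ioc
  have hnorm : ∀ s ∈ Set.Ioo 0 t, ∫ r, ‖k r s • g s‖ ∂ν = B * ‖g s‖ := by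
    intro s hs
    rw [← (hcol s hs).2, ← integral_mul_const]
    refine integral_congr_ae ?_
    filter_upwards [hae'] with r hr
    rw [norm_smul, Real.norm_of_nonneg (hk0 r hr s)]
  have hH : Integrable (fun p : ℝ × ℝ => k p.1 p.2 • g p.2) (ν.prod ν) := by
    refine (integrable_prod_iff' ?_).2 ⟨?_, ?_⟩
    · exact hkm.aestronglyMeasurable.smul hgi.aestronglyMeasurable.comp_snd
    · filter_upwards [hae] with s hs using (hcol s hs).1.smul_const _
    · refine (hgi.norm.const_mul B).congr ?_
      filter_upwards [hae] with s hs using (hnorm s hs).symm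
  have hrow : ∀ r ∈ Set.Ioc 0 t, ∫ s, k r s • g s ∂ν
      = (t - r) ^ (α - 1) • ∫ s in (0 : ℝ)..r, (r - s) ^ (-α) • g s := by
    intro r hr
    have : (fun s => k r s • g s) = (Set.Iic r).indicator
        fun s => (t - r) ^ (α - 1) • (r - s) ^ (-α) • g s := by
      ext s
      by_cases h : s ≤ r
      · simp [hk, h, mul_smul]
      · simp [hk, h]
    rw [this, hν, setIntegral_indicator measurableSet_Iic, Set.Ioc_inter_Iic,
      min_eq_right hr.2, integral_smul, intervalIntegral.integral_of_le hr.1.le]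
  constructor
  · rw [intervalIntegrable_iff_integrableOn_Ioc_of_le ht.le]
    refine hH.integral_prod_left.congr ?_
    filter_upwards [hae'] with r hr using hrow r hr
  · rw [intervalIntegral.integral_of_le ht.le, intervalIntegral.integral_of_le ht.le,
      ← integral_smul]
    calc _ = ∫ r, ∫ s, k r s • g s ∂ν ∂ν :=
          (integral_congr_ae (by filter_upwards [hae'] with r hr using hrow r hr)).symm
      _ = ∫ s, ∫ r, k r s • g s ∂ν ∂ν := integral_integral_swap hH
      _ = _ := by
        refine integral_congr_ae ?_
        filter_upwards [hae] with s hs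
        rw [integral_smul_const, (hcol s hs).2]

theorem mlTerm_succ {α : ℝ} (hα0 : 0 < α) (μ : ℝ) {t : ℝ} (ht : 0 < t) (k : ℕ) :
    IntervalIntegrable (fun r => (t - r) ^ (α - 1) * mlTerm α μ r k) volume 0 t ∧
      mlTerm α μ t (k + 1)
        = -(μ / Real.Gamma α) * ∫ r in (0 : ℝ)..t, (t - r) ^ (α - 1) * mlTerm α μ r k := by
  have hb : 0 < α * k + 1 := by positivity
  have e1 := intervalIntegrable_beta hα0 hb ht
  have e2 := integral_beta hα0 hb ht
  simp only [sub_zero, add_sub_cancel_right] at e1 e2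
  have h : ∀ r, (t - r) ^ (α - 1) * mlTerm α μ r k
      = ((-μ) ^ k / Real.Gamma (α * k + 1)) * ((t - r) ^ (α - 1) * r ^ (α * k)) := by
    intro r; rw [mlTerm]; ring
  simp only [h]
  refine ⟨e1.const_mul _, ?_⟩
  have g1 := (Real.Gamma_pos_of_pos hα0).ne'
  have g2 := (Real.Gamma_pos_of_pos hb).ne'
  rw [intervalIntegral.integral_const_mul, e2, mlTerm]
  have e3 : α * ((k + 1 : ℕ) : ℝ) + 1 = α + (α * k + 1) := by push_cast; ring
  have e4 : α * ((k + 1 : ℕ) : ℝ) = α + (α * k + 1) - 1 := by push_cast; ring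
  rw [e3, e4]
  field_simp
  ring

/-- The continuous solution of the Volterra equation `u = u₀ - μ I^α u` is the Mittag-Leffler
function: iterating the equation `m` times leaves a remainder bounded by the `m`-th term. -/
theorem eq_mul_tsum_mlTerm {α : ℝ} (hα0 : 0 < α) (hα1 : α < 1) {μ : ℝ} (hμ : 0 < μ) {T u₀ : ℝ}
    {u : ℝ → ℝ} (hu : ContinuousOn u (Set.Icc 0 T))
    (hV : ∀ t ∈ Set.Ioc 0 T,
      u t = u₀ - μ / Real.Gamma α * ∫ r in (0 : ℝ)..t, (t - r) ^ (α - 1) * u r)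
    {t : ℝ} (ht : t ∈ Set.Ioc 0 T) : u t = u₀ * ∑' k, mlTerm α μ t k := by
  obtain ⟨M, hM⟩ := isCompact_Icc.exists_bound_of_continuousOn hu
  have hΓ := Real.Gamma_pos_of_pos hα0
  have habs : ∀ (k : ℕ) {r : ℝ}, 0 < r → |mlTerm α μ r k| = (-1) ^ k * mlTerm α μ r k := by
    intro k r hr
    have h1 : (-1 : ℝ) ^ k * mlTerm α μ r k = μ ^ k * (r ^ (α * k) / Real.Gamma (α * k + 1)) := by
      rw [mlTerm, ← mul_assoc, ← mul_pow]; norm_num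
    have h2 := Real.Gamma_pos_of_pos (show 0 < α * k + 1 by positivity)
    rw [h1, mlTerm, abs_mul, abs_pow, abs_neg, abs_of_pos hμ, abs_of_nonneg (by positivity)]
  have hbound : ∀ m : ℕ, ∀ t ∈ Set.Ioc 0 T,
      |u t - u₀ * ∑ k ∈ Finset.range m, mlTerm α μ t k| ≤ M * |mlTerm α μ t m| := by
    intro m
    induction m with
    | zero =>
      intro t ht
      simpa [mlTerm] using hM t ⟨ht.1.le, ht.2⟩
    | succ m ih =>
      intro t ht
      have hi1 : IntervalIntegrable (fun r => (t - r) ^ (α - 1) * u r) volume 0 t := by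
        have h := intervalIntegrable_beta hα0 one_pos ht.1
        simp only [sub_self, Real.rpow_zero, mul_one] at h
        refine h.mul_continuousOn (hu.mono ?_)
        rw [Set.uIcc_of_le ht.1.le]
        exact Set.Icc_subset_Icc_right ht.2
      have hi2 : IntervalIntegrable (fun r => (t - r) ^ (α - 1)
          * (u₀ * ∑ k ∈ Finset.range m, mlTerm α μ r k)) volume 0 t := by
        have h : IntervalIntegrable (∑ k ∈ Finset.range m, fun r =>
            u₀ * ((t - r) ^ (α - 1) * mlTerm α μ r k)) volume 0 t :=
          IntervalIntegrable.sum (Finset.range m)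
            (f := fun k r => u₀ * ((t - r) ^ (α - 1) * mlTerm α μ r k))
            fun k _ => (mlTerm_succ hα0 μ ht.1 k).1.const_mul u₀
        refine h.congr fun r _ => ?_
        simp only [Finset.sum_apply, Finset.mul_sum]
        exact Finset.sum_congr rfl fun k _ => by ring
      have hsum : u₀ * ∑ k ∈ Finset.range m, mlTerm α μ t (k + 1)
          = -(μ / Real.Gamma α) * ∫ r in (0 : ℝ)..t, (t - r) ^ (α - 1)
            * (u₀ * ∑ k ∈ Finset.range m, mlTerm α μ r k) := by
        have h : ∀ r, (t - r) ^ (α - 1) * (u₀ * ∑ k ∈ Finset.range m, mlTerm α μ r k)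
            = ∑ k ∈ Finset.range m, u₀ * ((t - r) ^ (α - 1) * mlTerm α μ r k) := by
          intro r
          simp only [Finset.mul_sum]
          exact Finset.sum_congr rfl fun k _ => by ring
        simp only [h]
        rw [intervalIntegral.integral_finsetSum fun k _ =>
          (mlTerm_succ hα0 μ ht.1 k).1.const_mul u₀, Finset.mul_sum, Finset.mul_sum]
        refine Finset.sum_congr rfl fun k _ => ?_
        rw [intervalIntegral.integral_const_mul, (mlTerm_succ hα0 μ ht.1 k).2]
        ring
      have hrem : u t - u₀ * ∑ k ∈ Finset.range (m + 1), mlTerm α μ t k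
          = -(μ / Real.Gamma α) * ∫ r in (0 : ℝ)..t, (t - r) ^ (α - 1)
            * (u r - u₀ * ∑ k ∈ Finset.range m, mlTerm α μ r k) := by
        have h0 : mlTerm α μ t 0 = 1 := by simp [mlTerm]
        simp only [mul_sub]
        rw [intervalIntegral.integral_sub hi1 hi2, Finset.sum_range_succ', mul_add, hsum, h0,
          hV t ht]
        ring
      rw [hrem, habs _ ht.1, (mlTerm_succ hα0 μ ht.1 m).2, abs_mul, abs_neg,
        abs_of_pos (by positivity)]
      have hle : |∫ r in (0 : ℝ)..t, (t - r) ^ (α - 1)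
          * (u r - u₀ * ∑ k ∈ Finset.range m, mlTerm α μ r k)|
          ≤ ∫ r in (0 : ℝ)..t, (M * (-1) ^ m) * ((t - r) ^ (α - 1) * mlTerm α μ r m) := by
        rw [← Real.norm_eq_abs]
        refine intervalIntegral.norm_integral_le_of_norm_le ht.1.le (ae_of_all _ fun r hr => ?_)
          ((mlTerm_succ hα0 μ ht.1 m).1.const_mul _)
        have hnn : 0 ≤ (t - r) ^ (α - 1) := Real.rpow_nonneg (by linarith [hr.2]) _
        rw [norm_mul, Real.norm_of_nonneg hnn, Real.norm_eq_abs]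
        refine (mul_le_mul_of_nonneg_left (ih r ⟨hr.1, hr.2.trans ht.2⟩) hnn).trans_eq ?_
        rw [habs _ hr.1]
        ring
      rw [intervalIntegral.integral_const_mul] at hle
      refine (mul_le_mul_of_nonneg_left hle (by positivity)).trans_eq ?_
      rw [pow_succ]
      ring
  have hs := summable_mlTerm hα0 hα1 hμ ht.1
  have h1 : Tendsto (fun m : ℕ => u t - u₀ * ∑ k ∈ Finset.range m, mlTerm α μ t k) atTop
      (𝓝 (u t - u₀ * ∑' k, mlTerm α μ t k)) :=
    (hs.hasSum.tendsto_sum_nat.const_mul u₀).const_sub (u t)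
  have h2 : Tendsto (fun m : ℕ => u t - u₀ * ∑ k ∈ Finset.range m, mlTerm α μ t k) atTop
      (𝓝 0) := by
    refine squeeze_zero_norm (fun m => hbound m t ht) ?_
    simpa using (hs.tendsto_atTop_zero.abs.const_mul M)
  exact sub_eq_zero.1 (tendsto_nhds_unique h1 h2)

/-- If a component of the Caputo derivative of an absolutely continuous function is `-μ` times the
same component of the function, then the latter is a multiple of the Mittag-Leffler function: the
fractional integral of order `α` undoes the Caputo derivative and leaves a Volterra equation. -/
theorem inner_eq_mul_tsum_mlTerm {F : Type*} [NormedAddCommGroup F] [InnerProductSpace ℝ F]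
    [CompleteSpace F] {α : ℝ} (hα0 : 0 < α) (hα1 : α < 1) {μ : ℝ} (hμ : 0 < μ) {T : ℝ}
    {v : ℝ → F} {e : F} (hint : IntervalIntegrable (deriv v) volume 0 T)
    (hac : ∀ t ∈ Set.Icc 0 T, v t = v 0 + ∫ ζ in (0 : ℝ)..t, deriv v ζ)
    (hode : ∀ᵐ t ∂(volume.restrict (Set.Ioc 0 T)),
      inner ℝ (caputoDeriv α v t) e = -μ * inner ℝ (v t) e)
    {t : ℝ} (ht : t ∈ Set.Ioc 0 T) : inner ℝ (v t) e = inner ℝ (v 0) e * ∑' k, mlTerm α μ t k := by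
  have hT : 0 < T := ht.1.trans_le ht.2
  refine eq_mul_tsum_mlTerm hα0 hα1 hμ (T := T) (u := fun t => inner ℝ (v t) e) ?_ ?_ ht
  · have h1 : ContinuousOn (fun t => v 0 + ∫ ζ in (0 : ℝ)..t, deriv v ζ) (Set.Icc 0 T) := by
      refine continuousOn_const.add ?_
      have := intervalIntegral.continuousOn_primitive_interval
        ((intervalIntegrable_iff_integrableOn_Icc_of_le hT.le).1 hint |>.mono_set
          (by rw [Set.uIcc_of_le hT.le]))
      rwa [Set.uIcc_of_le hT.le] at this
    exact (h1.congr hac).inner continuousOn_const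
  · intro t ht
    have hg : IntervalIntegrable (deriv v) volume 0 t :=
      hint.mono_set (by
        rw [Set.uIcc_of_le ht.1.le, Set.uIcc_of_le hT.le]; exact Set.Icc_subset_Icc_right ht.2)
    obtain ⟨hi, he⟩ := fractional_integral_comp hα0 hα1 ht.1 hg
    have hΓ := Real.Gamma_pos_of_pos hα0
    have hΓ' := Real.Gamma_pos_of_pos (show 0 < 1 - α by linarith)
    have hc : ∀ r, (t - r) ^ (α - 1) • ∫ s in (0 : ℝ)..r, (r - s) ^ (-α) • deriv v s
        = Real.Gamma (1 - α) • ((t - r) ^ (α - 1) • caputoDeriv α v r) := by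
      intro r
      rw [caputoDeriv, smul_comm (Real.Gamma (1 - α)), smul_inv_smul₀ hΓ'.ne']
    rw [show (∫ s in (0 : ℝ)..t, deriv v s) = v t - v 0 by
      rw [hac t ⟨ht.1.le, ht.2⟩, add_sub_cancel_left]] at he
    have h1 := congrArg (fun w => inner ℝ w e) he
    simp only [inner_smul_left, inner_sub_left, conj_trivial] at h1
    rw [intervalIntegral.integral_of_le ht.1.le, real_inner_comm,
      ← integral_inner ((intervalIntegrable_iff_integrableOn_Ioc_of_le ht.1.le).1 hi)] at h1
    have h2 : ∫ r in Set.Ioc 0 t, inner ℝ e ((t - r) ^ (α - 1)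
          • ∫ s in (0 : ℝ)..r, (r - s) ^ (-α) • deriv v s)
        = ∫ r in Set.Ioc 0 t, (-μ * Real.Gamma (1 - α)) * ((t - r) ^ (α - 1) * inner ℝ (v r) e) := by
      refine integral_congr_ae ?_
      filter_upwards [ae_restrict_of_ae_restrict_of_subset (Set.Ioc_subset_Ioc_right ht.2) hode]
        with r hr
      rw [hc, real_inner_comm, inner_smul_left, inner_smul_left, hr]
      simp only [conj_trivial]
      ring
    rw [h2, integral_const_mul, ← intervalIntegral.integral_of_le ht.1.le] at h1
    field_simp
    have h3 : Real.Gamma (1 - α) ≠ 0 := hΓ'.ne'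
    refine mul_left_cancel₀ h3 ?_
    linear_combination -h1

/-! ### The finite element space and the eigenfunctions of the discrete operator -/

/-- A continuous function on a normed space that is `L`-Lipschitz on each set of a finite closed
cover is `L`-Lipschitz: along a segment the estimate propagates from piece to piece. -/
theorem lipschitzWith_of_finite_closed_cover {ι E F : Type*} [Finite ι] [NormedAddCommGroup E]
    [NormedSpace ℝ E] [NormedAddCommGroup F] {C : ι → Set E} (hC : ∀ i, IsClosed (C i))
    (hcover : ∀ x, ∃ i, x ∈ C i) {v : E → F} (hv : Continuous v) {L : NNReal}
    (hL : ∀ i, LipschitzOnWith L v (C i)) : LipschitzWith L v := by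
  refine LipschitzWith.of_dist_le_mul fun x y => ?_
  set p : ℝ → E := fun t => x + t • (y - x) with hp
  have hpc : Continuous p := by fun_prop
  have hpd : ∀ s t, dist (p s) (p t) = |s - t| * dist y x := by
    intro s t
    rw [dist_eq_norm, dist_eq_norm, ← Real.norm_eq_abs, ← norm_smul, sub_smul]
    simp [hp]
  set S : Set ℝ := {t | dist (v (p t)) (v x) ≤ L * (t * dist y x)} with hS
  have hSc : IsClosed S := isClosed_le (by fun_prop) (by fun_prop)
  have h0 : (0 : ℝ) ∈ S := by simp [hS, hp]
  have hsub : Set.Icc (0 : ℝ) 1 ⊆ S := by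
    refine (hSc.inter isClosed_Icc).Icc_subset_of_forall_exists_gt h0 fun t ht b hb => ?_
    -- one piece contains points of the segment arbitrarily close to `t` on its right
    obtain ⟨i, hi⟩ : ∃ i, ∃ᶠ z in 𝓝[>] t, p z ∈ C i := by
      by_contra h
      simp only [not_exists, not_frequently] at h
      obtain ⟨z, hz⟩ := (eventually_all.2 h).exists
      obtain ⟨i, hi⟩ := hcover (p z)
      exact hz i hi
    have hti : p t ∈ C i := by
      have h1 : t ∈ closure (p ⁻¹' C i) :=
        mem_closure_iff_frequently.2 (hi.filter_mono nhdsWithin_le_nhds)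
      rwa [((hC i).preimage hpc).closure_eq] at h1
    obtain ⟨z, hz, hzb⟩ := (hi.and_eventually (Ioc_mem_nhdsGT hb)).exists
    refine ⟨z, ?_, hzb⟩
    have h1 := (hL i).dist_le_mul _ hz _ hti
    rw [hpd, abs_of_pos (sub_pos.2 hzb.1)] at h1
    have h2 : dist (v (p t)) (v x) ≤ L * (t * dist y x) := ht.1
    calc dist (v (p z)) (v x) ≤ dist (v (p z)) (v (p t)) + dist (v (p t)) (v x) :=
          dist_triangle _ _ _
      _ ≤ L * ((z - t) * dist y x) + L * (t * dist y x) := add_le_add h1 h2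
      _ = L * (z * dist y x) := by ring
  have h1 : dist (v (p 1)) (v x) ≤ L * (1 * dist y x) := hsub (by simp)
  rw [dist_comm (v x), dist_comm x]
  simpa [hp] using h1

section FiniteElementSpace

variable {d : ℕ} {Ω : BoundedDomain d} (K : Triangulation Ω)

/-- Finite element functions are Lipschitz: the closed simplices and the complement of `Ω` cover the
whole space. -/
theorem exists_lipschitzWith (v : K.space) :
    ∃ C : NNReal, LipschitzWith C (v : EuclideanSpace ℝ (Fin d) → ℝ) := by
  obtain ⟨v, hv, hv0, hva⟩ := v
  have : Finite K.complex.faces := K.finite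
  choose g hg using fun s : K.complex.faces => hva s.1 s.2
  obtain ⟨M, hM⟩ := Finite.exists_le fun s => ‖(g s).linear.toContinuousLinearMap‖₊
  refine ⟨M, lipschitzWith_of_finite_closed_cover (ι := Option K.complex.faces)
    (C := fun o => o.elim Ω.carrierᶜ
      fun s => convexHull ℝ ((s : Finset (EuclideanSpace ℝ (Fin d))) : Set _))
    ?_ ?_ hv ?_⟩
  · rintro (_ | s)
    · exact Ω.isOpen.isClosed_compl
    · exact (s.1.finite_toSet.isCompact_convexHull (𝕜 := ℝ)).isClosed
  · intro x
    by_cases hx : x ∈ Ω.carrier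
    · have h1 : x ∈ K.complex.space := K.space_eq ▸ subset_closure hx
      obtain ⟨s, hs, hxs⟩ := Geometry.SimplicialComplex.mem_space_iff.1 h1
      exact ⟨some ⟨s, hs⟩, hxs⟩
    · exact ⟨none, hx⟩
  · rintro (_ | s)
    · refine LipschitzOnWith.of_dist_le_mul fun x hx y hy => ?_
      simp only [hv0 x hx, hv0 y hy, dist_self]
      positivity
    · refine LipschitzOnWith.of_dist_le_mul fun x hx y hy => ?_
      have h1 : v x - v y = (g s).linear.toContinuousLinearMap (x - y) := by
        rw [hg s x hx, hg s y hy, ← vsub_eq_sub, ← AffineMap.linearMap_vsub]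
        rfl
      rw [dist_eq_norm, dist_eq_norm]
      simp only [h1]
      refine (ContinuousLinearMap.le_opNorm _ _).trans ?_
      exact mul_le_mul_of_nonneg_right (hM s) (norm_nonneg _)

theorem exists_abs_le (v : K.space) :
    ∃ C : ℝ, ∀ x, |(v : EuclideanSpace ℝ (Fin d) → ℝ) x| ≤ C := by
  have h : HasCompactSupport (v : EuclideanSpace ℝ (Fin d) → ℝ) :=
    HasCompactSupport.intro Ω.isBounded.isCompact_closure fun x hx =>
      v.2.2.1 x fun h => hx (subset_closure h)
  exact h.exists_bound_of_continuous v.2.1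

/-- A finite element function is determined by its values at the vertices. -/
instance finiteDimensional_space : FiniteDimensional ℝ K.space := by
  have : Finite K.complex.vertices := by
    rw [Geometry.SimplicialComplex.vertices_eq]
    exact K.finite.biUnion fun s _ => s.finite_toSet
  let r : K.space →ₗ[ℝ] (K.complex.vertices → ℝ) :=
    { toFun := fun v p => (v : EuclideanSpace ℝ (Fin d) → ℝ) p
      map_add' := fun _ _ => rfl
      map_smul' := fun _ _ => rfl }
  refine FiniteDimensional.of_injective r ((injective_iff_map_eq_zero r).2 fun v hv => ?_)
  refine Subtype.ext (funext fun x => ?_)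
  by_cases hx : x ∈ Ω.carrier
  · have h1 : x ∈ K.complex.space := K.space_eq ▸ subset_closure hx
    obtain ⟨s, hs, hxs⟩ := Geometry.SimplicialComplex.mem_space_iff.1 h1
    obtain ⟨g, hg⟩ := v.2.2.2 s hs
    have h2 : convexHull ℝ (s : Set (EuclideanSpace ℝ (Fin d))) ⊆ g ⁻¹' {0} := by
      refine convexHull_min (fun p hp => ?_) ((convex_singleton 0).affine_preimage g)
      have hpv : p ∈ K.complex.vertices := by
        rw [Geometry.SimplicialComplex.vertices_eq]
        exact Set.mem_biUnion hs hp
      have h3 := congrFun hv ⟨p, hpv⟩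
      exact (hg p (subset_convexHull ℝ _ hp)).symm.trans h3
    exact (hg x hxs).trans (h2 hxs)
  · exact v.2.2.1 x hx

theorem inner_toL2 (v w : K.space) : inner ℝ (K.toL2 v) (K.toL2 w)
    = ∫ x, (v : EuclideanSpace ℝ (Fin d) → ℝ) x * (w : EuclideanSpace ℝ (Fin d) → ℝ) x ∂Ω.vol := by
  rw [L2.inner_def]
  refine integral_congr_ae ?_
  filter_upwards [(K.memLp v).coeFn_toLp, (K.memLp w).coeFn_toLp] with x hx hy
  refine (congrArg₂ (inner ℝ) hx hy).trans ?_
  simp [mul_comm]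

theorem toL2_injective : Function.Injective K.toL2 := by
  refine (injective_iff_map_eq_zero K.toL2).2 fun v hv => Subtype.ext (funext fun x => ?_)
  by_cases hx : x ∈ Ω.carrier
  · have h1 : (v : EuclideanSpace ℝ (Fin d) → ℝ) =ᵐ[Ω.vol] fun _ => 0 := by
      have h2 : (K.toL2 v : EuclideanSpace ℝ (Fin d) → ℝ) =ᵐ[Ω.vol] fun _ => 0 := by
        rw [hv]
        exact Lp.coeFn_zero ℝ 2 Ω.vol
      exact (K.memLp v).coeFn_toLp.symm.trans h2
    exact Measure.eqOn_open_of_ae_eq h1 Ω.isOpen v.2.1.continuousOn continuousOn_const hx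
  · exact v.2.2.1 x hx

instance isFiniteMeasure_vol : IsFiniteMeasure Ω.vol :=
  ⟨by rw [Measure.restrict_apply_univ]; exact Ω.isBounded.measure_lt_top⟩

theorem abs_partialDeriv_le {v : EuclideanSpace ℝ (Fin d) → ℝ} {C : NNReal}
    (hv : LipschitzWith C v) (i : Fin d) (x : EuclideanSpace ℝ (Fin d)) :
    |partialDeriv i v x| ≤ C := by
  have h1 := (fderiv ℝ v x).le_opNorm (EuclideanSpace.single i 1)
  rw [PiLp.norm_single, norm_one, mul_one] at h1
  exact h1.trans (norm_fderiv_le_of_lipschitz ℝ hv)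

theorem integrable_ellipticForm (A : EllipticOperator Ω) (v w : K.space) :
    Integrable (fun x => (∑ i, ∑ j, A.a x i j * partialDeriv j v x * partialDeriv i w x)
      + A.q x * (v : EuclideanSpace ℝ (Fin d) → ℝ) x * (w : EuclideanSpace ℝ (Fin d) → ℝ) x)
      Ω.vol := by
  obtain ⟨Cv, hCv⟩ := exists_lipschitzWith K v
  obtain ⟨Cw, hCw⟩ := exists_lipschitzWith K w
  obtain ⟨Bv, hBv⟩ := exists_abs_le K v
  obtain ⟨Bw, hBw⟩ := exists_abs_le K w
  obtain ⟨Ma, hMa⟩ := A.bounded_a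
  obtain ⟨Mq, hMq⟩ := A.bounded_q
  have hmem : ∀ᵐ x ∂Ω.vol, x ∈ Ω.carrier := ae_restrict_mem Ω.isOpen.measurableSet
  have hbound : ∀ {a b c A B C : ℝ}, |a| ≤ A → |b| ≤ B → |c| ≤ C → ‖a * b * c‖ ≤ A * B * C := by
    intro a b c A B C ha hb hc
    rw [norm_mul, norm_mul]
    have := (abs_nonneg a).trans ha
    have := (abs_nonneg b).trans hb
    exact mul_le_mul (mul_le_mul ha hb (abs_nonneg _) ‹_›) hc (abs_nonneg _) (by positivity)
  refine Integrable.add (integrable_finsetSum _ fun i _ => integrable_finsetSum _ fun j _ => ?_) ?_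
  · refine Integrable.of_bound (C := Ma * Cv * Cw) ?_ ?_
    · exact ((A.measurable_a i j).mul
        (measurable_fderiv_apply_const ℝ _ _).aestronglyMeasurable).mul
        (measurable_fderiv_apply_const ℝ _ _).aestronglyMeasurable
    · filter_upwards [hmem] with x hx
      exact hbound (hMa x hx i j) (abs_partialDeriv_le hCv j x) (abs_partialDeriv_le hCw i x)
  · refine Integrable.of_bound (C := Mq * Bv * Bw) ?_ ?_
    · exact (A.measurable_q.mul v.2.1.aestronglyMeasurable).mul w.2.1.aestronglyMeasurable
    · filter_upwards [hmem] with x hx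
      exact hbound (hMq x hx) (hBv x) (hBw x)

theorem form_comm (A : EllipticOperator Ω) (v w : EuclideanSpace ℝ (Fin d) → ℝ) :
    A.form v w = A.form w v := by
  refine integral_congr_ae ?_
  filter_upwards [ae_restrict_mem Ω.isOpen.measurableSet] with x hx
  congr 1
  · rw [Finset.sum_comm]
    refine Finset.sum_congr rfl fun i _ => Finset.sum_congr rfl fun j _ => ?_
    rw [A.symmetric x hx j i]
    ring
  · ring

/-- Additivity of the form: the partial derivatives are additive only almost everywhere, by
Rademacher's theorem. -/
theorem form_add_left (A : EllipticOperator Ω) (v₁ v₂ w : K.space) :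
    A.form ↑(v₁ + v₂) w = A.form v₁ w + A.form v₂ w := by
  obtain ⟨C₁, h₁⟩ := exists_lipschitzWith K v₁
  obtain ⟨C₂, h₂⟩ := exists_lipschitzWith K v₂
  unfold EllipticOperator.form ellipticForm
  rw [← integral_add (integrable_ellipticForm K A v₁ w) (integrable_ellipticForm K A v₂ w)]
  refine integral_congr_ae ?_
  filter_upwards [ae_restrict_of_ae h₁.ae_differentiableAt,
    ae_restrict_of_ae h₂.ae_differentiableAt] with x hx₁ hx₂
  rw [Submodule.coe_add]
  have h : ∀ j, partialDeriv j ((v₁ : EuclideanSpace ℝ (Fin d) → ℝ)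
      + (v₂ : EuclideanSpace ℝ (Fin d) → ℝ)) x = partialDeriv j v₁ x + partialDeriv j v₂ x := by
    intro j
    rw [partialDeriv, fderiv_add hx₁ hx₂]
    rfl
  simp only [h, Pi.add_apply, mul_add, add_mul, Finset.sum_add_distrib]
  ring

theorem form_smul_left (A : EllipticOperator Ω) (c : ℝ) (v w : K.space) :
    A.form ↑(c • v) w = c * A.form v w := by
  unfold EllipticOperator.form ellipticForm
  rw [← integral_const_mul]
  refine integral_congr_ae (ae_of_all _ fun x => ?_)
  rw [Submodule.coe_smul]
  have h : ∀ j, partialDeriv j (c • (v : EuclideanSpace ℝ (Fin d) → ℝ)) x = c * partialDeriv j v x := by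
    intro j
    rw [partialDeriv, fderiv_const_smul_field]
    rfl
  simp only [h, Pi.smul_apply, smul_eq_mul, mul_add, Finset.mul_sum]
  congr 1
  · exact Finset.sum_congr rfl fun i _ => Finset.sum_congr rfl fun j _ => by ring
  · ring

/-- The bilinear form of the elliptic operator on the finite element space. -/
noncomputable def discreteForm (A : EllipticOperator Ω) : K.space →ₗ[ℝ] K.space →ₗ[ℝ] ℝ :=
  LinearMap.mk₂ ℝ (fun v w => A.form v w) (form_add_left K A) (form_smul_left K A)
    (fun v w₁ w₂ => by
      rw [form_comm, form_add_left, form_comm, form_comm A w₂])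
    (fun c v w => by
      rw [form_comm, form_smul_left, form_comm, smul_eq_mul])

theorem form_self_pos (A : EllipticOperator Ω) {v : K.space} (hv : v ≠ 0) : 0 < A.form v v := by
  obtain ⟨c, hc, h⟩ := A.posDef
  refine lt_of_lt_of_le ?_ (h v (exists_lipschitzWith K v) v.2.2.1)
  have h1 : K.toL2 v ≠ 0 := fun h0 => hv (toL2_injective K (h0.trans (map_zero _).symm))
  have h2 := real_inner_self_pos.2 h1
  rw [inner_toL2] at h2
  simp only [pow_two]
  exact mul_pos hc h2

end FiniteElementSpace

/-- A symmetric positive definite bilinear form on a finite-dimensional inner product space is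
diagonal with positive entries in some orthonormal basis. -/
theorem exists_orthonormalBasis_diagonal {H : Type*} [NormedAddCommGroup H]
    [InnerProductSpace ℝ H] [FiniteDimensional ℝ H] (B : H →ₗ[ℝ] H →ₗ[ℝ] ℝ)
    (hsymm : ∀ x y, B x y = B y x) (hpos : ∀ x, x ≠ 0 → 0 < B x x) :
    ∃ (b : OrthonormalBasis (Fin (Module.finrank ℝ H)) ℝ H) (l : Fin (Module.finrank ℝ H) → ℝ),
      (∀ i, 0 < l i) ∧ ∀ x i, B x (b i) = l i * inner ℝ x (b i) := by
  have := FiniteDimensional.complete ℝ H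
  let S : H →ₗ[ℝ] H :=
    { toFun := fun x => (InnerProductSpace.toDual ℝ H).symm (B x).toContinuousLinearMap
      map_add' := fun x y => by simp
      map_smul' := fun c x => by simp }
  have hS : ∀ x y, inner ℝ (S x) y = B x y := fun x y => by
    simp [S, InnerProductSpace.toDual_symm_apply]
  have hSs : S.IsSymmetric := fun x y => by
    rw [hS, real_inner_comm, hS, hsymm]
  have hdiag : ∀ x i, B x (hSs.eigenvectorBasis rfl i)
      = hSs.eigenvalues rfl i * inner ℝ x (hSs.eigenvectorBasis rfl i) := by
    intro x i
    rw [hsymm, ← hS, hSs.apply_eigenvectorBasis, real_inner_smul_left, real_inner_comm]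
    rfl
  refine ⟨hSs.eigenvectorBasis rfl, hSs.eigenvalues rfl, fun i => ?_, hdiag⟩
  have h1 := hpos _ ((hSs.eigenvectorBasis rfl).orthonormal.ne_zero i)
  rw [hdiag, real_inner_self_eq_norm_sq, (hSs.eigenvectorBasis rfl).orthonormal.1 i] at h1
  simpa using h1

/-- The discrete operator `A_h` has positive eigenvalues `l i` and eigenfunctions `φ i`, orthonormal
in `L²(Ω)`, for which Parseval's identity holds on the finite element space. -/
theorem exists_eigenfunctions {d : ℕ} {Ω : BoundedDomain d} (K : Triangulation Ω)
    (A : EllipticOperator Ω) :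
    ∃ (n : ℕ) (φ : Fin n → K.space) (l : Fin n → ℝ), (∀ i, 0 < l i) ∧
      (∀ (v : K.space) i, A.form v (φ i) = l i * inner ℝ (K.toL2 v) (K.toL2 (φ i))) ∧
      ∀ v : K.space, ‖K.toL2 v‖ ^ 2 = ∑ i, inner ℝ (K.toL2 v) (K.toL2 (φ i)) ^ 2 := by
  set e := LinearEquiv.ofInjective K.toL2 (toL2_injective K) with he
  have hec : ∀ v, (e v : Ω.L2) = K.toL2 v := fun v => rfl
  have : FiniteDimensional ℝ (LinearMap.range K.toL2) := inferInstance
  obtain ⟨b, l, hl, hb⟩ := exists_orthonormalBasis_diagonal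
    ((discreteForm K A).compl₁₂ e.symm.toLinearMap e.symm.toLinearMap)
    (fun x y => form_comm A _ _)
    (fun x hx => form_self_pos K A fun h => hx (e.symm.map_eq_zero_iff.1 h))
  have hφ : ∀ i, K.toL2 (e.symm (b i)) = b i := fun i => by rw [← hec, e.apply_symm_apply]
  refine ⟨_, fun i => e.symm (b i), l, hl, fun v i => ?_, fun v => ?_⟩
  · have h1 := hb (e v) i
    have h2 : inner ℝ (e v) (b i) = inner ℝ (K.toL2 v) (b i : Ω.L2) := rfl
    rw [hφ, ← h2, ← h1]
    change _ = A.form (e.symm (e v)) (e.symm (b i))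
    rw [e.symm_apply_apply]
  · have h1 := b.sum_sq_norm_inner_left (e v)
    have h2 : ‖e v‖ = ‖K.toL2 v‖ := rfl
    rw [← h2, ← h1]
    refine Finset.sum_congr rfl fun i _ => ?_
    rw [hφ, Real.norm_eq_abs, sq_abs]
    rfl

/-! ### Diagonalization and the error estimate -/

/-- Scaling to unit step size of the discrete derivative of the powers. -/
theorem bdf2_powerGrid (α : ℝ) {τ : ℝ} (hτ : 0 < τ) (n : ℤ) :
    bdf2 τ (powerGrid α τ) n = τ ^ (1 - α) * bdf2 1 (powerGrid α 1) n := by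
  have h : ∀ k, powerGrid α τ k = τ ^ (2 - α) * powerGrid α 1 k := by
    intro k
    by_cases hk : 0 < k
    · have hk' : (0 : ℝ) ≤ k := by exact_mod_cast hk.le
      rw [powerGrid, powerGrid, if_pos hk, if_pos hk, mul_one, Real.mul_rpow hk' hτ.le]
      ring
    · simp [powerGrid, hk]
  have h2 : τ ^ (2 - α) = τ * τ ^ (1 - α) := by
    rw [show 2 - α = 1 + (1 - α) by ring, Real.rpow_add hτ, Real.rpow_one]
  simp only [bdf2, h, h2, smul_eq_mul, inv_one, one_mul]
  field_simp

theorem mlTerm_mul_right {α : ℝ} (l : ℝ) {t τ : ℝ} (ht : 0 ≤ t) (hτ : 0 ≤ τ) (k : ℕ) :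
    mlTerm α l (t * τ) k = mlTerm α (l * τ ^ α) t k := by
  rw [mlTerm, mlTerm, Real.mul_rpow ht hτ, Real.rpow_mul hτ, Real.rpow_natCast]
  rw [show -(l * τ ^ α) = -l * τ ^ α by ring, mul_pow]
  ring

section ErrorEstimate

variable {d : ℕ} {Ω : BoundedDomain d} {A : EllipticOperator Ω} {K : Triangulation Ω}
  {α T : ℝ} {N : ℕ}

/-- The component of the scheme along an eigenfunction is a scalar scheme with step size one. -/
theorem inner_scheme_eq (hα0 : 0 < α) (hα1 : α < 1) (hT : 0 < T) (hN : 0 < N) {v0 : K.space}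
    {U w : ℤ → K.space} (h : IsCNSolution A K α T N (fun _ => 0) v0 U w) {φ : K.space} {l : ℝ}
    (hl : 0 < l) (hφ : ∀ v : K.space, A.form v φ = l * inner ℝ (K.toL2 v) (K.toL2 φ))
    {n : ℕ} (hn1 : 1 ≤ n) (hnN : n ≤ N) :
    ((inner ℝ (K.toL2 (w n)) (K.toL2 φ) : ℝ) : ℂ)
      = (inner ℝ (K.toL2 v0) (K.toL2 φ) : ℝ)
        * taylorCoeff (schemeFun α (l * (T / N) ^ α)) n := by
  have hτ : 0 < T / N := div_pos hT (by exact_mod_cast hN)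
  have hμ : 0 < l * (T / N) ^ α := mul_pos hl (Real.rpow_pos_of_pos hτ _)
  have hstep := h.step
  have hvel := h.velocity n hn1 hnN
  set τ := T / N with hτdef
  set v : ℝ := inner ℝ (K.toL2 v0) (K.toL2 φ) with hv
  set y : ℤ → ℝ := fun k => τ⁻¹ * inner ℝ (K.toL2 (U k)) (K.toL2 φ) with hy
  have hyU : ∀ k, inner ℝ (K.toL2 (U k)) (K.toL2 φ) = τ * y k := fun k => by
    rw [hy]; field_simp
  have hy0 : ∀ k ≤ 0, y k = 0 := fun k hk => by simp [hy, h.zero k hk]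
  have hys : ∀ n : ℕ, 1 ≤ n → n ≤ N →
      ∑ j ∈ Finset.range (n + 1), glWeight α j * y (n - j)
        + (l * τ ^ α) * ((1 - α / 2) * y n + (α / 2) * y (n - 1))
      = ((1 - α / 2) * bdf2 1 (powerGrid α 1) n
        + (α / 2) * bdf2 1 (powerGrid α 1) (n - 1)) * v := by
    intro n hn1 hnN
    have h1 := hstep n hn1 hnN φ
    simp only [hφ, map_smul, map_sum, real_inner_smul_left, sum_inner, hyU, inner_zero_left,
      bdf2_powerGrid α hτ, ← hv] at h1
    have h2 : ∑ j ∈ Finset.range (n + 1), glWeight α j * (τ * y (n - j))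
        = τ * ∑ j ∈ Finset.range (n + 1), glWeight α j * y (n - j) := by
      rw [Finset.mul_sum]
      exact Finset.sum_congr rfl fun j _ => by ring
    rw [h2] at h1
    have h3 : τ ^ (1 - α) = τ * τ ^ (-α) := by
      rw [show 1 - α = 1 + -α by ring, Real.rpow_add hτ, Real.rpow_one]
    have h4 : τ ^ (-α) * τ ^ α = 1 := by
      rw [← Real.rpow_add hτ, neg_add_cancel, Real.rpow_zero]
    have h5 : 0 < τ ^ (-α) := Real.rpow_pos_of_pos hτ _
    rw [h3] at h1
    refine mul_left_cancel₀ (mul_pos hτ h5).ne' ?_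
    linear_combination h1 + τ * l * ((1 - α / 2) * y n + (α / 2) * y (n - 1)) * h4
  have hc := eq_taylorCoeff_unknownFun hα0 hα1 hμ hy0 hys
  have hw : inner ℝ (K.toL2 (w n)) (K.toL2 φ)
      = 3 / 2 * y n - 2 * y (n - 1) + 1 / 2 * y (n - 2) := by
    rw [hvel, bdf2]
    simp only [map_smul, map_add, map_sub, real_inner_smul_left, inner_add_left, inner_sub_left,
      hyU]
    field_simp
  have ha : AnalyticAt ℂ (unknownFun α (l * τ ^ α)) 0 :=
    (differentiableOn_unknownFun hα0 hα1 hμ).analyticAt (Metric.ball_mem_nhds 0 one_pos)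
  rw [schemeFun_eq, taylorCoeff_bdfSymbol_mul ha, hw]
  push_cast
  rw [hc n (by omega), hc (n - 1) (by omega), hc (n - 2) (by omega)]
  simp only [bdf2, inv_one, one_smul, Complex.real_smul]
  push_cast
  ring

/-- The scalar estimate, applied to each component in a basis of eigenfunctions, carries over to the
`L²(Ω)` norm by Parseval's identity. -/
theorem norm_sub_le_of_isCNSolution {c : ℝ} (hα0 : 0 < α) (hα1 : α < 1) (hc0 : 0 < c)
    (hc : ∀ μ : ℝ, 0 < μ → ∀ n : ℕ, 1 ≤ n →
      ‖((∑' k, mlTerm α μ n k : ℝ) : ℂ) - taylorCoeff (schemeFun α μ) n‖ ≤ c * ((n : ℝ) ^ 2)⁻¹)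
    (hT : 0 < T) (hN : 0 < N) {u0 : Ω.L2} {u : ℝ → K.space}
    (hu : IsSemidiscreteSolution A K α T (fun _ => 0) u0 u) {U w : ℤ → K.space}
    (hw : IsCNSolution A K α T N (fun _ => 0) (u 0) U w) {n : ℕ} (hn1 : 1 ≤ n) (hnN : n ≤ N) :
    ‖K.toL2 (u (n * (T / N))) - K.toL2 (w n)‖
      ≤ c * (T / N) ^ 2 * ((n * (T / N)) ^ 2)⁻¹ * ‖u0‖ := by
  have hN' : (0 : ℝ) < N := by exact_mod_cast hN
  have hn' : (0 : ℝ) < n := by exact_mod_cast hn1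
  have hτ : 0 < T / N := div_pos hT hN'
  have ht : (n : ℝ) * (T / N) ∈ Set.Ioc 0 T := by
    refine ⟨mul_pos hn' hτ, ?_⟩
    calc (n : ℝ) * (T / N) ≤ N * (T / N) :=
          mul_le_mul_of_nonneg_right (by exact_mod_cast hnN) hτ.le
      _ = T := by field_simp
  obtain ⟨m, φ, l, hl, hφ, hpars⟩ := exists_eigenfunctions K A
  have hcomp : ∀ i, |inner ℝ (K.toL2 (u (n * (T / N)) - w n)) (K.toL2 (φ i))|
      ≤ c * ((n : ℝ) ^ 2)⁻¹ * |inner ℝ (K.toL2 (u 0)) (K.toL2 (φ i))| := by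
    intro i
    have h1 : inner ℝ (K.toL2 (u (n * (T / N)))) (K.toL2 (φ i))
        = inner ℝ (K.toL2 (u 0)) (K.toL2 (φ i)) * ∑' k, mlTerm α (l i * (T / N) ^ α) n k := by
      simp only [← mlTerm_mul_right (l i) hn'.le hτ.le]
      refine inner_eq_mul_tsum_mlTerm (v := fun t => K.toL2 (u t)) hα0 hα1 (hl i)
        hu.integrable_deriv hu.eq_integral_deriv ?_ ht
      filter_upwards [hu.equation] with t ht
      have h2 := ht (φ i)
      rw [hφ, inner_zero_left] at h2
      linear_combination h2
    have h2 := inner_scheme_eq hα0 hα1 hT hN hw (hl i) (fun v => hφ v i) hn1 hnN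
    have h3 := hc _ (mul_pos (hl i) (Real.rpow_pos_of_pos hτ α)) n hn1
    rw [map_sub, inner_sub_left, ← Real.norm_eq_abs, ← Complex.norm_real, Complex.ofReal_sub, h1,
      h2, Complex.ofReal_mul, ← mul_sub, norm_mul, Complex.norm_real, Real.norm_eq_abs, mul_comm]
    exact mul_le_mul_of_nonneg_right h3 (abs_nonneg _)
  have hnorm : ‖K.toL2 (u (n * (T / N)) - w n)‖ ≤ c * ((n : ℝ) ^ 2)⁻¹ * ‖K.toL2 (u 0)‖ := by
    refine abs_le_of_sq_le_sq' ?_ (by positivity) |>.2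
    rw [mul_pow, hpars, hpars, Finset.mul_sum]
    refine Finset.sum_le_sum fun i _ => ?_
    rw [← sq_abs, ← sq_abs (inner ℝ (K.toL2 (u 0)) _), ← mul_pow]
    exact pow_le_pow_left₀ (abs_nonneg _) (hcomp i) 2
  have hproj : ‖K.toL2 (u 0)‖ ≤ ‖u0‖ := by
    have h1 := hu.initial (u 0)
    rw [real_inner_self_eq_norm_sq] at h1
    have h2 := real_inner_le_norm u0 (K.toL2 (u 0))
    rw [← h1, pow_two] at h2
    rcases (norm_nonneg (K.toL2 (u 0))).eq_or_lt with h0 | h0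
    · rw [← h0]; exact norm_nonneg _
    · exact le_of_mul_le_mul_right h2 h0
  rw [← map_sub]
  refine hnorm.trans ((mul_le_mul_of_nonneg_left hproj (by positivity)).trans_eq ?_)
  field_simp

theorem isCNI_zero_iff {v0 : K.space} {U w : ℤ → K.space} :
    IsCNI A K α T N (fun _ => 0) v0 U w ↔ IsCNSolution A K α T N (fun _ => 0) v0 U w := by
  simp [IsCNI, primitive]

theorem isCNII_zero_iff {v0 : K.space} {U w : ℤ → K.space} :
    IsCNII A K α T N (fun _ => 0) v0 U w ↔ IsCNSolution A K α T N (fun _ => 0) v0 U w := by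
  have h : (bdf2 (T / N) fun k : ℤ => primitive (primitive fun _ => (0 : Ω.L2)) (k * (T / N)))
      = fun _ => 0 := by
    ext1 k
    simp [bdf2, primitive]
  rw [IsCNII, h]

end ErrorEstimate

end SubDiffusion

theorem mainTheorem3 (α : ℝ) (hα0 : 0 < α) (hα1 : α < 1) :
    ∃ c : ℝ, 0 < c ∧
      ∀ (d : ℕ), (d = 1 ∨ d = 2) →
      ∀ (Ω : SubDiffusion.BoundedDomain d) (A : SubDiffusion.EllipticOperator Ω)
        (K : SubDiffusion.Triangulation Ω) (T : ℝ) (N : ℕ), 0 < T → 0 < N →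
      ∀ (u0 : Ω.L2) (u : ℝ → K.space),
        SubDiffusion.IsSemidiscreteSolution A K α T (fun _ => 0) u0 u →
      ∀ (U w : ℤ → K.space),
        (SubDiffusion.IsCNI A K α T N (fun _ => 0) (u 0) U w ↔
          SubDiffusion.IsCNII A K α T N (fun _ => 0) (u 0) U w) ∧
        (SubDiffusion.IsCNI A K α T N (fun _ => 0) (u 0) U w →
          ∀ n : ℕ, 1 ≤ n → n ≤ N →
            ‖K.toL2 (u (n * (T / N))) - K.toL2 (w n)‖
              ≤ c * (T / N) ^ 2 * ((n * (T / N)) ^ 2)⁻¹ * ‖u0‖) ∧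
        (SubDiffusion.IsCNII A K α T N (fun _ => 0) (u 0) U w →
          ∀ n : ℕ, 1 ≤ n → n ≤ N →
            ‖K.toL2 (u (n * (T / N))) - K.toL2 (w n)‖
              ≤ c * (T / N) ^ 2 * ((n * (T / N)) ^ 2)⁻¹ * ‖u0‖) := by
  obtain ⟨c, hc0, hc⟩ := SubDiffusion.exists_scalar_error hα0 hα1
  refine ⟨c, hc0, fun d _ Ω A K T N hT hN u0 u hu U w => ?_⟩
  rw [SubDiffusion.isCNI_zero_iff, SubDiffusion.isCNII_zero_iff]
  have key := fun (h : SubDiffusion.IsCNSolution A K α T N (fun _ => 0) (u 0) U w) (n : ℕ)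
    (h1 : 1 ≤ n) (h2 : n ≤ N) =>
      SubDiffusion.norm_sub_le_of_isCNSolution hα0 hα1 hc0 hc hT hN hu h h1 h2
  exact ⟨Iff.rfl, key, key⟩
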